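/- **Proposition 2.5 (stability of partial Bessel functions of Howe vectors).** *Fields and group.* Let $E/F$ be an unramified quadratic extension of non-archimedean local fields with rings of integers $\mathcal O_E,\mathcal O_F$ and maximal ideals $\mathcal P_E,\mathcal P_F$, let $x\mapsto\bar x$ be the nontrivial Galois conjugation, and let $\varpi\in F$ be a uniformizer of $F$ (hence of $E$). Let $$G=\mathrm U(2,2)=\{g\in \mathrm{GL}_4(E): g\,s\,{}^t\bar g=s\},\qquad s=\begin{pmatrix}0&1_2\\-1_2&0\end{pmatrix},$$ with the topology of $\mathrm{GL}_4(E)$. Let $T=\{\mathbf t(a_1,a_2)=\mathrm{diag}(a_1,a_2,\bar a_1^{-1},\bar a_2^{-1}): a_1,a_2\in E^\times\}$, and let $U$ be the group of all elements $$u=\begin{pmatrix}1&x&&\\&1&&\\&&1&\\&&-\bar x&1\end{pmatrix}\begin{pmatrix}1&&z&y\\&1&\bar y&b\\&&1&\\&&&1\end{pmatrix}\qquad(x,y\in E,\ z,b\in F).$$ Put $B=TU$. *Weyl group.* Let $\mathbf W$ be the Weyl group of $G$ (dihedral of order 8), generated by the simple reflections $s_\alpha$ (which exchanges $a_1$ and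 $a_2$ in $\mathbf t(a_1,a_2)$) and $s_\beta$ (which replaces $a_2$ by $\bar a_2^{-1}$). Let $l$ be the length function and $\le$ the Bruhat order: $w'\le w$ if $w'$ is the product of a subword of a reduced word of $w$; $w'<w$ means $w'\le w$ and $w'\ne w$. Put $$\dot s_\alpha=\begin{pmatrix}&1&&\\1&&&\\&&&1\\&&1&\end{pmatrix},\qquad \dot s_\beta=\begin{pmatrix}1&&&\\&&&1\\&&1&\\&-1&&\end{pmatrix},$$ and let $\dot w$ be the product of these matrices along a reduced word of $w$ (it does not depend on the reduced word). Let $U_w^-=\{u\in U: \dot w u\dot w^{-1}\in {}^tU\}$, which is the product of the root subgroups of the positive roots $\gamma$ with $w(\gamma)<0$. *Characters.* Let $\psi$ and $\psi_E$ be unramified additive characters of $F$ and $E$ (continuous unitary characters for which $\mathcal O_F$, respectively $\mathcal O_E$, is the largest fractional ideal on which the character is trivial) with $\psi_E|_F=1$. For $u\in U$ written as above put $\psi_U(u)=\psi_E(-x)\psi(b)$. *Compact open subgroups.* For $m\ge 1$ let $K_m=(1+\mathrm{Mat}_4(\mathcal P_E^m))\cap G$, $d_m=\mathbf t(\varpi^{-3m},\varpi^{-m})$,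 $H_m=d_mK_md_m^{-1}$, $U_m=U\cap H_m$ and $U_{w,m}^-=U_w^-\cap H_m$. *Howe vectors.* Let $(\pi,V)$ and $(\pi',V')$ be irreducible smooth complex representations of $G$ with the same central character, with nonzero linear functionals $\lambda$ on $V$ and $\lambda'$ on $V'$ such that $\lambda(\pi(u)\xi)=\psi_U(u)\lambda(\xi)$ for $u\in U,\ \xi\in V$, and likewise for $\lambda'$. Write $W_\xi(g)=\lambda(\pi(g)\xi)$ for $\xi\in V$, and $W_{\xi'}(g)=\lambda'(\pi'(g)\xi')$ for $\xi'\in V'$. Let $v\in V$, $v'\in V'$ with $W_v(1)=W_{v'}(1)=1$, and let $C\ge1$ be an integer such that $\pi(K_C)$ fixes $v$ and $\pi'(K_C)$ fixes $v'$. For $m\ge C$ put $$v_m=\frac1{\mathrm{Vol}(U_m)}\int_{U_m}\psi_U(u)^{-1}\pi(u)v\,du,\qquad v'_m=\frac1{\mathrm{Vol}(U_m)}\int_{U_m}\psi_U(u)^{-1}\pi'(u)v'\,du,$$ where $du$ is a Haar measure on $U$. *Statement.* Let $w\in\mathbf W$, let $a_0,\dots,a_{l(w)}$ be integers with $a_0=0$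 and $a_t\ge t+a_{t-1}$ for $1\le t\le l(w)$, and let $m$ be an integer with $m\ge 4^{a_{l(w)}}C$. 1. If $W_{v_k}(t\dot w')=W_{v'_k}(t\dot w')$ for all $w'<w$, all integers $k\ge 4^{a_{l(w')}}C$ and all $t\in T$, then $$W_{v_m}(t\dot w u)=W_{v'_m}(t\dot w u)\qquad\text{for all } t\in T \text{ and all } u\in U_w^-\setminus U_{w,m}^-.$$ 2. If $W_{v_k}(t\dot w')=W_{v'_k}(t\dot w')$ for all $w'\le w$, all integers $k\ge 4^{a_{l(w')}}C$ and all $t\in T$, then $$W_{v_m}(g)=W_{v'_m}(g)\qquad\text{for all } g\in B\dot wB.$$ -/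

import Mathlib

open ValuativeRel MeasureTheory
open scoped Valued Matrix

noncomputable section

namespace HoweU22

/-! ### Non-archimedean local fields -/

section LocalField

variable {K : Type*} [Field K] [ValuativeRel K]

/-- `x` is a uniformizer of `K`: it lies in `𝒪[K]` and generates the maximal ideal `𝓂[K]`. -/
def IsUniformizer (x : K) : Prop :=
  ∃ h : x ∈ 𝒪[K], 𝓂[K] = Ideal.span {(⟨x, h⟩ : 𝒪[K])}

/-- The power `𝓟_K ^ m` of the maximal ideal, as a subset of `K`. -/
def maxIdealPow (K : Type*) [Field K] [ValuativeRel K] (m : ℕ) : Set K :=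
  {x | ∃ y : 𝒪[K], y ∈ 𝓂[K] ^ m ∧ (y : K) = x}

/-- An unramified additive character of `K`: continuous, and `𝒪[K]` is the largest
fractional ideal on which it is trivial. -/
def IsUnramifiedChar [TopologicalSpace K] (ψ : AddChar K Circle) : Prop :=
  Continuous ψ ∧ ∀ a : K, (∀ x ∈ 𝒪[K], ψ (a * x) = 1) ↔ a ∈ 𝒪[K]

/-- `E/F` is unramified: a uniformizer of `F` is a uniformizer of `E`
(the residue fields of local fields are finite, so the residue extension is separable). -/
def IsUnramifiedExtension (F E : Type*) [Field F] [ValuativeRel F] [Field E] [ValuativeRel E]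
    [Algebra F E] : Prop :=
  ∀ x : F, IsUniformizer x → IsUniformizer (algebraMap F E x)

end LocalField

/-! ### The Weyl group -/

/-- The two simple roots. -/
inductive SimpleRoot where
  | α : SimpleRoot
  | β : SimpleRoot
  deriving DecidableEq

/-- The Weyl group of `U(2,2)`, acting on the four coordinate lines of the diagonal torus
`diag(a₁, a₂, σ(a₁)⁻¹, σ(a₂)⁻¹)`: the permutations of the coordinates `0, 1, 2, 3` that respect
the pairing `0 ↔ 2`, `1 ↔ 3`. It is the dihedral group of order 8. -/
def WeylGroup : Subgroup (Equiv.Perm (Fin 4)) where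
  carrier := {w | ∀ i, w (i + 2) = w i + 2}
  mul_mem' := by
    intro a b ha hb i
    simp only [Set.mem_ofPred_eq] at ha hb
    simp [Equiv.Perm.mul_apply, ha, hb]
  one_mem' := by intro i; rfl
  inv_mem' := by
    intro a ha i
    simp only [Set.mem_ofPred_eq] at ha
    rw [Equiv.Perm.inv_eq_iff_eq, ha]
    simp

/-- The simple reflections: `s_α` exchanges `a₁` and `a₂`; `s_β` replaces `a₂` by `σ(a₂)⁻¹`. -/
def simpleReflection : SimpleRoot → WeylGroup
  | .α => ⟨Equiv.swap 0 1 * Equiv.swap 2 3, show ∀ _, _ by decide⟩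
  | .β => ⟨Equiv.swap 1 3, show ∀ _, _ by decide⟩

/-- The Weyl group element given by a word in the simple reflections. -/
def wordProd (ω : List SimpleRoot) : WeylGroup := (ω.map simpleReflection).prod

/-- `ω` is a word of minimal length for the Weyl group element it represents. -/
def IsReducedWord (ω : List SimpleRoot) : Prop :=
  ∀ ω' : List SimpleRoot, wordProd ω' = wordProd ω → ω.length ≤ ω'.length

/-- The length of a Weyl group element. -/
def weylLength (w : WeylGroup) : ℕ :=
  sInf {n | ∃ ω : List SimpleRoot, wordProd ω = w ∧ ω.length = n}

/-- The Bruhat order `w' ≤ w`: `w'` is the product of a subword of a reduced word of `w`. -/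
def BruhatLE (w' w : WeylGroup) : Prop :=
  ∃ ω : List SimpleRoot, IsReducedWord ω ∧ wordProd ω = w ∧
    ∃ ω' : List SimpleRoot, ω'.Sublist ω ∧ wordProd ω' = w'

/-- The strict Bruhat order `w' < w`. -/
def BruhatLT (w' w : WeylGroup) : Prop := BruhatLE w' w ∧ w' ≠ w

/-- The reduced words; each Weyl group element has one, only the longest element has two. -/
def reducedWords : List (List SimpleRoot) :=
  [[], [.α], [.β], [.α, .β], [.β, .α], [.α, .β, .α], [.β, .α, .β],
    [.α, .β, .α, .β], [.β, .α, .β, .α]]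

theorem exists_reducedWords (w : WeylGroup) : ∃ ω ∈ reducedWords, wordProd ω = w := by
  obtain ⟨w, hw⟩ := w
  have key : ∀ w : Equiv.Perm (Fin 4), (∀ i, w (i + 2) = w i + 2) →
      ∃ ω ∈ reducedWords, ((wordProd ω : WeylGroup) : Equiv.Perm (Fin 4)) = w := by decide
  obtain ⟨ω, h1, h2⟩ := key w hw
  exact ⟨ω, h1, Subtype.ext h2⟩

theorem exists_isReducedWord (w : WeylGroup) :
    ∃ ω : List SimpleRoot, IsReducedWord ω ∧ wordProd ω = w := by
  obtain ⟨ω₀, -, h₀⟩ := exists_reducedWords w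
  have hne : ∃ n, ∃ ω : List SimpleRoot, wordProd ω = w ∧ ω.length = n := ⟨_, ω₀, h₀, rfl⟩
  classical
  obtain ⟨ω, h1, h2⟩ := Nat.find_spec hne
  refine ⟨ω, fun ω' h' => ?_, h1⟩
  rw [h2]
  exact Nat.find_min' hne ⟨ω', h'.trans h1, rfl⟩

theorem mem_reducedWords {ω : List SimpleRoot} (h : IsReducedWord ω) : ω ∈ reducedWords := by
  have hle : ω.length ≤ 4 := by
    obtain ⟨ω', h1, h2⟩ := exists_reducedWords (wordProd ω)
    have h3 := h ω' h2
    have h4 : ∀ τ ∈ reducedWords, τ.length ≤ 4 := by decide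
    exact h3.trans (h4 ω' h1)
  by_contra hn
  obtain ⟨ω', h1, h2⟩ : ∃ ω' ∈ reducedWords,
      wordProd ω' = wordProd ω ∧ ω'.length < ω.length := by
    revert hn
    clear h
    match ω, hle with
    | [], _ => decide
    | [a], _ => cases a <;> decide
    | [a, b], _ => cases a <;> cases b <;> decide
    | [a, b, c], _ => cases a <;> cases b <;> cases c <;> decide
    | [a, b, c, d], _ => cases a <;> cases b <;> cases c <;> cases d <;> decide
    | _ :: _ :: _ :: _ :: _ :: l, hle => simp only [List.length_cons] at hle; omega
  exact absurd (h ω' h2.1) (by omega)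

/-! ### The group `U(2,2)` and its subgroups -/

section Group

variable {F E : Type*} [Field F] [Field E] [Algebra F E]

/-- The matrix `s` with blocks `0, 1₂, -1₂, 0`. -/
def formMatrix (E : Type*) [Field E] : Matrix (Fin 4) (Fin 4) E :=
  !![0, 0, 1, 0; 0, 0, 0, 1; -1, 0, 0, 0; 0, -1, 0, 0]

/-- `U(2,2) = {g ∈ GL₄(E) : g s ᵗḡ = s}`, with the topology of `GL₄(E)`; here `σ` is the Galois
conjugation of `E/F`. -/
def U22 (σ : E ≃ₐ[F] E) : Subgroup (GL (Fin 4) E) where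
  carrier := {g | (g : Matrix (Fin 4) (Fin 4) E) * formMatrix E *
    ((g : Matrix (Fin 4) (Fin 4) E).map σ)ᵀ = formMatrix E}
  mul_mem' := by
    intro a b ha hb
    simp only [Set.mem_ofPred_eq] at ha hb ⊢
    have h : ((((a * b : GL (Fin 4) E) : Matrix (Fin 4) (Fin 4) E)).map σ)ᵀ =
        ((b : Matrix (Fin 4) (Fin 4) E).map σ)ᵀ * ((a : Matrix (Fin 4) (Fin 4) E).map σ)ᵀ := by
      rw [Units.val_mul, ← Matrix.transpose_mul, Matrix.map_mul]
    rw [h, Units.val_mul]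
    calc (a : Matrix (Fin 4) (Fin 4) E) * b * formMatrix E *
          (((b : Matrix (Fin 4) (Fin 4) E).map σ)ᵀ * ((a : Matrix (Fin 4) (Fin 4) E).map σ)ᵀ)
        = a * (b * formMatrix E * ((b : Matrix (Fin 4) (Fin 4) E).map σ)ᵀ) *
          ((a : Matrix (Fin 4) (Fin 4) E).map σ)ᵀ := by simp only [Matrix.mul_assoc]
      _ = formMatrix E := by rw [hb, ha]
  one_mem' := by simp
  inv_mem' := by
    intro a ha
    simp only [Set.mem_ofPred_eq] at ha ⊢
    have h1 : ((a⁻¹ : GL (Fin 4) E) : Matrix (Fin 4) (Fin 4) E) * a = 1 := by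
      rw [← Units.val_mul]; simp
    have h2 : ((a : Matrix (Fin 4) (Fin 4) E).map σ)ᵀ *
        (((a⁻¹ : GL (Fin 4) E) : Matrix (Fin 4) (Fin 4) E).map σ)ᵀ = 1 := by
      rw [← Matrix.transpose_mul, ← Matrix.map_mul, h1]; simp
    calc ((a⁻¹ : GL (Fin 4) E) : Matrix (Fin 4) (Fin 4) E) * formMatrix E *
          (((a⁻¹ : GL (Fin 4) E) : Matrix (Fin 4) (Fin 4) E).map σ)ᵀ
        = ((a⁻¹ : GL (Fin 4) E) : Matrix (Fin 4) (Fin 4) E) *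
          (a * formMatrix E * ((a : Matrix (Fin 4) (Fin 4) E).map σ)ᵀ) *
          (((a⁻¹ : GL (Fin 4) E) : Matrix (Fin 4) (Fin 4) E).map σ)ᵀ := by rw [ha]
      _ = (((a⁻¹ : GL (Fin 4) E) : Matrix (Fin 4) (Fin 4) E) * a) * formMatrix E *
          (((a : Matrix (Fin 4) (Fin 4) E).map σ)ᵀ *
          (((a⁻¹ : GL (Fin 4) E) : Matrix (Fin 4) (Fin 4) E).map σ)ᵀ) := by
          simp only [Matrix.mul_assoc]
      _ = formMatrix E := by rw [h1, h2]; simp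

variable {σ : E ≃ₐ[F] E}

/-- The matrix of an element of `U(2,2)`. -/
abbrev toMat (g : U22 σ) : Matrix (Fin 4) (Fin 4) E := ((g : GL (Fin 4) E) : Matrix _ _ E)

/-- Build an element of `U(2,2)` from a matrix and a right inverse. -/
def mkU22 (σ : E ≃ₐ[F] E) (A A' : Matrix (Fin 4) (Fin 4) E) (h : A * A' = 1)
    (hA : A * formMatrix E * (A.map σ)ᵀ = formMatrix E) : U22 σ :=
  ⟨⟨A, A', h, mul_eq_one_comm.mp h⟩, hA⟩

/-- The maximal torus `T`: the elements `t(a₁, a₂) = diag(a₁, a₂, ā₁⁻¹, ā₂⁻¹)`. -/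
def torus (σ : E ≃ₐ[F] E) : Set (U22 σ) :=
  {g | ∃ a₁ a₂ : Eˣ, toMat g = Matrix.diagonal ![(a₁ : E), a₂, (σ a₁)⁻¹, (σ a₂)⁻¹]}

/-- The upper triangular unipotent shape: all matrices
`(u *; 0 u')` with `u` upper and `u'` lower triangular unipotent. -/
def IsUnipotentShape (A : Matrix (Fin 4) (Fin 4) E) : Prop :=
  (A 0 0 = 1 ∧ A 1 0 = 0 ∧ A 1 1 = 1) ∧ (A 2 0 = 0 ∧ A 2 1 = 0 ∧ A 3 0 = 0 ∧ A 3 1 = 0) ∧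
    (A 2 2 = 1 ∧ A 2 3 = 0 ∧ A 3 3 = 1)

/-- The maximal unipotent subgroup `U`. The elements of `U(2,2)` of this shape are the products
`m(1 x; 0 1) n(z y; ȳ b)`, see `mem_unipotent_iff`. -/
def unipotent (σ : E ≃ₐ[F] E) : Subgroup (U22 σ) where
  carrier := {g | IsUnipotentShape (toMat g)}
  mul_mem' := by
    intro a b ha hb
    obtain ⟨⟨h1, h2, h3⟩, ⟨h4, h5, h6, h7⟩, h8, h9, h10⟩ := ha
    obtain ⟨⟨k1, k2, k3⟩, ⟨k4, k5, k6, k7⟩, k8, k9, k10⟩ := hb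
    refine ⟨⟨?_, ?_, ?_⟩, ⟨?_, ?_, ?_, ?_⟩, ?_, ?_, ?_⟩ <;>
      simp [toMat, Matrix.mul_apply, Fin.sum_univ_four, *]
  one_mem' := by
    refine ⟨⟨?_, ?_, ?_⟩, ⟨?_, ?_, ?_, ?_⟩, ?_, ?_, ?_⟩ <;> simp [toMat]
  inv_mem' := by
    intro a ha
    obtain ⟨⟨h1, h2, h3⟩, ⟨h4, h5, h6, h7⟩, h8, h9, h10⟩ := ha
    have e : ∀ i j, (toMat a * toMat a⁻¹) i j = (1 : Matrix (Fin 4) (Fin 4) E) i j := by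
      intro i j
      have : toMat a * toMat a⁻¹ = 1 := by
        simp only [toMat]
        rw [← Units.val_mul, ← Subgroup.coe_mul]; simp
      rw [this]
    simp only [Matrix.mul_apply, Fin.sum_univ_four] at e
    have r2 : ∀ j, toMat a⁻¹ 2 j = (1 : Matrix (Fin 4) (Fin 4) E) 2 j := by
      intro j; have := e 2 j; rw [h4, h5, h8, h9] at this; simpa using this
    have r3 : ∀ j, toMat a 3 2 * toMat a⁻¹ 2 j + toMat a⁻¹ 3 j
        = (1 : Matrix (Fin 4) (Fin 4) E) 3 j := by
      intro j; have := e 3 j; rw [h6, h7, h10] at this; simpa using this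
    have r1 : ∀ j, toMat a⁻¹ 1 j + toMat a 1 2 * toMat a⁻¹ 2 j + toMat a 1 3 * toMat a⁻¹ 3 j
        = (1 : Matrix (Fin 4) (Fin 4) E) 1 j := by
      intro j; have := e 1 j; rw [h2, h3] at this; simpa using this
    have s20 := r2 0
    have s21 := r2 1
    have s22 := r2 2
    have s23 := r2 3
    have s30 := r3 0
    have s31 := r3 1
    have s33 := r3 3
    rw [s20] at s30
    rw [s21] at s31
    rw [s23] at s33
    simp at s20 s21 s22 s23 s30 s31 s33
    have s10 := r1 0
    have s11 := r1 1
    rw [s20, s30] at s10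
    rw [s21, s31] at s11
    simp at s10 s11
    have s00 := e 0 0
    rw [h1, s10, s20, s30] at s00
    simp at s00
    exact ⟨⟨s00, s10, s11⟩, ⟨s20, s21, s30, s31⟩, s22, s23, s33⟩

/-- For `E/F` quadratic Galois with conjugation `σ`, the group `U` consists of the products
`m(1 x; 0 1) n(z y; ȳ b)` with `x, y ∈ E` and `z, b ∈ F`. -/
theorem mem_unipotent_iff (hσ : ∀ x, σ (σ x) = x) (hfix : ∀ x, σ x = x → ∃ c, algebraMap F E c = x)
    (g : U22 σ) : g ∈ unipotent σ ↔ ∃ (x y : E) (z b : F), toMat g =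
      !![1, x, 0, 0; 0, 1, 0, 0; 0, 0, 1, 0; 0, 0, -σ x, 1] *
      !![1, 0, algebraMap F E z, y; 0, 1, σ y, algebraMap F E b; 0, 0, 1, 0; 0, 0, 0, 1] := by
  constructor
  · rintro ⟨⟨h1, h2, h3⟩, ⟨h4, h5, h6, h7⟩, h8, h9, h10⟩
    have hg : toMat g * formMatrix E * ((toMat g).map σ)ᵀ = formMatrix E := g.2
    have e : ∀ i j, (toMat g * formMatrix E * ((toMat g).map σ)ᵀ) i j = formMatrix E i j := by
      intro i j; rw [hg]
    generalize toMat g = A at *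
    simp only [Matrix.mul_apply, Fin.sum_univ_four, formMatrix, Matrix.transpose_apply,
      Matrix.map_apply] at e
    have e00 := e 0 0
    have e01 := e 0 1
    have e03 := e 0 3
    have e11 := e 1 1
    simp [h1, h2, h3, h6, h7, h10] at e00 e01 e03 e11
    obtain ⟨b, hb⟩ := hfix (A 1 3) (by linear_combination e11)
    have hx : A 3 2 = -σ (A 0 1) := by
      have := congrArg σ e03
      simp only [map_add, map_zero, hσ] at this
      linear_combination this
    obtain ⟨z, hz⟩ := hfix (A 0 2 - A 0 1 * A 1 2) (by
      have h01 := congrArg σ e01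
      simp only [map_add, map_neg, map_mul, map_zero, hσ] at h01
      simp only [map_sub, map_mul]
      linear_combination e00 - σ (A 0 1) * e01 + A 0 1 * h01 + σ (A 0 1) * A 0 1 * e11)
    refine ⟨A 0 1, A 0 3 - A 0 1 * A 1 3, z, b, ?_⟩
    have hy : σ (A 0 3 - A 0 1 * A 1 3) = A 1 2 := by
      have h01 := congrArg σ e01
      simp only [map_add, map_neg, map_mul, map_zero, hσ] at h01
      simp only [map_sub, map_mul]
      linear_combination -h01 - σ (A 0 1) * e11
    rw [hz, hb, hy]
    ext i j
    fin_cases i <;> fin_cases j <;>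
      simp [Matrix.mul_apply, Fin.sum_univ_four, h1, h2, h3, h4, h5, h6, h7, h8, h9, h10, hx]
  · rintro ⟨x, y, z, b, h⟩
    change IsUnipotentShape (toMat g)
    rw [h]
    refine ⟨⟨?_, ?_, ?_⟩, ⟨?_, ?_, ?_, ?_⟩, ?_, ?_, ?_⟩ <;>
      simp [Matrix.mul_apply, Fin.sum_univ_four]

/-- The Borel subgroup `B = T U`. -/
def borel (σ : E ≃ₐ[F] E) : Set (U22 σ) :=
  {g | ∃ t ∈ torus σ, ∃ u ∈ unipotent σ, g = t * u}

/-- The opposite unipotent group: the transposes of the elements of `U`. -/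
def oppUnipotent (σ : E ≃ₐ[F] E) : Set (U22 σ) :=
  {g | ∃ u ∈ unipotent σ, toMat g = (toMat u)ᵀ}

/-! ### Representatives of Weyl group elements and Bruhat cells -/

/-- The representatives of the simple reflections. -/
def simpleRep (σ : E ≃ₐ[F] E) : SimpleRoot → U22 σ
  | .α => mkU22 σ !![0, 1, 0, 0; 1, 0, 0, 0; 0, 0, 0, 1; 0, 0, 1, 0]
      !![0, 1, 0, 0; 1, 0, 0, 0; 0, 0, 0, 1; 0, 0, 1, 0]
      (by ext i j; fin_cases i <;> fin_cases j <;> simp [Matrix.mul_apply, Fin.sum_univ_four])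
      (by ext i j; fin_cases i <;> fin_cases j <;>
        simp [Matrix.mul_apply, Fin.sum_univ_four, formMatrix])
  | .β => mkU22 σ !![1, 0, 0, 0; 0, 0, 0, 1; 0, 0, 1, 0; 0, -1, 0, 0]
      !![1, 0, 0, 0; 0, 0, 0, -1; 0, 0, 1, 0; 0, 1, 0, 0]
      (by ext i j; fin_cases i <;> fin_cases j <;> simp [Matrix.mul_apply, Fin.sum_univ_four])
      (by ext i j; fin_cases i <;> fin_cases j <;>
        simp [Matrix.mul_apply, Fin.sum_univ_four, formMatrix])

/-- The representative `ẇ` of `w`: the product of the representatives of the simple reflections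
along a reduced word of `w` (any reduced word gives the same, see `weylRep_wordProd`). -/
def weylRep (σ : E ≃ₐ[F] E) (w : WeylGroup) : U22 σ :=
  ((exists_isReducedWord w).choose.map (simpleRep σ)).prod

theorem weylRep_wordProd (σ : E ≃ₐ[F] E) {ω : List SimpleRoot} (h : IsReducedWord ω) :
    weylRep σ (wordProd ω) = (ω.map (simpleRep σ)).prod := by
  have key : ∀ ω₁ ∈ reducedWords, ∀ ω₂ ∈ reducedWords, wordProd ω₁ = wordProd ω₂ →
      ω₁ = ω₂ ∨ (ω₁ = [.α, .β, .α, .β] ∧ ω₂ = [.β, .α, .β, .α]) ∨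
        (ω₂ = [.α, .β, .α, .β] ∧ ω₁ = [.β, .α, .β, .α]) := by decide
  have braid : (([.α, .β, .α, .β] : List SimpleRoot).map (simpleRep σ)).prod =
      (([.β, .α, .β, .α] : List SimpleRoot).map (simpleRep σ)).prod := by
    apply Subtype.ext
    apply Units.ext
    simp only [List.map_cons, List.map_nil, List.prod_cons, List.prod_nil, mul_one,
      Subgroup.coe_mul, Units.val_mul, simpleRep, mkU22]
    ext i j
    fin_cases i <;> fin_cases j <;> simp [Matrix.mul_apply, Fin.sum_univ_four]
  have hs := (exists_isReducedWord (wordProd ω)).choose_spec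
  unfold weylRep
  generalize (exists_isReducedWord (wordProd ω)).choose = ω' at *
  rcases key _ (mem_reducedWords hs.1) _ (mem_reducedWords h) hs.2 with h' | ⟨h1, h2⟩ | ⟨h1, h2⟩
  · rw [h']
  · rw [h1, h2, braid]
  · rw [h1, h2, braid]

/-- The Bruhat cell `B w B`. -/
def bruhatCell (σ : E ≃ₐ[F] E) (w : WeylGroup) : Set (U22 σ) :=
  {g | ∃ b ∈ borel σ, ∃ b' ∈ borel σ, g = b * weylRep σ w * b'}

/-- `U_w⁻`: the elements of `U` that `w` conjugates into the opposite unipotent group, i.e. the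
product of the root subgroups of the positive roots `γ` with `w(γ) < 0`. -/
def unipotentMinus (σ : E ≃ₐ[F] E) (w : WeylGroup) : Set (U22 σ) :=
  {u | u ∈ unipotent σ ∧ weylRep σ w * u * (weylRep σ w)⁻¹ ∈ oppUnipotent σ}

/-! ### Compact open subgroups -/

/-- The congruence subgroup `K_m = (1 + Mat₄(𝓟_E ^ m)) ∩ U(2,2)`. -/
def congruence [ValuativeRel E] (σ : E ≃ₐ[F] E) (m : ℕ) : Set (U22 σ) :=
  {g | ∀ i j, toMat g i j - (1 : Matrix (Fin 4) (Fin 4) E) i j ∈ maxIdealPow E m}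

/-- The element `d_m = t(ϖ^(-3m), ϖ^(-m))`, for `ϖ ∈ Fˣ`. -/
def scalingElt (σ : E ≃ₐ[F] E) (ϖ : Fˣ) (m : ℕ) : U22 σ :=
  mkU22 σ
    (Matrix.diagonal ![(algebraMap F E ϖ)⁻¹ ^ (3 * m), (algebraMap F E ϖ)⁻¹ ^ m,
      algebraMap F E ϖ ^ (3 * m), algebraMap F E ϖ ^ m])
    (Matrix.diagonal ![algebraMap F E ϖ ^ (3 * m), algebraMap F E ϖ ^ m,
      (algebraMap F E ϖ)⁻¹ ^ (3 * m), (algebraMap F E ϖ)⁻¹ ^ m])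
    (by
      have h : algebraMap F E ϖ ≠ 0 := by simp
      rw [Matrix.diagonal_mul_diagonal, ← Matrix.diagonal_one]
      congr 1
      ext i
      fin_cases i <;> simp [h])
    (by
      have h : algebraMap F E ϖ ≠ 0 := by simp
      ext i j
      fin_cases i <;> fin_cases j <;>
        simp [Matrix.mul_apply, Fin.sum_univ_four, formMatrix, Matrix.diagonal, h])

/-- `H_m = d_m K_m d_m⁻¹`. -/
def howeGroup [ValuativeRel E] (σ : E ≃ₐ[F] E) (ϖ : Fˣ) (m : ℕ) : Set (U22 σ) :=
  {g | ∃ k ∈ congruence σ m, g = scalingElt σ ϖ m * k * (scalingElt σ ϖ m)⁻¹}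

/-- `U_m = U ∩ H_m`, as a subset of `U`. -/
def unipotentLevel [ValuativeRel E] (σ : E ≃ₐ[F] E) (ϖ : Fˣ) (m : ℕ) : Set (unipotent σ) :=
  {u | (u : U22 σ) ∈ howeGroup σ ϖ m}

/-! ### The generic character, representations and Howe vectors -/

/-- The element of `F` that maps to a given element of the image of `F` in `E`. -/
def toBase (F : Type*) {E : Type*} [Field F] [Field E] [Algebra F E] (x : E) : F :=
  Function.invFun (algebraMap F E) x

theorem toBase_algebraMap (c : F) : toBase F (algebraMap F E c) = c :=
  Function.leftInverse_invFun (algebraMap F E).injective c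

/-- The generic character `ψ_U (m(1 x; 0 1) n(z y; ȳ b)) = ψ_E(-x) ψ(b)` of `U`; the entries
of the matrix in the places `(1,2)` and `(2,4)` are `x` and `b`. -/
def genericChar (ψ : AddChar F Circle) (ψE : AddChar E Circle) (u : U22 σ) : ℂ :=
  (ψE (-(toMat u 0 1)) : ℂ) * (ψ (toBase F (toMat u 1 3)) : ℂ)

theorem genericChar_eq (ψ : AddChar F Circle) (ψE : AddChar E Circle) (u : U22 σ)
    (x y : E) (z b : F) (h : toMat u =
      !![1, x, 0, 0; 0, 1, 0, 0; 0, 0, 1, 0; 0, 0, -σ x, 1] *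
      !![1, 0, algebraMap F E z, y; 0, 1, σ y, algebraMap F E b; 0, 0, 1, 0; 0, 0, 0, 1]) :
    genericChar ψ ψE u = (ψE (-x) : ℂ) * (ψ b : ℂ) := by
  have h1 : toMat u 0 1 = x := by rw [h]; simp [Matrix.mul_apply, Fin.sum_univ_four]
  have h2 : toMat u 1 3 = algebraMap F E b := by
    rw [h]; simp [Matrix.mul_apply, Fin.sum_univ_four]
  rw [genericChar, h1, h2, toBase_algebraMap]

variable {V : Type*} [AddCommGroup V] [Module ℂ V]

/-- A representation is smooth if every vector has an open stabilizer. -/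
def IsSmoothRep [TopologicalSpace E] (π : Representation ℂ (U22 σ) V) : Prop :=
  ∀ v : V, IsOpen {g : U22 σ | π g v = v}

/-- `ω` is the central character of `π`. -/
def HasCentralChar (π : Representation ℂ (U22 σ) V)
    (ω : Subgroup.center (U22 σ) →* ℂˣ) : Prop :=
  ∀ (z : Subgroup.center (U22 σ)) (v : V), π (z : U22 σ) v = (ω z : ℂ) • v

/-- `ℓ` is a Whittaker functional: a nonzero functional with `ℓ (π(u) v) = ψ_U(u) ℓ(v)`. -/
def IsWhittakerFunctional (ψ : AddChar F Circle) (ψE : AddChar E Circle)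
    (π : Representation ℂ (U22 σ) V) (ℓ : V →ₗ[ℂ] ℂ) : Prop :=
  ℓ ≠ 0 ∧ ∀ u ∈ unipotent σ, ∀ v : V, ℓ (π u v) = genericChar ψ ψE u * ℓ v

/-- The Whittaker function `W_v(g) = ℓ(π(g) v)`. -/
def whittaker (π : Representation ℂ (U22 σ) V) (ℓ : V →ₗ[ℂ] ℂ) (v : V) (g : U22 σ) : ℂ :=
  ℓ (π g v)

/-- The integral `∫_S f dμ` of a function with values in a complex vector space that takes finitely
many values on `S`: the sum over the values `x` of `μ(S ∩ f⁻¹(x)) x`. -/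
def simpleIntegral {X : Type*} [MeasurableSpace X] (μ : Measure X) (S : Set X) (f : X → V) : V :=
  ∑ᶠ x : V, ((μ.real (S ∩ f ⁻¹' {x}) : ℝ) : ℂ) • x

/-- The Howe vector `v_m = Vol(U_m)⁻¹ ∫_{U_m} ψ_U(u)⁻¹ π(u) v du`. For smooth `π` the integrand is
locally constant on the compact group `U_m`, so it takes finitely many values. -/
def howeVector [ValuativeRel E] [MeasurableSpace (unipotent σ)] (μ : Measure (unipotent σ)) (ϖ : Fˣ)
    (ψ : AddChar F Circle) (ψE : AddChar E Circle)
    (π : Representation ℂ (U22 σ) V) (v : V) (m : ℕ) : V :=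
  ((μ.real (unipotentLevel σ ϖ m) : ℝ) : ℂ)⁻¹ •
    simpleIntegral μ (unipotentLevel σ ϖ m)
      (fun u => (genericChar ψ ψE (u : U22 σ))⁻¹ • π (u : U22 σ) v)

end Group

end HoweU22

end

/-!
Write `χ_m` for the character of `U_m` given by `ψ_U`. Three facts about Howe vectors carry the
proof.

* Conjugation by `d_m` makes the entries of `H_m` in the places of the simple roots lie in
  `𝓟 ^ (-m)`, and the second-order terms in a product are integral there. As `ψ` and `ψ_E` are trivial
  on the integers, `χ_m` extends to a character of `H_m` (`howeChar_mul`). By the Iwahori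
  factorization (`iwahori_factorization`), `H_m` is the product of `U_m` and of a subgroup of
  `K_m`, which fixes `v`; so `H_m` acts on `v_m` by this character (`map_howeVector`).
* For `k ≤ m`, the vector `v_m` is an average of the translates `χ_m(u)⁻¹ π(u) v_k` with `u ∈ U_m`
  (`howeVector_eq_average`).
* `W_{v_m}` transforms by `ψ_U` under `U` on the left.

Everything else is formal: the relation `W_{v_k}(g) = W_{v'_k}(g)` between levels `k` and elements
`g` has the three invariance properties collected in `IsHoweRelation`.

Let `g = b ẇ u`, and let `w = s_1 ⋯ s_l` be a reduced word. The positive roots made negative by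
`w` are the roots `γ_i` obtained from `s_i` by the inverse of `s_(i+1) ⋯ s_l`. Multiplying `u` on
the right by elements of `U_m`, one removes its components in `γ_l, γ_(l-1), …` as long as they
are small at level `m` (`strip`). If they are all removed, then `g` lies in `U t ẇ H_m` for some
`t ∈ T`; if moreover `u ∈ U_w⁻`, then `u ∈ U_m`. Otherwise a component `c` in some `γ_i` is large.
Since `c⁻¹` is small in the opposite root at level `m / 4` (`inv_mem_of_large`), the rank one
identity `x_γ(c) x_{-γ}(-c⁻¹) ∈ ṡ⁻¹ B` (`exists_simple_mul_eq`) deletes the letter `s_i`, and by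
the product rule for Bruhat cells (`mul_simple_mem`) the point moves to cells of proper subwords
of `w`. Descending from the level `m` to `m / 4` perturbs `u` by an element of `U_m`, whose
components in `γ_j`, `j > i`, may be large at the new level; in this case one continues with such
a `j`. So at most `l` descents occur (`IsHoweRelation.of_large`), which is why `m ≥ 4 ^ l k₀`
suffices, where `k₀` is the level for the smaller cells, and why the exponents satisfy
`a_l ≥ l + a_(l-1)`. An induction on the length gives the two claims, `IsHoweRelation.of_notMem` and
`IsHoweRelation.of_bruhatCell`.

For a Weyl group element `w`, the groups `triangular σ w` and `unitriangular σ w` are the Borel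
subgroup `ẇ⁻¹ B ẇ` and its unipotent radical. The root of a letter is encoded by the place
`(rootRow, rootCol)` of its free matrix entry, and in terms of the order `wRank w` of the
coordinates the place of a root that `w` makes simple is just above the diagonal.
-/

noncomputable section

namespace HoweU22

/-! ### Valuations and the Galois conjugation -/

section LocalFieldLemmas

/-- A nontrivial automorphism of a quadratic extension is an involution with fixed field `F`. -/
theorem conj_involutive_and_fixed {F E : Type*} [Field F] [Field E] [Algebra F E]
    (hquad : Module.finrank F E = 2) {σ : E ≃ₐ[F] E}
    (hσ : σ ≠ AlgEquiv.refl) :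
    (∀ x, σ (σ x) = x) ∧ ∀ x, σ x = x → ∃ c, algebraMap F E c = x := by
  have : FiniteDimensional F E := Module.finite_of_finrank_pos (by omega)
  have hle : Nat.card (E ≃ₐ[F] E) ≤ 2 := by
    rw [← hquad]; simpa [Nat.card_eq_fintype_card] using AlgEquiv.card_le (F := F) (K := E)
  have h1 : Nat.card (E ≃ₐ[F] E) ≠ 1 := by
    intro h
    rw [Nat.card_eq_one_iff_unique] at h
    exact hσ (h.1.elim _ _)
  have h0 : Nat.card (E ≃ₐ[F] E) ≠ 0 := Nat.card_pos.ne'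
  have h2 : Nat.card (E ≃ₐ[F] E) = 2 := by omega
  have hgal : IsGalois F E := IsGalois.of_card_aut_eq_finrank F E (by rw [h2, hquad])
  classical
  have hall : ∀ τ : E ≃ₐ[F] E, τ = 1 ∨ τ = σ := by
    intro τ
    by_contra hcon
    push Not at hcon
    have := Finset.card_le_univ ({1, σ, τ} : Finset (E ≃ₐ[F] E))
    rw [Finset.card_eq_three.2 ⟨1, σ, τ, fun h => hσ h.symm, fun h => hcon.1 h.symm,
      fun h => hcon.2 h.symm, rfl⟩, ← Nat.card_eq_fintype_card, h2] at this
    omega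
  refine ⟨fun x => ?_, fun x hx => ?_⟩
  · have h : σ ^ 2 = 1 := by rw [← h2]; exact pow_card_eq_one'
    have := congrArg (fun τ : E ≃ₐ[F] E => τ x) h
    simpa [pow_two] using this
  · have : x ∈ (⊥ : IntermediateField F E) := by
      rw [IsGalois.mem_bot_iff_fixed]
      intro τ
      rcases hall τ with rfl | rfl
      · rfl
      · exact hx
    exact IntermediateField.mem_bot.1 this

variable {F E : Type*} [Field F] [ValuativeRel F] [Field E] [ValuativeRel E] [Algebra F E]

theorem algebraMap_mem_integer [ValuativeExtension F E] {x : F} :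
    algebraMap F E x ∈ 𝒪[E] ↔ x ∈ 𝒪[F] := by
  rw [Valuation.mem_integer_iff, Valuation.mem_integer_iff]
  have h := ValuativeExtension.vle_iff_vle (A := F) (B := E) x 1
  rw [map_one] at h
  rw [Valuation.Compatible.vle_iff_le (v := valuation E),
    Valuation.Compatible.vle_iff_le (v := valuation F)] at h
  simpa using h

theorem IsUniformizer.valuation_lt_one {K : Type*} [Field K] [ValuativeRel K] {p : K}
    (hp : IsUniformizer p) :
    valuation K p < 1 := by
  obtain ⟨h, hp⟩ := hp
  have : (⟨p, h⟩ : 𝒪[K]) ∈ 𝓂[K] := by rw [hp]; exact Ideal.mem_span_singleton_self _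
  have h1 : ¬ IsUnit (⟨p, h⟩ : 𝒪[K]) := this
  rw [(Valuation.integer.integers _).isUnit_iff_valuation_eq_one] at h1
  exact lt_of_le_of_ne h h1

variable [TopologicalSpace E] [IsNonarchimedeanLocalField E]

theorem exists_valuation_pow_lt {p : E} (hp : valuation E p < 1) {γ : ValueGroupWithZero E}
    (hγ : γ ≠ 0) : ∃ n : ℕ, valuation E (p ^ n) < γ := by
  simp only [map_pow]
  exact exists_pow_lt₀ hp (Units.mk0 γ hγ)

/-- A continuous endomorphism of `E` that fixes some `p ≠ 0` of valuation less than `1` preserves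
the ring of integers. Otherwise some `y = p x ^ N` would have powers that tend to `0`, while those
of `σ y` do not. -/
theorem map_mem_integer_of_continuous (σ : E →+* E) (hσ : Continuous σ) {p : E} (h0 : p ≠ 0)
    (hp : valuation E p < 1) (hfix : σ p = p) {x : E} (hx : x ∈ 𝒪[E]) : σ x ∈ 𝒪[E] := by
  rw [Valuation.mem_integer_iff] at hx ⊢
  by_contra hlt
  rw [not_le] at hlt
  have hx0 : σ x ≠ 0 := by
    intro h; rw [h] at hlt; simp at hlt
  obtain ⟨N, hN⟩ := exists_valuation_pow_lt (p := (σ x)⁻¹)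
    (by rw [map_inv₀]; exact inv_lt_one_of_one_lt₀ hlt)
    (γ := valuation E p) (by simpa using h0)
  set y := p * x ^ N with hy
  have hy1 : valuation E y < 1 := by
    rw [hy, map_mul, map_pow]
    exact (mul_le_of_le_one_right' (pow_le_one' hx N)).trans_lt hp
  have hy2 : 1 < valuation E (σ y) := by
    rw [hy, map_mul, map_mul, hfix, map_pow, map_pow]
    rw [inv_pow, map_inv₀, map_pow] at hN
    have hpos : 0 < valuation E (σ x) ^ N := by
      have : 0 < valuation E (σ x) := zero_lt_one.trans hlt
      exact pow_pos this N
    rwa [inv_lt_iff_one_lt_mul₀' hpos, mul_comm] at hN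
  have ht : Filter.Tendsto (fun n : ℕ => y ^ n) Filter.atTop (nhds 0) := by
    rw [(IsValuativeTopology.hasBasis_nhds_zero' E).tendsto_right_iff]
    intro γ hγ
    obtain ⟨n, hn⟩ := exists_valuation_pow_lt hy1 hγ
    filter_upwards [Filter.eventually_ge_atTop n] with k hk
    refine lt_of_le_of_lt ?_ hn
    rw [map_pow, map_pow]
    exact pow_le_pow_right_of_le_one' hy1.le hk
  have ht2 := (hσ.tendsto 0).comp ht
  rw [map_zero] at ht2
  rw [(IsValuativeTopology.hasBasis_nhds_zero' E).tendsto_right_iff] at ht2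
  obtain ⟨n, hn⟩ := (ht2 1 one_ne_zero).exists
  simp only [Function.comp, map_pow, Set.mem_ofPred_eq] at hn
  exact absurd hn (not_lt.2 (one_le_pow_of_one_le' hy2.le n))

variable [TopologicalSpace F] [IsNonarchimedeanLocalField F]

theorem continuous_algebraMap_of_uniformizer [ValuativeExtension F E] {ϖ : F} (h0 : ϖ ≠ 0)
    (hϖ : IsUniformizer (algebraMap F E ϖ)) :
    Continuous (algebraMap F E) := by
  refine continuous_of_continuousAt_zero (algebraMap F E).toAddMonoidHom ?_
  change Filter.Tendsto (algebraMap F E) (nhds 0) (nhds (algebraMap F E 0))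
  rw [map_zero, (IsValuativeTopology.hasBasis_nhds_zero' F).tendsto_iff
    (IsValuativeTopology.hasBasis_nhds_zero' E)]
  intro γ hγ
  obtain ⟨n, hn⟩ := exists_valuation_pow_lt hϖ.valuation_lt_one hγ
  refine ⟨valuation F (ϖ ^ n), by simpa using fun h => absurd h h0, fun x hx => ?_⟩
  have h := (ValuativeExtension.vle_iff_vle (A := F) (B := E) x (ϖ ^ n)).2
    ((Valuation.Compatible.vle_iff_le (v := valuation F) _ _).2 (le_of_lt hx))
  rw [Valuation.Compatible.vle_iff_le (v := valuation E), map_pow] at h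
  exact h.trans_lt hn

/-- Every `F`-linear map from the finite-dimensional space `E` is continuous. -/
theorem continuous_algEquiv (hfin : FiniteDimensional F E) (σ : E ≃ₐ[F] E)
    (hc : Continuous (algebraMap F E)) :
    Continuous σ := by
  let := IsTopologicalAddGroup.rightUniformSpace F
  have := isUniformAddGroup_of_addCommGroup (G := F)
  let : (Valued.v (R := F) (Γ₀ := ValueGroupWithZero F)).RankOne :=
  { hom' := IsRankLeOne.nonempty.some.emb (R := F).comp MonoidWithZeroHom.ValueGroup₀.embedding
    strictMono' := IsRankLeOne.nonempty.some.strictMono.comp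
        MonoidWithZeroHom.ValueGroup₀.embedding_strictMono }
  have : ContinuousSMul F E := ⟨by
    have : (fun x : F × E => x.1 • x.2) = fun x : F × E => algebraMap F E x.1 * x.2 := by
      ext x; rw [Algebra.smul_def]
    rw [this]
    fun_prop⟩
  have : T2Space E := by
    let := IsTopologicalAddGroup.rightUniformSpace E
    have := isUniformAddGroup_of_addCommGroup (G := E)
    infer_instance
  exact LinearMap.continuous_of_finiteDimensional (𝕜 := F) (σ.toLinearEquiv : E →ₗ[F] E)

end LocalFieldLemmas

/-! ### The hermitian form and triangular matrices -/

section Triangular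

variable {F E : Type*} [Field F] [Field E] [Algebra F E] {σ : E ≃ₐ[F] E}

theorem add_two_add_two : ∀ i : Fin 4, i + 2 + 2 = i := by decide

theorem ne_add_two : ∀ i : Fin 4, i ≠ i + 2 := by decide

theorem add_two_eq_iff {i j : Fin 4} : i + 2 = j ↔ i = j + 2 := by
  revert i j; decide

/-- The signs `1, 1, -1, -1` of the nonzero entries of the form matrix. -/
def formSign (i : Fin 4) : ℤ := if i < 2 then 1 else -1

theorem formSign_mul_self (i : Fin 4) : formSign i * formSign i = 1 := by
  unfold formSign; split_ifs <;> rfl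

theorem formSign_add_two (i : Fin 4) : formSign (i + 2) = -formSign i := by
  revert i; decide

theorem formMatrix_apply (i j : Fin 4) :
    formMatrix E i j = if j = i + 2 then (formSign i : E) else 0 := by
  fin_cases i <;> fin_cases j <;> simp [formMatrix, formSign]

/-- The adjoint of a matrix with respect to the skew-hermitian form `s`, so that the elements of
`U(2,2)` are the matrices whose inverse is the adjoint. -/
def formAdjoint (σ : E ≃ₐ[F] E) (A : Matrix (Fin 4) (Fin 4) E) : Matrix (Fin 4) (Fin 4) E :=
  Matrix.of fun i j => ((formSign i * formSign j : ℤ) : E) * σ (A (j + 2) (i + 2))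

theorem formAdjoint_mul_formMatrix (A : Matrix (Fin 4) (Fin 4) E) :
    formAdjoint σ A * formMatrix E = formMatrix E * (A.map σ)ᵀ := by
  ext i j
  rw [Matrix.mul_apply, Matrix.mul_apply, Finset.sum_eq_single (j + 2),
    Finset.sum_eq_single (i + 2)]
  · have h : j = j + 2 + 2 := (add_two_add_two j).symm
    rw [formMatrix_apply, formMatrix_apply, if_pos h, if_pos rfl]
    simp only [formAdjoint, Matrix.of_apply, ← h, Matrix.transpose_apply, Matrix.map_apply]
    rw [mul_right_comm, ← Int.cast_mul, mul_assoc, formSign_mul_self, mul_one]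
  · intro k _ hk
    rw [formMatrix_apply, if_neg hk, zero_mul]
  · simp
  · intro k _ hk
    rw [formMatrix_apply, if_neg, mul_zero]
    intro h; apply hk; rw [h, add_two_add_two]
  · simp

theorem formMatrix_mul_self : formMatrix E * formMatrix E = -1 := by
  ext i j
  fin_cases i <;> fin_cases j <;> simp [formMatrix, Matrix.mul_apply, Fin.sum_univ_four]

theorem mul_formMatrix_cancel {A B : Matrix (Fin 4) (Fin 4) E}
    (h : A * formMatrix E = B * formMatrix E) : A = B := by
  have := congrArg (· * formMatrix E) h
  simpa [Matrix.mul_assoc, formMatrix_mul_self] using this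

theorem unitary_iff (A : Matrix (Fin 4) (Fin 4) E) :
    A * formMatrix E * (A.map σ)ᵀ = formMatrix E ↔ A * formAdjoint σ A = 1 := by
  rw [Matrix.mul_assoc, ← formAdjoint_mul_formMatrix, ← Matrix.mul_assoc]
  constructor
  · intro h
    exact mul_formMatrix_cancel (by rw [h, one_mul])
  · intro h
    rw [h, one_mul]

/-- The element of `U(2,2)` given by a matrix whose adjoint is its inverse. -/
def ofMulAdjoint (A : Matrix (Fin 4) (Fin 4) E) (h : A * formAdjoint σ A = 1) : U22 σ :=
  mkU22 σ A (formAdjoint σ A) h ((unitary_iff A).2 h)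

theorem toMat_mul (g h : U22 σ) : toMat (g * h) = toMat g * toMat h := rfl

theorem toMat_one : toMat (1 : U22 σ) = 1 := rfl

theorem toMat_injective : Function.Injective (toMat : U22 σ → Matrix (Fin 4) (Fin 4) E) :=
  fun _ _ h => Subtype.ext (Units.ext h)

theorem toMat_inv (g : U22 σ) : toMat g⁻¹ = formAdjoint σ (toMat g) := by
  have h : toMat g * formAdjoint σ (toMat g) = 1 := (unitary_iff _).1 g.2
  have h2 : toMat g⁻¹ * toMat g = 1 := by rw [← toMat_mul, inv_mul_cancel, toMat_one]
  calc toMat g⁻¹ = toMat g⁻¹ * (toMat g * formAdjoint σ (toMat g)) := by rw [h, mul_one]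
    _ = formAdjoint σ (toMat g) := by rw [← mul_assoc, h2, one_mul]

theorem toMat_inv_apply (g : U22 σ) (i j : Fin 4) :
    toMat g⁻¹ i j = ((formSign i * formSign j : ℤ) : E) * σ (toMat g (j + 2) (i + 2)) := by
  rw [toMat_inv]; rfl

theorem toMat_inv_eq_zero_iff (g : U22 σ) (i j : Fin 4) :
    toMat g⁻¹ i j = 0 ↔ toMat g (j + 2) (i + 2) = 0 := by
  rw [toMat_inv_apply]
  have : ((formSign i * formSign j : ℤ) : E) ≠ 0 := by
    unfold formSign; split_ifs <;> simp
  rw [mul_eq_zero, or_iff_right this, map_eq_zero]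

/-! ### Triangular subgroups -/

/-- The position of the coordinates `0, 1, 2, 3` in the flag `0, 1, 3, 2` fixed by the Borel
subgroup. -/
def flagRank : Fin 4 → Fin 4 := ![0, 1, 3, 2]

/-- The rank of the coordinates in the flag moved by `w`. -/
abbrev wRank (w : WeylGroup) (i : Fin 4) : Fin 4 := flagRank ((w : Equiv.Perm (Fin 4)) i)

theorem wRank_injective (w : WeylGroup) : Function.Injective (wRank w) := by
  have : Function.Injective flagRank := by decide
  exact this.comp (w : Equiv.Perm (Fin 4)).injective

theorem wRank_add_two (w : WeylGroup) (i : Fin 4) : wRank w (i + 2) = Fin.rev (wRank w i) := by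
  have h : ∀ i, flagRank (i + 2) = Fin.rev (flagRank i) := by decide
  unfold wRank
  rw [w.2 i, h]

/-- The Borel subgroup of `U(2,2)` that fixes the flag moved by `w`. -/
def triangular (σ : E ≃ₐ[F] E) (w : WeylGroup) : Subgroup (U22 σ) where
  carrier := {g | (toMat g).BlockTriangular (wRank w)}
  mul_mem' := by
    intro g h hg hh
    exact Matrix.BlockTriangular.mul hg hh
  one_mem' := Matrix.blockTriangular_one
  inv_mem' := by
    intro g hg _ _ hij
    rw [toMat_inv_eq_zero_iff]
    apply hg
    rw [wRank_add_two, wRank_add_two]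
    exact Fin.rev_lt_rev.2 hij

theorem mem_triangular {w : WeylGroup} {g : U22 σ} :
    g ∈ triangular σ w ↔ ∀ i j, wRank w j < wRank w i → toMat g i j = 0 :=
  ⟨fun h _ _ hij => h hij, fun h _ _ hij => h _ _ hij⟩

theorem toMat_mul_apply_diag {w : WeylGroup} {g h : U22 σ} (hg : g ∈ triangular σ w)
    (hh : h ∈ triangular σ w) (i : Fin 4) :
    toMat (g * h) i i = toMat g i i * toMat h i i := by
  rw [toMat_mul, Matrix.mul_apply, Finset.sum_eq_single i]
  · intro k _ hk
    rcases lt_or_gt_of_ne ((wRank_injective w).ne hk) with h1 | h1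
    · rw [hg h1, zero_mul]
    · rw [hh h1, mul_zero]
  · simp

/-- The unipotent radical of `triangular σ w`. -/
def unitriangular (σ : E ≃ₐ[F] E) (w : WeylGroup) : Subgroup (U22 σ) where
  carrier := {g | g ∈ triangular σ w ∧ ∀ i, toMat g i i = 1}
  mul_mem' := by
    intro g h hg hh
    refine ⟨mul_mem hg.1 hh.1, fun i => ?_⟩
    rw [toMat_mul_apply_diag hg.1 hh.1, hg.2, hh.2, one_mul]
  one_mem' := ⟨one_mem _, fun i => by simp [toMat_one]⟩
  inv_mem' := by
    intro g hg
    refine ⟨inv_mem hg.1, fun i => ?_⟩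
    rw [toMat_inv_apply, hg.2, formSign_mul_self]
    simp

theorem mem_unitriangular {w : WeylGroup} {g : U22 σ} :
    g ∈ unitriangular σ w ↔ (∀ i j, wRank w j < wRank w i → toMat g i j = 0) ∧
      ∀ i, toMat g i i = 1 := by
  rw [← mem_triangular]; rfl

theorem unipotent_eq : unipotent σ = unitriangular σ 1 := by
  ext g
  rw [mem_unitriangular]
  constructor
  · rintro ⟨⟨h1, h2, h3⟩, ⟨h4, h5, h6, h7⟩, h8, h9, h10⟩
    constructor
    · intro i j hij
      fin_cases i <;> fin_cases j <;> first | assumption | exact absurd hij (by decide)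
    · intro i
      fin_cases i <;> assumption
  · rintro ⟨h1, h2⟩
    exact ⟨⟨h2 0, h1 1 0 (by decide), h2 1⟩, ⟨h1 2 0 (by decide), h1 2 1 (by decide),
      h1 3 0 (by decide), h1 3 1 (by decide)⟩, h2 2, h1 2 3 (by decide), h2 3⟩

/-- The longest element of the Weyl group, which exchanges the paired coordinates. -/
def longestElt : WeylGroup := ⟨Equiv.addRight 2, fun _ => rfl⟩

theorem wRank_longestElt_mul (w : WeylGroup) (i : Fin 4) :
    wRank (longestElt * w) i = Fin.rev (wRank w i) := by
  rw [← wRank_add_two]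
  change flagRank (((w : Equiv.Perm (Fin 4)) i) + 2) = flagRank ((w : Equiv.Perm (Fin 4)) (i + 2))
  rw [w.2 i]

/-- Opposite unipotent groups meet in the identity. -/
theorem unitriangular_inf_longestElt {w : WeylGroup} {g : U22 σ} (h : g ∈ unitriangular σ w)
    (h' : g ∈ unitriangular σ (longestElt * w)) : g = 1 := by
  apply toMat_injective
  ext i j
  rw [toMat_one]
  rw [mem_unitriangular] at h h'
  rcases lt_trichotomy (wRank w i) (wRank w j) with h1 | h1 | h1
  · rw [h'.1 i j, Matrix.one_apply_ne]
    · rintro rfl; exact lt_irrefl _ h1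
    · rw [wRank_longestElt_mul, wRank_longestElt_mul]; exact Fin.rev_lt_rev.2 h1
  · obtain rfl := wRank_injective w h1
    rw [h.2, Matrix.one_apply_eq]
  · rw [h.1 i j h1, Matrix.one_apply_ne]
    rintro rfl; exact lt_irrefl _ h1

theorem oppUnipotent_subset {g : U22 σ} (h : g ∈ oppUnipotent σ) :
    g ∈ unitriangular σ longestElt := by
  obtain ⟨u, hu, hg⟩ := h
  rw [unipotent_eq, mem_unitriangular] at hu
  rw [mem_unitriangular, hg]
  refine ⟨fun i j hij => ?_, fun i => hu.2 i⟩
  rw [← mul_one longestElt, wRank_longestElt_mul, wRank_longestElt_mul, Fin.rev_lt_rev] at hij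
  exact hu.1 j i hij

/-! ### Monomial matrices -/

/-- `n` is a monomial matrix that moves the coordinates by `w`, i.e. it represents `w`. -/
def IsMonomial (n : U22 σ) (w : WeylGroup) : Prop :=
  ∀ i j, i ≠ (w : Equiv.Perm (Fin 4)) j → toMat n i j = 0

theorem IsMonomial.mul {n n' : U22 σ} {w w' : WeylGroup} (h : IsMonomial n w)
    (h' : IsMonomial n' w') : IsMonomial (n * n') (w * w') := by
  intro i j hij
  rw [toMat_mul, Matrix.mul_apply]
  refine Finset.sum_eq_zero fun k _ => ?_
  by_cases hk : k = (w' : Equiv.Perm (Fin 4)) j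
  · rw [h i k, zero_mul]
    rintro rfl; exact hij (by rw [hk]; rfl)
  · rw [h' k j hk, mul_zero]

theorem IsMonomial.one : IsMonomial (1 : U22 σ) 1 := by
  intro i j hij
  exact Matrix.one_apply_ne hij

theorem IsMonomial.inv {n : U22 σ} {w : WeylGroup} (h : IsMonomial n w) :
    IsMonomial n⁻¹ w⁻¹ := by
  intro i j hij
  rw [toMat_inv_eq_zero_iff]
  apply h
  intro hji
  apply hij
  rw [w.2 i, add_left_inj] at hji
  rw [hji]
  simp

theorem IsMonomial.ne_zero {n : U22 σ} {w : WeylGroup} (h : IsMonomial n w) (j : Fin 4) :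
    toMat n ((w : Equiv.Perm (Fin 4)) j) j ≠ 0 := by
  intro h0
  have h1 : (toMat n⁻¹ * toMat n) j j = 1 := by
    rw [← toMat_mul, inv_mul_cancel, toMat_one, Matrix.one_apply_eq]
  rw [Matrix.mul_apply, Finset.sum_eq_zero] at h1
  · exact zero_ne_one h1
  · intro k _
    by_cases hk : k = (w : Equiv.Perm (Fin 4)) j
    · rw [hk, h0, mul_zero]
    · rw [h k j hk, mul_zero]

theorem IsMonomial.mul_apply {n : U22 σ} {w : WeylGroup} (h : IsMonomial n w)
    (A : Matrix (Fin 4) (Fin 4) E) (i j : Fin 4) :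
    (toMat n * A) ((w : Equiv.Perm (Fin 4)) i) j =
      toMat n ((w : Equiv.Perm (Fin 4)) i) i * A i j := by
  rw [Matrix.mul_apply, Finset.sum_eq_single i]
  · intro k _ hk
    rw [h _ k, zero_mul]
    intro h; exact hk ((w : Equiv.Perm (Fin 4)).injective h).symm
  · simp

theorem IsMonomial.apply_mul_inv {n : U22 σ} {w : WeylGroup} (h : IsMonomial n w)
    (A : Matrix (Fin 4) (Fin 4) E) (i j : Fin 4) :
    (A * toMat n⁻¹) i ((w : Equiv.Perm (Fin 4)) j) =
      A i j * toMat n⁻¹ j ((w : Equiv.Perm (Fin 4)) j) := by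
  rw [Matrix.mul_apply, Finset.sum_eq_single j]
  · intro k _ hk
    rw [h.inv k _, mul_zero]
    simpa using hk
  · simp

theorem IsMonomial.conj_eq_zero_iff {n : U22 σ} {w : WeylGroup} (h : IsMonomial n w)
    (g : U22 σ) (i j : Fin 4) :
    toMat (n * g * n⁻¹) ((w : Equiv.Perm (Fin 4)) i) ((w : Equiv.Perm (Fin 4)) j) = 0 ↔
      toMat g i j = 0 := by
  rw [toMat_mul, toMat_mul, h.apply_mul_inv, h.mul_apply]
  have h1 := h.ne_zero i
  have h2 := h.inv.ne_zero ((w : Equiv.Perm (Fin 4)) j)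
  have h3 : ((w⁻¹ : WeylGroup) : Equiv.Perm (Fin 4)) ((w : Equiv.Perm (Fin 4)) j) = j := by simp
  rw [h3] at h2
  simp [h1, h2]

theorem IsMonomial.conj_diag {n : U22 σ} {w : WeylGroup} (h : IsMonomial n w)
    (g : U22 σ) (i : Fin 4) :
    toMat (n * g * n⁻¹) ((w : Equiv.Perm (Fin 4)) i) ((w : Equiv.Perm (Fin 4)) i) =
      toMat g i i := by
  have h1 : (toMat n * toMat n⁻¹) ((w : Equiv.Perm (Fin 4)) i) ((w : Equiv.Perm (Fin 4)) i) =
      1 := by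
    rw [← toMat_mul, mul_inv_cancel, toMat_one, Matrix.one_apply_eq]
  rw [h.mul_apply] at h1
  rw [toMat_mul, toMat_mul, h.apply_mul_inv, h.mul_apply]
  linear_combination (toMat g i i) * h1

theorem IsMonomial.conj_mem_triangular {n : U22 σ} {w : WeylGroup} (h : IsMonomial n w)
    (v : WeylGroup) (g : U22 σ) : n * g * n⁻¹ ∈ triangular σ v ↔ g ∈ triangular σ (v * w) := by
  rw [mem_triangular, mem_triangular]
  constructor
  · intro H i j hij
    rw [← h.conj_eq_zero_iff]
    exact H _ _ hij
  · intro H i j hij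
    obtain ⟨i, rfl⟩ := (w : Equiv.Perm (Fin 4)).surjective i
    obtain ⟨j, rfl⟩ := (w : Equiv.Perm (Fin 4)).surjective j
    rw [h.conj_eq_zero_iff]
    exact H _ _ hij

theorem IsMonomial.conj_mem_unitriangular {n : U22 σ} {w : WeylGroup} (h : IsMonomial n w)
    (v : WeylGroup) (g : U22 σ) :
    n * g * n⁻¹ ∈ unitriangular σ v ↔ g ∈ unitriangular σ (v * w) := by
  change _ ∈ triangular σ v ∧ _ ↔ _ ∈ triangular σ (v * w) ∧ _
  rw [h.conj_mem_triangular]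
  refine and_congr_right fun _ => ⟨fun H i => ?_, fun H i => ?_⟩
  · rw [← h.conj_diag]; exact H _
  · obtain ⟨i, rfl⟩ := (w : Equiv.Perm (Fin 4)).surjective i
    rw [h.conj_diag]; exact H _

theorem isMonomial_simpleRep (s : SimpleRoot) :
    IsMonomial (simpleRep σ s) (simpleReflection s) := by
  cases s
  · have h : ∀ j : Fin 4, ((simpleReflection .α : WeylGroup) : Equiv.Perm (Fin 4)) j =
      ![1, 0, 3, 2] j := by decide
    intro i j hij
    rw [h] at hij
    fin_cases i <;> fin_cases j <;> first | rfl | exact absurd rfl hij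
  · have h : ∀ j : Fin 4, ((simpleReflection .β : WeylGroup) : Equiv.Perm (Fin 4)) j =
      ![0, 3, 2, 1] j := by decide
    intro i j hij
    rw [h] at hij
    fin_cases i <;> fin_cases j <;> first | rfl | exact absurd rfl hij

/-- The product of the representatives of the simple reflections along a word. -/
def wordRep (σ : E ≃ₐ[F] E) (ω : List SimpleRoot) : U22 σ := (ω.map (simpleRep σ)).prod

theorem wordRep_append (ω ω' : List SimpleRoot) :
    wordRep σ (ω ++ ω') = wordRep σ ω * wordRep σ ω' := by simp [wordRep]

theorem wordRep_cons (s : SimpleRoot) (ω : List SimpleRoot) :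
    wordRep σ (s :: ω) = simpleRep σ s * wordRep σ ω := by simp [wordRep]

theorem wordProd_append (ω ω' : List SimpleRoot) :
    wordProd (ω ++ ω') = wordProd ω * wordProd ω' := by simp [wordProd]

theorem wordProd_cons (s : SimpleRoot) (ω : List SimpleRoot) :
    wordProd (s :: ω) = simpleReflection s * wordProd ω := by simp [wordProd]

theorem isMonomial_wordRep (ω : List SimpleRoot) : IsMonomial (wordRep σ ω) (wordProd ω) := by
  induction ω with
  | nil => exact IsMonomial.one
  | cons s ω ih =>
    rw [wordRep_cons, wordProd_cons]
    exact (isMonomial_simpleRep s).mul ih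

theorem isMonomial_weylRep (w : WeylGroup) : IsMonomial (weylRep σ w) w := by
  obtain ⟨h1, h2⟩ := (exists_isReducedWord w).choose_spec
  have h := isMonomial_wordRep (σ := σ) (exists_isReducedWord w).choose
  rwa [h2] at h

theorem mem_torus_iff {g : U22 σ} : g ∈ torus σ ↔ IsMonomial g 1 := by
  constructor
  · rintro ⟨a₁, a₂, h⟩ i j hij
    rw [h, Matrix.diagonal_apply_ne]
    exact hij
  · intro h
    have hd : ∀ i j, i ≠ j → toMat g i j = 0 := h
    have h0 : ∀ i, toMat g i i ≠ 0 := h.ne_zero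
    have h1 : ∀ i, toMat g i i * σ (toMat g (i + 2) (i + 2)) = 1 := by
      intro i
      have h2 : (toMat g * toMat g⁻¹) i i = 1 := by
        rw [← toMat_mul, mul_inv_cancel, toMat_one, Matrix.one_apply_eq]
      rw [Matrix.mul_apply, Finset.sum_eq_single i, toMat_inv_apply, formSign_mul_self] at h2
      · simpa using h2
      · intro k _ hk
        rw [hd i k hk.symm, zero_mul]
      · simp
    have h1' : ∀ i, toMat g (i + 2) (i + 2) = (σ (toMat g i i))⁻¹ := by
      intro i
      have h3 := h1 (i + 2)
      rw [add_two_add_two] at h3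
      exact eq_inv_of_mul_eq_one_left h3
    refine ⟨Units.mk0 _ (h0 0), Units.mk0 _ (h0 1), ?_⟩
    ext i j
    by_cases hij : i = j
    · subst hij
      rw [Matrix.diagonal_apply_eq]
      fin_cases i
      · rfl
      · rfl
      · exact h1' 0
      · exact h1' 1
    · rw [hd i j hij, Matrix.diagonal_apply_ne _ hij]

theorem torus_le_triangular {t : U22 σ} (h : t ∈ torus σ) (w : WeylGroup) :
    t ∈ triangular σ w := by
  rw [mem_torus_iff] at h
  rw [mem_triangular]
  rintro i j hij
  apply h
  rintro rfl
  exact lt_irrefl _ hij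

theorem exists_torus_mul {g : U22 σ} (hg : g ∈ triangular σ 1) :
    ∃ t ∈ torus σ, ∃ u ∈ unipotent σ, g = t * u := by
  have hdiag : ∀ i, toMat g i i * ((formSign i * formSign i : ℤ) : E) *
      σ (toMat g (i + 2) (i + 2)) = 1 := by
    intro i
    have := toMat_mul_apply_diag hg (inv_mem hg) i
    rw [mul_inv_cancel, toMat_one, Matrix.one_apply_eq, toMat_inv_apply] at this
    rw [mul_assoc, ← this]
  let t : U22 σ := ofMulAdjoint (Matrix.diagonal fun i => toMat g i i) (by
    ext i j
    rw [Matrix.diagonal_mul, formAdjoint, Matrix.of_apply]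
    by_cases hij : i = j
    · subst hij
      rw [Matrix.diagonal_apply_eq, Matrix.one_apply_eq, ← mul_assoc, hdiag]
    · rw [Matrix.diagonal_apply_ne, Matrix.one_apply_ne hij]
      · simp
      · simpa using Ne.symm hij)
  have ht : t ∈ torus σ := by
    rw [mem_torus_iff]
    intro i j hij
    exact Matrix.diagonal_apply_ne _ hij
  refine ⟨t, ht, t⁻¹ * g, ?_, by group⟩
  rw [unipotent_eq]
  have htt := torus_le_triangular ht 1
  refine ⟨mul_mem (inv_mem htt) hg, fun i => ?_⟩
  rw [toMat_mul_apply_diag (inv_mem htt) hg]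
  have h2 := toMat_mul_apply_diag (inv_mem htt) htt i
  rw [inv_mul_cancel, toMat_one, Matrix.one_apply_eq] at h2
  rw [h2]
  congr 1
  exact (Matrix.diagonal_apply_eq _ _).symm

theorem mem_borel_iff {g : U22 σ} : g ∈ borel σ ↔ g ∈ triangular σ 1 := by
  refine ⟨?_, exists_torus_mul⟩
  rintro ⟨t, ht, u, hu, rfl⟩
  rw [unipotent_eq] at hu
  exact mul_mem (torus_le_triangular ht 1) hu.1

/-- Two monomial matrices for the same Weyl group element differ by an element of the torus. -/
theorem IsMonomial.exists_torus_mul {n n' : U22 σ} {w : WeylGroup} (h : IsMonomial n w)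
    (h' : IsMonomial n' w) : ∃ t ∈ torus σ, n = t * n' := by
  refine ⟨n * n'⁻¹, ?_, by group⟩
  rw [mem_torus_iff]
  simpa using h.mul h'.inv

/-- `U_w⁻` is contained in the intersection of `U` with the unipotent group opposite to that
of `w`. -/
theorem mem_unipotentMinus {w : WeylGroup} {u : U22 σ} (h : u ∈ unipotentMinus σ w) :
    u ∈ unitriangular σ 1 ∧ u ∈ unitriangular σ (longestElt * w) := by
  refine ⟨unipotent_eq (σ := σ) ▸ h.1, ?_⟩
  rw [← (isMonomial_weylRep w).conj_mem_unitriangular]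
  exact oppUnipotent_subset h.2

/-! ### Root elements -/

section Root

/-- The nilpotent part of a root element, see `rootElt`. -/
def rootNil (σ : E ≃ₐ[F] E) (i j : Fin 4) (c : E) : Matrix (Fin 4) (Fin 4) E :=
  Matrix.of fun k l => if k = i ∧ l = j then c else if k = j + 2 ∧ l = i + 2 then
    -(((formSign i * formSign j : ℤ) : E) * σ c) else 0

theorem rootNil_eq_zero {i j : Fin 4} {c : E} {k l : Fin 4} (h1 : ¬(k = i ∧ l = j))
    (h2 : ¬(k = j + 2 ∧ l = i + 2)) : rootNil σ i j c k l = 0 := by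
  rw [rootNil, Matrix.of_apply, if_neg h1, if_neg h2]

theorem rootNil_mul_self {i j : Fin 4} (hij : i ≠ j) (c d : E) :
    rootNil σ i j c * rootNil σ i j d = 0 := by
  ext k l
  rw [Matrix.mul_apply]
  refine Finset.sum_eq_zero fun x _ => ?_
  by_cases h : (x = i ∧ l = j) ∨ (x = j + 2 ∧ l = i + 2)
  · rw [rootNil_eq_zero (i := i) (j := j) (k := k), zero_mul]
    · rintro ⟨-, rfl⟩
      rcases h with ⟨h, -⟩ | ⟨h, -⟩
      · exact hij h.symm
      · exact ne_add_two _ h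
    · rintro ⟨-, rfl⟩
      rcases h with ⟨h, -⟩ | ⟨h, -⟩
      · exact ne_add_two _ h.symm
      · rw [add_left_inj] at h; exact hij h
  · rw [not_or] at h
    rw [rootNil_eq_zero h.1 h.2, mul_zero]

theorem formAdjoint_one_add_rootNil (hσ : ∀ x, σ (σ x) = x) {i j : Fin 4} {c : E}
    (hc : j = i + 2 → σ c = c) :
    formAdjoint σ (1 + rootNil σ i j c) = 1 - rootNil σ i j c := by
  ext k l
  rw [formAdjoint, Matrix.of_apply, Matrix.add_apply, Matrix.sub_apply, map_add, mul_add,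
    sub_eq_add_neg]
  congr 1
  · by_cases hkl : k = l
    · subst hkl
      rw [formSign_mul_self]; simp
    · rw [Matrix.one_apply_ne hkl, Matrix.one_apply_ne]
      · simp
      · simpa using Ne.symm hkl
  · simp only [rootNil, Matrix.of_apply, add_two_eq_iff (j := i), add_two_eq_iff (j := j),
      add_left_inj]
    by_cases h1 : k = i ∧ l = j
    · obtain ⟨rfl, rfl⟩ := h1
      by_cases h2 : l = k + 2
      · subst h2
        rw [if_pos ⟨rfl, (add_two_add_two k).symm⟩, if_pos ⟨rfl, rfl⟩, hc rfl, formSign_add_two,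
          mul_neg, formSign_mul_self]
        simp
      · rw [if_neg (fun h => h2 h.1), if_pos ⟨rfl, rfl⟩, if_pos ⟨rfl, rfl⟩, map_neg, map_mul, hσ,
          map_intCast, mul_neg, ← mul_assoc, ← Int.cast_mul]
        have : formSign k * formSign l * (formSign k * formSign l) = 1 := by
          rw [mul_mul_mul_comm, formSign_mul_self, formSign_mul_self]; rfl
        rw [this]; simp
    · rw [if_neg h1]
      by_cases h2 : k = j + 2 ∧ l = i + 2
      · obtain ⟨rfl, rfl⟩ := h2
        rw [if_pos ⟨rfl, rfl⟩, if_pos ⟨rfl, rfl⟩, formSign_add_two, formSign_add_two]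
        push_cast
        ring
      · rw [if_neg h2, if_neg (fun h => h2 ⟨h.2, h.1⟩), if_neg (fun h => h1 ⟨h.2, h.1⟩)]
        simp

/-- The root element with the entry `c` in the place `(i, j)`, and the entry that this forces in
the place `(j + 2, i + 2)`. If these places agree, `c` has to be fixed by the conjugation. -/
def rootElt (hσ : ∀ x, σ (σ x) = x) (i j : Fin 4) (hij : i ≠ j) (c : E)
    (hc : j = i + 2 → σ c = c) : U22 σ :=
  ofMulAdjoint (1 + rootNil σ i j c) (by
    rw [formAdjoint_one_add_rootNil hσ hc, add_mul, one_mul, mul_sub, mul_one,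
      rootNil_mul_self hij]
    abel)

variable (hσ : ∀ x, σ (σ x) = x) {i j : Fin 4} (hij : i ≠ j)

theorem toMat_rootElt (c : E) (hc : j = i + 2 → σ c = c) :
    toMat (rootElt hσ i j hij c hc) = 1 + rootNil σ i j c := rfl

theorem rootElt_apply (c : E) (hc : j = i + 2 → σ c = c) :
    toMat (rootElt hσ i j hij c hc) i j = c := by
  rw [toMat_rootElt, Matrix.add_apply, Matrix.one_apply_ne hij]
  simp [rootNil]

theorem rootElt_zero (hc : j = i + 2 → σ (0 : E) = 0) :
    rootElt hσ i j hij 0 hc = 1 := by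
  apply toMat_injective
  ext k l
  simp [toMat_rootElt, rootNil, toMat_one]

theorem rootElt_mem_unitriangular (c : E) (hc : j = i + 2 → σ c = c) {w : WeylGroup}
    (h : wRank w i < wRank w j) : rootElt hσ i j hij c hc ∈ unitriangular σ w := by
  have h' : wRank w (j + 2) < wRank w (i + 2) := by
    rw [wRank_add_two, wRank_add_two]; exact Fin.rev_lt_rev.2 h
  rw [mem_unitriangular]
  simp only [toMat_rootElt, Matrix.add_apply]
  refine ⟨fun k l hkl => ?_, fun k => ?_⟩
  · rw [Matrix.one_apply_ne (by rintro rfl; exact lt_irrefl _ hkl), rootNil_eq_zero, add_zero]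
    · rintro ⟨rfl, rfl⟩; exact lt_asymm h hkl
    · rintro ⟨rfl, rfl⟩; exact lt_asymm h' hkl
  · rw [Matrix.one_apply_eq, rootNil_eq_zero, add_zero]
    · rintro ⟨rfl, h2⟩; exact hij h2
    · rintro ⟨rfl, h2⟩; rw [add_left_inj] at h2; exact hij h2.symm

end Root

end Triangular

/-! ### Entries, lattices and the Howe groups -/

section Entries

variable {F E : Type*} [Field F] [Field E] [Algebra F E] {σ : E ≃ₐ[F] E} {ϖ : Fˣ}

/-- The deviation from `1` of a product. -/
theorem toMat_mul_sub (g g' : U22 σ) (i j : Fin 4) :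
    toMat (g * g') i j - (1 : Matrix (Fin 4) (Fin 4) E) i j =
      (toMat g i j - (1 : Matrix (Fin 4) (Fin 4) E) i j) +
      (toMat g' i j - (1 : Matrix (Fin 4) (Fin 4) E) i j) +
      ∑ k, (toMat g i k - (1 : Matrix (Fin 4) (Fin 4) E) i k) *
        (toMat g' k j - (1 : Matrix (Fin 4) (Fin 4) E) k j) := by
  have : toMat g * toMat g' - 1 =
      (toMat g - 1) + (toMat g' - 1) + (toMat g - 1) * (toMat g' - 1) := by
    noncomm_ring
  have := congrFun (congrFun this i) j
  rw [Matrix.add_apply, Matrix.add_apply, Matrix.mul_apply] at this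
  exact this

theorem toMat_inv_sub (g : U22 σ) (i j : Fin 4) :
    toMat g⁻¹ i j - (1 : Matrix (Fin 4) (Fin 4) E) i j = ((formSign i * formSign j : ℤ) : E) *
      σ (toMat g (j + 2) (i + 2) - (1 : Matrix (Fin 4) (Fin 4) E) (j + 2) (i + 2)) := by
  rw [toMat_inv_apply, map_sub, mul_sub]
  congr 1
  by_cases hij : i = j
  · subst hij; rw [formSign_mul_self]; simp
  · rw [Matrix.one_apply_ne hij, Matrix.one_apply_ne (by simpa using Ne.symm hij)]; simp

theorem intCast_mul_mem {E : Type*} [Field E] (A : AddSubgroup E) (n : ℤ) {x : E}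
    (hx : x ∈ A) : (n : E) * x ∈ A := by
  rw [← zsmul_eq_mul]; exact A.zsmul_mem hx n

/-- Entries just above the diagonal add up in products. Here `i` and `j` are neighbours in the flag
moved by `w`. -/
theorem toMat_mul_apply_adjacent {w : WeylGroup} {g g' : U22 σ} (hg : g ∈ unitriangular σ w)
    (hg' : g' ∈ unitriangular σ w) {i j : Fin 4}
    (hadj : (wRank w i : ℕ) + 1 = wRank w j) :
    toMat (g * g') i j = toMat g i j + toMat g' i j := by
  have hij : i ≠ j := by rintro rfl; omega
  have := toMat_mul_sub g g' i j
  rw [Matrix.one_apply_ne hij, sub_zero, sub_zero, sub_zero, Finset.sum_eq_zero, add_zero] at this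
  · exact this
  · intro k _
    rw [mem_unitriangular] at hg hg'
    by_cases h1 : wRank w k ≤ wRank w i
    · have : toMat g i k - (1 : Matrix (Fin 4) (Fin 4) E) i k = 0 := by
        rcases h1.lt_or_eq with h2 | h2
        · rw [hg.1 i k h2, Matrix.one_apply_ne, sub_zero]
          rintro rfl; exact lt_irrefl _ h2
        · obtain rfl := wRank_injective w h2
          rw [hg.2, Matrix.one_apply_eq, sub_self]
      rw [this, zero_mul]
    · have h1 : wRank w j ≤ wRank w k := by
        rw [not_le, Fin.lt_def] at h1
        rw [Fin.le_def]; omega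
      have : toMat g' k j - (1 : Matrix (Fin 4) (Fin 4) E) k j = 0 := by
        rcases h1.lt_or_eq with h2 | h2
        · rw [hg'.1 k j h2, Matrix.one_apply_ne, sub_zero]
          rintro rfl; exact lt_irrefl _ h2
        · obtain rfl := wRank_injective w h2
          rw [hg'.2, Matrix.one_apply_eq, sub_self]
      rw [this, mul_zero]

theorem toMat_inv_apply_adjacent {w : WeylGroup} {g : U22 σ} (hg : g ∈ unitriangular σ w)
    {i j : Fin 4} (hadj : (wRank w i : ℕ) + 1 = wRank w j) :
    toMat g⁻¹ i j = -toMat g i j := by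
  have hij : i ≠ j := by rintro rfl; omega
  have := toMat_mul_apply_adjacent hg (inv_mem hg) hadj
  rw [mul_inv_cancel, toMat_one, Matrix.one_apply_ne hij] at this
  linear_combination -this

/-- The entry of a unipotent element in a simple root of the form `2 e_i` is fixed by `σ`. -/
theorem conj_apply_adjacent {w : WeylGroup} {g : U22 σ} (hg : g ∈ unitriangular σ w)
    {i : Fin 4} (hadj : (wRank w i : ℕ) + 1 = wRank w (i + 2)) :
    σ (toMat g i (i + 2)) = toMat g i (i + 2) := by
  have h1 := toMat_inv_apply_adjacent hg hadj
  rw [toMat_inv_apply, add_two_add_two, formSign_add_two, mul_neg, formSign_mul_self] at h1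
  push_cast at h1
  linear_combination -h1

theorem toMat_apply_swap_eq_zero {w : WeylGroup} {g : U22 σ} (hg : g ∈ unitriangular σ w)
    {i j : Fin 4} (hadj : (wRank w i : ℕ) + 1 = wRank w j) (h0 : toMat g i j = 0) :
    toMat g (j + 2) (i + 2) = 0 := by
  rw [← toMat_inv_eq_zero_iff, toMat_inv_apply_adjacent hg hadj, h0, neg_zero]

/-- The exponents of the element `d_m = diag(ϖ ^ (m e_i))`. -/
def weight : Fin 4 → ℤ := ![-3, -1, 3, 1]

theorem weight_add_two (i : Fin 4) : weight (i + 2) = -weight i := by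
  revert i; decide

theorem uniformizer_ne_zero : algebraMap F E (ϖ : F) ≠ 0 := by simp

theorem toMat_scalingElt (m : ℕ) :
    toMat (scalingElt σ ϖ m) =
      Matrix.diagonal fun i => algebraMap F E (ϖ : F) ^ (m * weight i : ℤ) := by
  change Matrix.diagonal _ = _
  congr 1
  ext i
  fin_cases i <;> simp only [weight, Fin.zero_eta, Fin.mk_one, Fin.reduceFinMk, Matrix.cons_val]
  · rw [mul_neg, zpow_neg, ← inv_zpow, ← zpow_natCast]; congr 1; push_cast; ring
  · rw [mul_neg, zpow_neg, ← inv_zpow, ← zpow_natCast]; congr 1; ring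
  · rw [← zpow_natCast]; congr 1; push_cast; ring
  · rw [← zpow_natCast]; congr 1; ring

theorem toMat_scalingElt_inv (m : ℕ) :
    toMat (scalingElt σ ϖ m)⁻¹ =
      Matrix.diagonal fun i => algebraMap F E (ϖ : F) ^ (-(m * weight i) : ℤ) := by
  ext i j
  rw [toMat_inv_apply, toMat_scalingElt]
  by_cases hij : i = j
  · subst hij
    rw [Matrix.diagonal_apply_eq, Matrix.diagonal_apply_eq, formSign_mul_self, map_zpow₀,
      AlgEquiv.commutes, weight_add_two]
    simp
  · rw [Matrix.diagonal_apply_ne _ hij, Matrix.diagonal_apply_ne]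
    · simp
    · simpa using Ne.symm hij

end Entries

section Lattice

variable {E : Type*} [Field E] [ValuativeRel E]

/-- The fractional ideal `p ^ n 𝒪[E]`. -/
def fracIdeal (p : E) (n : ℤ) : AddSubgroup E where
  carrier := {x | p ^ (-n) * x ∈ 𝒪[E]}
  add_mem' := by
    intro x y hx hy
    simp only [Set.mem_ofPred_eq] at hx hy ⊢
    rw [mul_add]; exact add_mem hx hy
  zero_mem' := by simp
  neg_mem' := by
    intro x hx
    simp only [Set.mem_ofPred_eq] at hx ⊢
    rw [mul_neg]; exact neg_mem hx

variable {p : E}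

theorem mem_fracIdeal {n : ℤ} {x : E} : x ∈ fracIdeal p n ↔ p ^ (-n) * x ∈ 𝒪[E] := Iff.rfl

theorem mem_fracIdeal_zero {x : E} : x ∈ fracIdeal p 0 ↔ x ∈ 𝒪[E] := by simp [mem_fracIdeal]

theorem mul_mem_fracIdeal (hp0 : p ≠ 0) {a b : ℤ} {x y : E} (hx : x ∈ fracIdeal p a)
    (hy : y ∈ fracIdeal p b) : x * y ∈ fracIdeal p (a + b) := by
  rw [mem_fracIdeal] at *
  have : p ^ (-(a + b)) * (x * y) = p ^ (-a) * x * (p ^ (-b) * y) := by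
    rw [neg_add, zpow_add₀ hp0]; ring
  rw [this]; exact mul_mem hx hy

theorem fracIdeal_antitone (hp0 : p ≠ 0) (hp : p ∈ 𝒪[E]) {a b : ℤ} (hab : a ≤ b) :
    fracIdeal p b ≤ fracIdeal p a := by
  intro x hx
  rw [mem_fracIdeal] at *
  obtain ⟨n, rfl⟩ := Int.le.dest hab
  have : p ^ (-a) * x = p ^ n * (p ^ (-(a + n)) * x) := by
    rw [← mul_assoc, ← zpow_natCast, ← zpow_add₀ hp0]; congr 2; ring
  rw [this]; exact mul_mem (pow_mem hp n) hx

theorem inv_mem_fracIdeal {n : ℤ} {x : E} (hx : x ∉ fracIdeal p n) :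
    x⁻¹ ∈ fracIdeal p (-n) := by
  rw [mem_fracIdeal] at *
  rw [Valuation.mem_integer_iff, not_le] at hx
  rw [Valuation.mem_integer_iff]
  have : p ^ (- -n) * x⁻¹ = (p ^ (-n) * x)⁻¹ := by
    rw [mul_inv, zpow_neg, zpow_neg, inv_inv]
  rw [this, map_inv₀]
  exact inv_le_one_of_one_le₀ hx.le

/-- An element of `1 + 𝓟` is a unit. -/
theorem inv_mem_integer_of_sub_one_mem (hp0 : p ≠ 0) (hp1 : valuation E p < 1) {x : E}
    {n : ℤ} (hn : 1 ≤ n)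
    (hx : x - 1 ∈ fracIdeal p n) : x⁻¹ ∈ 𝒪[E] ∧ x ≠ 0 := by
  have h1 : x - 1 ∈ fracIdeal p 1 := fracIdeal_antitone hp0 hp1.le hn hx
  have h2 : valuation E (x - 1) < 1 := by
    rw [mem_fracIdeal, Valuation.mem_integer_iff] at h1
    have : x - 1 = p * (p ^ (-1 : ℤ) * (x - 1)) := by
      rw [zpow_neg_one, mul_inv_cancel_left₀ hp0]
    rw [this, map_mul]
    exact (mul_le_of_le_one_right' h1).trans_lt hp1
  have h3 : valuation E x = 1 := by
    have := (valuation E).map_one_add_of_lt h2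
    simpa using this
  refine ⟨?_, fun h => ?_⟩
  · rw [Valuation.mem_integer_iff, map_inv₀, h3, inv_one]
  · rw [h] at h3; simp at h3

theorem maxIdealPow_eq (hp0 : p ≠ 0) (hp : IsUniformizer p) (m : ℕ) :
    maxIdealPow E m = {x | x ∈ fracIdeal p m} := by
  obtain ⟨h, hp⟩ := hp
  ext x
  simp only [maxIdealPow, Set.mem_ofPred_eq, hp, Ideal.span_singleton_pow,
    Ideal.mem_span_singleton, mem_fracIdeal]
  constructor
  · rintro ⟨_, ⟨y, rfl⟩, rfl⟩
    have : p ^ (-(m : ℤ)) * (p ^ m * (y : E)) = y := by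
      rw [zpow_neg, zpow_natCast, inv_mul_cancel_left₀ (pow_ne_zero m hp0)]
    simp only [Subring.coe_mul, SubmonoidClass.mk_pow]
    rw [this]; exact y.2
  · intro hx
    refine ⟨⟨p, h⟩ ^ m * ⟨_, hx⟩, Dvd.intro _ rfl, ?_⟩
    simp only [SubmonoidClass.mk_pow, Subring.coe_mul]
    rw [zpow_neg, zpow_natCast, mul_inv_cancel_left₀ (pow_ne_zero m hp0)]

end Lattice

section HoweGroups

variable {F E : Type*} [Field F] [ValuativeRel F] [Field E] [ValuativeRel E] [Algebra F E]

/-- The algebraic properties of an unramified quadratic extension `E/F` with conjugation `σ` and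
uniformizer `ϖ`: `σ` is an integral involution with fixed field `F`, and `ϖ` remains a uniformizer
of `E`. -/
structure IsUnramifiedConj (σ : E ≃ₐ[F] E) (ϖ : Fˣ) : Prop where
  invol : ∀ x, σ (σ x) = x
  fixed : ∀ x, σ x = x → ∃ c, algebraMap F E c = x
  integral : ∀ x ∈ 𝒪[E], σ x ∈ 𝒪[E]
  base : ∀ x : F, algebraMap F E x ∈ 𝒪[E] ↔ x ∈ 𝒪[F]
  uniformizer : IsUniformizer (algebraMap F E ϖ)
  lt_one : valuation E (algebraMap F E ϖ) < 1

variable {σ : E ≃ₐ[F] E} {ϖ : Fˣ}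

/-- The uniformizer `ϖ` of `F`, as an element of `E`. -/
local notation "𝔭" => algebraMap F E (ϖ : F)

theorem IsUnramifiedConj.map_mem (h : IsUnramifiedConj σ ϖ) {x : E} {n : ℤ}
    (hx : x ∈ fracIdeal 𝔭 n) : σ x ∈ fracIdeal 𝔭 n := by
  rw [mem_fracIdeal] at *
  have := h.integral _ hx
  rwa [map_mul, map_zpow₀, AlgEquiv.commutes] at this

theorem IsUnramifiedConj.anti (h : IsUnramifiedConj σ ϖ) {x : E} {a b : ℤ} (hab : a ≤ b)
    (hx : x ∈ fracIdeal 𝔭 b) : x ∈ fracIdeal 𝔭 a :=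
  fracIdeal_antitone uniformizer_ne_zero h.lt_one.le hab hx

/-- The exponent of the fractional ideal that bounds the entry `(i, j)` of `h - 1` for
`h ∈ H_m`. -/
def howeExp (m : ℕ) (i j : Fin 4) : ℤ := m * (weight i - weight j + 1)

theorem howeExp_swap (m : ℕ) (i j : Fin 4) :
    howeExp m (j + 2) (i + 2) = howeExp m i j := by
  rw [howeExp, howeExp, weight_add_two, weight_add_two]; ring

theorem howeExp_add (m : ℕ) (i j k : Fin 4) :
    howeExp m i k + howeExp m k j = howeExp m i j + m := by
  rw [howeExp, howeExp, howeExp]; ring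

/-- The Howe group is given by bounds on the entries: conjugation by `d_m` rescales the entry
`(i, j)` by `ϖ ^ (m (e_i - e_j))`. -/
theorem mem_howeGroup (h : IsUnramifiedConj σ ϖ) {m : ℕ} {g : U22 σ} :
    g ∈ howeGroup σ ϖ m ↔ ∀ i j, toMat g i j - (1 : Matrix (Fin 4) (Fin 4) E) i j ∈
      fracIdeal 𝔭 (howeExp m i j) := by
  have h0 : (𝔭 : E) ≠ 0 := uniformizer_ne_zero
  have key : ∀ i j, toMat ((scalingElt σ ϖ m)⁻¹ * g * scalingElt σ ϖ m) i j -
      (1 : Matrix (Fin 4) (Fin 4) E) i j = 𝔭 ^ (-(m * weight i) + m * weight j : ℤ) * (toMat g i j -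
      (1 : Matrix (Fin 4) (Fin 4) E) i j) := by
    intro i j
    rw [toMat_mul, toMat_mul, toMat_scalingElt, toMat_scalingElt_inv, Matrix.mul_diagonal,
      Matrix.diagonal_mul, zpow_add₀ h0]
    by_cases hij : i = j
    · subst hij
      rw [Matrix.one_apply_eq]
      have : (𝔭 : E) ^ (-(m * weight i) : ℤ) * 𝔭 ^ (m * weight i : ℤ) = 1 := by
        rw [← zpow_add₀ h0]; simp
      linear_combination this
    · rw [Matrix.one_apply_ne hij]; ring
  have hiff : g ∈ howeGroup σ ϖ m ↔
      (scalingElt σ ϖ m)⁻¹ * g * scalingElt σ ϖ m ∈ congruence σ m := by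
    constructor
    · rintro ⟨k, hk, rfl⟩
      convert hk using 1
      group
    · intro hk
      exact ⟨_, hk, by group⟩
  rw [hiff]
  simp only [congruence, Set.mem_ofPred_eq, key, maxIdealPow_eq h0 h.uniformizer, mem_fracIdeal]
  refine forall_congr' fun i => forall_congr' fun j => ?_
  rw [← mul_assoc, ← zpow_add₀ h0]
  have : -(m : ℤ) + (-(m * weight i) + m * weight j) = -howeExp m i j := by rw [howeExp]; ring
  rw [this]

theorem mem_congruence (h : IsUnramifiedConj σ ϖ) {m : ℕ} {g : U22 σ} :
    g ∈ congruence σ m ↔ ∀ i j, toMat g i j - (1 : Matrix (Fin 4) (Fin 4) E) i j ∈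
      fracIdeal 𝔭 m := by
  simp only [congruence, Set.mem_ofPred_eq, maxIdealPow_eq uniformizer_ne_zero h.uniformizer]

omit [ValuativeRel F] in
/-- The second-order terms in a product of elements of `H_m` gain a factor `ϖ ^ m`. In the places of
the simple roots, where `howeExp m` is `-m`, they are integral. -/
theorem howe_cross_term (g g' : U22 σ) {m : ℕ}
    (hg : ∀ i j, toMat g i j - (1 : Matrix (Fin 4) (Fin 4) E) i j ∈ fracIdeal 𝔭 (howeExp m i j))
    (hg' : ∀ i j, toMat g' i j - (1 : Matrix (Fin 4) (Fin 4) E) i j ∈ fracIdeal 𝔭 (howeExp m i j))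
    (i j : Fin 4) :
    ∑ k, (toMat g i k - (1 : Matrix (Fin 4) (Fin 4) E) i k) *
        (toMat g' k j - (1 : Matrix (Fin 4) (Fin 4) E) k j) ∈ fracIdeal 𝔭 (howeExp m i j + m) := by
  refine sum_mem fun k _ => ?_
  rw [← howeExp_add m i j k]
  exact mul_mem_fracIdeal uniformizer_ne_zero (hg i k) (hg' k j)

/-- The elements of the Howe group `H_m` whose entry `(1, 3)` lies in `F + 𝒪[E]`, so that its
component in `F` is defined modulo `𝒪[F]`. On this group the generic character of `U_m` extends to a
character, see `howeChar`. It contains `U_m` and the root elements that lie in `H_m`. -/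
def howeSubgroup (h : IsUnramifiedConj σ ϖ) (m : ℕ) : Subgroup (U22 σ) where
  carrier := {g | (∀ i j, toMat g i j - (1 : Matrix (Fin 4) (Fin 4) E) i j ∈
      fracIdeal 𝔭 (howeExp m i j)) ∧ ∃ c : F, toMat g 1 3 - algebraMap F E c ∈ 𝒪[E]}
  mul_mem' := by
    rintro a b ⟨ha, c, hc⟩ ⟨hb, d, hd⟩
    refine ⟨fun i j => ?_, c + d, ?_⟩
    · rw [toMat_mul_sub]
      exact add_mem (add_mem (ha i j) (hb i j))
        (h.anti (by omega) (howe_cross_term a b ha hb i j))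
    · have h1 := toMat_mul_sub a b 1 3
      have h2 := howe_cross_term a b ha hb 1 3
      have h3 : howeExp m 1 3 + m = 0 := by simp [howeExp, weight]
      rw [h3, mem_fracIdeal_zero] at h2
      rw [Matrix.one_apply_ne (by decide), sub_zero, sub_zero, sub_zero] at h1
      rw [h1, map_add]
      convert add_mem (add_mem hc hd) h2 using 1
      ring
  one_mem' := ⟨fun i j => by rw [toMat_one, sub_self]; exact zero_mem _, 0, by
    rw [toMat_one, Matrix.one_apply_ne (by decide)]; simp⟩
  inv_mem' := by
    rintro a ⟨ha, c, hc⟩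
    refine ⟨fun i j => ?_, -c, ?_⟩
    · rw [toMat_inv_sub]
      apply intCast_mul_mem
      rw [← howeExp_swap]
      exact h.map_mem (ha _ _)
    · rw [toMat_inv_apply]
      have := neg_mem (h.integral _ hc)
      rw [map_sub, AlgEquiv.commutes] at this
      convert this using 1
      have h1 : ((formSign 1 * formSign 3 : ℤ) : E) = -1 := by simp [formSign]
      rw [h1, map_neg]
      change -1 * σ (toMat a 1 3) - _ = _
      ring

/-- The congruence subgroup `K_m` as a subgroup. -/
def congruenceSubgroup (h : IsUnramifiedConj σ ϖ) (m : ℕ) : Subgroup (U22 σ) where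
  carrier := congruence σ m
  mul_mem' := by
    intro a b ha hb
    rw [mem_congruence h] at *
    intro i j
    rw [toMat_mul_sub]
    refine add_mem (add_mem (ha i j) (hb i j)) (sum_mem fun k _ => ?_)
    exact h.anti (by omega) (mul_mem_fracIdeal uniformizer_ne_zero (ha i k) (hb k j))
  one_mem' := by
    rw [mem_congruence h]
    intro i j
    rw [toMat_one, sub_self]; exact zero_mem _
  inv_mem' := by
    intro a ha
    rw [mem_congruence h] at *
    intro i j
    rw [toMat_inv_sub]
    exact intCast_mul_mem _ _ (h.map_mem (ha _ _))

theorem mem_congruenceSubgroup (h : IsUnramifiedConj σ ϖ) {m : ℕ} {g : U22 σ} :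
    g ∈ congruenceSubgroup h m ↔ g ∈ congruence σ m := Iff.rfl

theorem unipotent_inf_howeGroup_le (h : IsUnramifiedConj σ ϖ) {m : ℕ} {u : U22 σ}
    (hu : u ∈ unipotent σ) (hm : u ∈ howeGroup σ ϖ m) : u ∈ howeSubgroup h m := by
  refine ⟨(mem_howeGroup h).1 hm, ?_⟩
  rw [unipotent_eq] at hu
  obtain ⟨c, hc⟩ := h.fixed _ (conj_apply_adjacent (i := 1) hu (by decide))
  refine ⟨c, ?_⟩
  rw [hc]
  simp

theorem howeSubgroup_le (h : IsUnramifiedConj σ ϖ) {m : ℕ} {g : U22 σ}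
    (hg : g ∈ howeSubgroup h m) : g ∈ howeGroup σ ϖ m := (mem_howeGroup h).2 hg.1

theorem rootElt_mem_howeSubgroup (h : IsUnramifiedConj σ ϖ) {m : ℕ} {i j : Fin 4} (hij : i ≠ j)
    (c : E) (hc : j = i + 2 → σ c = c) (hm : c ∈ fracIdeal 𝔭 (howeExp m i j)) :
    rootElt h.invol i j hij c hc ∈ howeSubgroup h m := by
  refine ⟨fun k l => ?_, ?_⟩
  · rw [toMat_rootElt, Matrix.add_apply, add_sub_cancel_left, rootNil, Matrix.of_apply]
    split_ifs with h1 h2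
    · obtain ⟨rfl, rfl⟩ := h1; exact hm
    · obtain ⟨rfl, rfl⟩ := h2
      rw [howeExp_swap]
      exact neg_mem (intCast_mul_mem _ _ (h.map_mem hm))
    · exact zero_mem _
  · by_cases h1 : i = 1 ∧ j = 3
    · obtain ⟨rfl, rfl⟩ := h1
      obtain ⟨d, hd⟩ := h.fixed _ (hc rfl)
      refine ⟨d, ?_⟩
      rw [hd, rootElt_apply, sub_self]
      exact zero_mem _
    · refine ⟨0, ?_⟩
      rw [toMat_rootElt, Matrix.add_apply, Matrix.one_apply_ne (by decide), rootNil_eq_zero]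
      · simp
      · rintro ⟨rfl, rfl⟩; exact h1 ⟨rfl, rfl⟩
      · rw [← add_two_eq_iff, ← add_two_eq_iff]
        rintro ⟨rfl, rfl⟩; exact h1 ⟨rfl, rfl⟩

/-- On the roots of `U` the exponents `howeExp m` are at most `-m`; in particular they decrease
with `m`. -/
theorem weight_lt_of_rank_lt {i j : Fin 4} : wRank 1 i < wRank 1 j →
    weight i - weight j + 1 ≤ -1 := by
  revert i j; decide

theorem mem_howeSubgroup_of_upper (h : IsUnramifiedConj σ ϖ) {m : ℕ} {u : U22 σ}
    (hu : u ∈ unipotent σ) (hm : ∀ i j, wRank 1 i < wRank 1 j →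
      toMat u i j ∈ fracIdeal 𝔭 (howeExp m i j)) : u ∈ howeSubgroup h m := by
  refine unipotent_inf_howeGroup_le h hu ?_
  rw [mem_howeGroup h]
  intro i j
  rw [unipotent_eq, mem_unitriangular] at hu
  rcases lt_trichotomy (wRank 1 i) (wRank 1 j) with h1 | h1 | h1
  · rw [Matrix.one_apply_ne (by rintro rfl; exact lt_irrefl _ h1), sub_zero]
    exact hm i j h1
  · obtain rfl := wRank_injective 1 h1
    rw [hu.2, Matrix.one_apply_eq, sub_self]; exact zero_mem _
  · rw [hu.1 i j h1, Matrix.one_apply_ne (by rintro rfl; exact lt_irrefl _ h1), sub_self]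
    exact zero_mem _

/-- The groups `U_m` increase with `m`. -/
theorem unipotent_inf_howeSubgroup_mono (h : IsUnramifiedConj σ ϖ) {k m : ℕ} (hkm : k ≤ m)
    {u : U22 σ} (hu : u ∈ unipotent σ) (hk : u ∈ howeSubgroup h k) : u ∈ howeSubgroup h m := by
  refine mem_howeSubgroup_of_upper h hu fun i j hij => ?_
  have h1 := hk.1 i j
  rw [Matrix.one_apply_ne (by rintro rfl; exact lt_irrefl _ hij), sub_zero] at h1
  refine h.anti ?_ h1
  have := weight_lt_of_rank_lt hij
  rw [howeExp, howeExp]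
  have hkm' : (k : ℤ) ≤ m := by exact_mod_cast hkm
  exact mul_le_mul_of_nonpos_right hkm' (by omega)

theorem unipotent_inf_congruence_le (h : IsUnramifiedConj σ ϖ) {C : ℕ} (m : ℕ)
    {u : U22 σ} (hu : u ∈ unipotent σ) (hk : u ∈ congruenceSubgroup h C) :
    u ∈ howeSubgroup h m := by
  refine mem_howeSubgroup_of_upper h hu fun i j hij => ?_
  have h1 := (mem_congruence h).1 hk i j
  rw [Matrix.one_apply_ne (by rintro rfl; exact lt_irrefl _ hij), sub_zero] at h1
  refine h.anti ?_ h1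
  have := weight_lt_of_rank_lt hij
  rw [howeExp]
  have h3 : (m : ℤ) * (weight i - weight j + 1) ≤ 0 :=
    mul_nonpos_of_nonneg_of_nonpos (by omega) (by omega)
  omega

/-! ### The Iwahori factorization -/

omit [ValuativeRel F] [ValuativeRel E] in
theorem rootElt_mul_apply {h : ∀ x, σ (σ x) = x} {i j : Fin 4} (hij : i ≠ j)
    (c : E) (hc : j = i + 2 → σ c = c) (g : U22 σ) (l : Fin 4) :
    toMat (rootElt h i j hij c hc * g) i l = toMat g i l + c * toMat g j l := by
  rw [toMat_mul, toMat_rootElt, add_mul, one_mul, Matrix.add_apply, Matrix.mul_apply,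
    Finset.sum_eq_single j]
  · simp [rootNil]
  · intro k _ hk
    rw [rootNil_eq_zero, zero_mul]
    · rintro ⟨-, h⟩; exact hk h
    · rintro ⟨h1, h2⟩
      rw [h1, add_two_add_two] at h2
      exact hk h2
  · simp

omit [ValuativeRel F] [ValuativeRel E] in
theorem rootElt_mul_apply_of_ne {h : ∀ x, σ (σ x) = x} {i j : Fin 4} (hij : i ≠ j)
    (c : E) (hc : j = i + 2 → σ c = c) (g : U22 σ) {k : Fin 4} (h1 : k ≠ i) (h2 : k ≠ j + 2)
    (l : Fin 4) : toMat (rootElt h i j hij c hc * g) k l = toMat g k l := by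
  rw [toMat_mul, toMat_rootElt, add_mul, one_mul, Matrix.add_apply, Matrix.mul_apply,
    Finset.sum_eq_zero, add_zero]
  intro x _
  rw [rootNil_eq_zero (fun h => h1 h.1) (fun h => h2 h.1), zero_mul]

/-- The entry `(i, j)` of an element of the Howe group is removed by a row operation, that is, by an
element of `U_m` on the left. -/
theorem exists_eliminate (h : IsUnramifiedConj σ ϖ) {m : ℕ} (hm : 1 ≤ m) {g : U22 σ}
    (hg : g ∈ howeSubgroup h m) {i j : Fin 4} (hij : wRank 1 i < wRank 1 j)
    (hc : j = i + 2 → σ (toMat g i j / toMat g j j) = toMat g i j / toMat g j j) :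
    ∃ u ∈ unipotent σ, u ∈ howeSubgroup h m ∧ toMat (u * g) i j = 0 ∧
      (∀ k l, k ≠ i → k ≠ j + 2 → toMat (u * g) k l = toMat g k l) ∧
      ∀ l, toMat g j l = 0 → toMat (u * g) i l = toMat g i l := by
  have hne : i ≠ j := by rintro rfl; exact lt_irrefl _ hij
  have hjj := hg.1 j j
  rw [Matrix.one_apply_eq] at hjj
  obtain ⟨hinv, h0⟩ := inv_mem_integer_of_sub_one_mem uniformizer_ne_zero h.lt_one
    (by rw [howeExp]; simpa using hm) hjj
  have hcm : -(toMat g i j / toMat g j j) ∈ fracIdeal 𝔭 (howeExp m i j) := by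
    have h1 := hg.1 i j
    rw [Matrix.one_apply_ne hne, sub_zero] at h1
    have := mul_mem_fracIdeal uniformizer_ne_zero h1 (mem_fracIdeal_zero.2 hinv)
    rw [add_zero] at this
    rw [div_eq_mul_inv]
    exact neg_mem this
  have hc' : j = i + 2 → σ (-(toMat g i j / toMat g j j)) = -(toMat g i j / toMat g j j) := by
    intro h1; rw [map_neg, hc h1]
  refine ⟨rootElt h.invol i j hne _ hc', ?_, rootElt_mem_howeSubgroup h hne _ hc' hcm, ?_, ?_, ?_⟩
  · rw [unipotent_eq]
    exact rootElt_mem_unitriangular _ _ _ _ hij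
  · rw [rootElt_mul_apply]
    field_simp
    ring
  · intro k l h1 h2
    exact rootElt_mul_apply_of_ne _ _ _ _ h1 h2 l
  · intro l hl
    rw [rootElt_mul_apply, hl, mul_zero, add_zero]

omit [ValuativeRel F] [ValuativeRel E] in
/-- The columns of a unitary matrix are orthogonal with respect to the form, except for the paired
ones. -/
theorem sum_adjoint_mul (g : U22 σ) (i j : Fin 4) (hij : i ≠ j) :
    ∑ k, ((formSign i * formSign k : ℤ) : E) * σ (toMat g (k + 2) (i + 2)) * toMat g k j = 0 := by
  have h1 : (toMat g⁻¹ * toMat g) i j = 0 := by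
    rw [← toMat_mul, inv_mul_cancel, toMat_one, Matrix.one_apply_ne hij]
  rw [Matrix.mul_apply] at h1
  simpa only [toMat_inv_apply] using h1

omit [ValuativeRel F] [ValuativeRel E] in
theorem conj_div_eq {x y : E} (h : σ y * x = σ x * y) : σ (x / y) = x / y := by
  by_cases hy : y = 0
  · simp [hy]
  · have : σ y ≠ 0 := by simpa using hy
    rw [map_div₀]
    field_simp
    linear_combination -h

/-- The lower triangular elements of `H_m` lie in `K_m`, since conjugation by `d_m` contracts their
entries. -/
theorem mem_congruence_of_lower (h : IsUnramifiedConj σ ϖ) {m : ℕ} {g : U22 σ}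
    (hg : g ∈ howeSubgroup h m) (hl : ∀ i j, wRank 1 i < wRank 1 j → toMat g i j = 0) :
    g ∈ congruenceSubgroup h m := by
  rw [mem_congruenceSubgroup, mem_congruence h]
  intro i j
  by_cases hij : wRank 1 i < wRank 1 j
  · rw [hl i j hij, Matrix.one_apply_ne (by rintro rfl; exact lt_irrefl _ hij), sub_self]
    exact zero_mem _
  · refine h.anti ?_ (hg.1 i j)
    have : 0 ≤ weight i - weight j := by
      revert hij; clear hg hl; revert i j; decide
    rw [howeExp, mul_add, mul_one]
    have := mul_nonneg (Int.natCast_nonneg m) this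
    omega

/-- The Iwahori factorization of the Howe group: the elements of `H_m` are products of elements of
`U_m` and of lower triangular elements, and the latter lie in `K_m`. -/
theorem iwahori_factorization (h : IsUnramifiedConj σ ϖ) {m : ℕ} (hm : 1 ≤ m) {g : U22 σ}
    (hg : g ∈ howeSubgroup h m) :
    ∃ u ∈ unipotent σ, u ∈ howeSubgroup h m ∧ u * g ∈ congruenceSubgroup h m := by
  -- Clear the column with index 2 above its diagonal entry, from the bottom of the flag
  -- `0, 1, 3, 2` to its top, and then the entry `(1, 3)`; the form takes care of the
  -- remaining entries.
  obtain ⟨u₁, hu₁, hm₁, e₁, f₁, -⟩ := exists_eliminate h hm hg (i := 3) (j := 2) (by decide)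
    (fun h => absurd h (by decide))
  have hg₁ := mul_mem hm₁ hg
  obtain ⟨u₂, hu₂, hm₂, e₂, f₂, -⟩ := exists_eliminate h hm hg₁ (i := 1) (j := 2) (by decide)
    (fun h => absurd h (by decide))
  have hg₂ := mul_mem hm₂ hg₁
  have e₂' : toMat (u₂ * (u₁ * g)) 3 2 = 0 := by rw [f₂ 3 2 (by decide) (by decide), e₁]
  -- The column is isotropic, and only its entries `0` and `2` are left, so that their quotient is
  -- fixed by `σ`.
  obtain ⟨u₃, hu₃, hm₃, e₃, f₃, -⟩ := exists_eliminate h hm hg₂ (i := 0) (j := 2) (by decide)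
    (fun _ => conj_div_eq (by
      have := sum_adjoint_mul (u₂ * (u₁ * g)) 0 2 (by decide)
      simp only [Fin.sum_univ_four, e₂, e₂'] at this
      simp [formSign] at this
      linear_combination this))
  have hg₃ := mul_mem hm₃ hg₂
  have e₃₁ : toMat (u₃ * (u₂ * (u₁ * g))) 1 2 = 0 := by rw [f₃ 1 2 (by decide) (by decide), e₂]
  have e₃₃ : toMat (u₃ * (u₂ * (u₁ * g))) 3 2 = 0 := by rw [f₃ 3 2 (by decide) (by decide), e₂']
  obtain ⟨x, hx⟩ : ∃ x, x = u₃ * (u₂ * (u₁ * g)) := ⟨_, rfl⟩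
  rw [← hx] at e₃ e₃₁ e₃₃ hg₃
  have hx22 : toMat x 2 2 ≠ 0 := by
    have h2 := hg₃.1 2 2
    rw [Matrix.one_apply_eq] at h2
    exact (inv_mem_integer_of_sub_one_mem uniformizer_ne_zero h.lt_one
      (by rw [howeExp]; simpa using hm) h2).2
  -- As the column with index 2 is a multiple of a basis vector, so is the row with index 0.
  have hrow : ∀ i : Fin 4, i ≠ 2 → toMat x 0 (i + 2) = 0 := by
    intro i hi
    have := sum_adjoint_mul x i 2 hi
    simp only [Fin.sum_univ_four, e₃, e₃₁, e₃₃, mul_zero, zero_add, add_zero] at this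
    have hs : ((formSign i * formSign 2 : ℤ) : E) ≠ 0 := by
      unfold formSign; split_ifs <;> simp
    exact (map_eq_zero σ).1 ((mul_eq_zero.1 ((mul_eq_zero.1 this).resolve_right hx22)).resolve_left
      hs)
  have e₃₀ : toMat x 0 1 = 0 := hrow 3 (by decide)
  have e₃₀' : toMat x 0 3 = 0 := hrow 1 (by decide)
  obtain ⟨u₄, hu₄, hm₄, e₄, f₄, f₄'⟩ := exists_eliminate h hm hg₃ (i := 1) (j := 3) (by decide)
    (fun _ => conj_div_eq (by
      have := sum_adjoint_mul x 1 3 (by decide)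
      simp only [Fin.sum_univ_four, e₃₀'] at this
      simp [formSign, e₃₀'] at this
      linear_combination this))
  have hg₄ := mul_mem hm₄ hg₃
  refine ⟨u₄ * u₃ * u₂ * u₁, mul_mem (mul_mem (mul_mem hu₄ hu₃) hu₂) hu₁,
    mul_mem (mul_mem (mul_mem hm₄ hm₃) hm₂) hm₁, ?_⟩
  have hprod : u₄ * u₃ * u₂ * u₁ * g = u₄ * x := by rw [hx]; group
  rw [hprod]
  refine mem_congruence_of_lower h hg₄ ?_
  have g01 : toMat (u₄ * x) 0 1 = 0 := by rw [f₄ 0 1 (by decide) (by decide), e₃₀]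
  have g02 : toMat (u₄ * x) 0 2 = 0 := by rw [f₄ 0 2 (by decide) (by decide), e₃]
  have g03 : toMat (u₄ * x) 0 3 = 0 := by rw [f₄ 0 3 (by decide) (by decide), e₃₀']
  have g12 : toMat (u₄ * x) 1 2 = 0 := by rw [f₄' 2 e₃₃, e₃₁]
  have g32 : toMat (u₄ * x) 3 2 = 0 := by rw [f₄ 3 2 (by decide) (by decide), e₃₃]
  intro i j hij
  fin_cases i <;> fin_cases j <;> first | assumption | exact absurd hij (by decide)

/-! ### The character of the Howe group -/

open Classical in
/-- An element of `F` congruent to `x` modulo `𝒪[E]`, if there is one. -/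
def basePart (F : Type*) {E : Type*} [Field F] [Field E] [ValuativeRel E] [Algebra F E]
    (x : E) : F :=
  if h : ∃ c : F, x - algebraMap F E c ∈ 𝒪[E] then h.choose else 0

omit [ValuativeRel F] in
theorem basePart_spec {x : E} (h : ∃ c : F, x - algebraMap F E c ∈ 𝒪[E]) :
    x - algebraMap F E (basePart F x) ∈ 𝒪[E] := by
  rw [basePart, dif_pos h]; exact h.choose_spec

/-- The extension of the generic character of `U_m` to the Howe group `H_m`. -/
def howeChar (ψ : AddChar F Circle) (ψE : AddChar E Circle) (g : U22 σ) : ℂ :=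
  (ψE (-(toMat g 0 1)) : ℂ) * (ψ (basePart F (toMat g 1 3)) : ℂ)

theorem addChar_eq_of_sub_mem {K : Type*} [Field K] [ValuativeRel K] {ψ : AddChar K Circle}
    (hψ : ∀ x ∈ 𝒪[K], ψ x = 1) {x y : K} (h : x - y ∈ 𝒪[K]) : ψ x = ψ y := by
  have h1 := hψ _ h
  rw [← sub_add_cancel x y, AddChar.map_add_eq_mul, h1, one_mul]

variable {ψ : AddChar F Circle} {ψE : AddChar E Circle}

theorem addChar_basePart (h : IsUnramifiedConj σ ϖ) (hψ : ∀ x ∈ 𝒪[F], ψ x = 1) {x : E} {c : F}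
    (hc : x - algebraMap F E c ∈ 𝒪[E]) : ψ (basePart F x) = ψ c := by
  have h1 := basePart_spec ⟨c, hc⟩
  refine addChar_eq_of_sub_mem hψ ?_
  rw [← h.base, map_sub]
  convert sub_mem hc h1 using 1
  ring

/-- In the places of the simple roots the entries of elements of `H_m` add up modulo `𝒪[E]`, on
which the characters are trivial. -/
theorem howeChar_mul (h : IsUnramifiedConj σ ϖ) (hψ : ∀ x ∈ 𝒪[F], ψ x = 1)
    (hψE : ∀ x ∈ 𝒪[E], ψE x = 1) {m : ℕ} {a b : U22 σ} (ha : a ∈ howeSubgroup h m)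
    (hb : b ∈ howeSubgroup h m) :
    howeChar ψ ψE (a * b) = howeChar ψ ψE a * howeChar ψ ψE b := by
  have key : ∀ i j : Fin 4, i ≠ j → howeExp m i j + m = 0 →
      toMat (a * b) i j - (toMat a i j + toMat b i j) ∈ 𝒪[E] := by
    intro i j hij h0
    have h1 := toMat_mul_sub a b i j
    have h2 := howe_cross_term a b ha.1 hb.1 i j
    rw [h0, mem_fracIdeal_zero] at h2
    rw [Matrix.one_apply_ne hij, sub_zero, sub_zero, sub_zero] at h1
    rw [h1, add_sub_cancel_left]
    exact h2
  have k01 := key 0 1 (by decide) (by simp [howeExp, weight])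
  have k13 := key 1 3 (by decide) (by simp [howeExp, weight])
  obtain ⟨c, hc⟩ := ha.2
  obtain ⟨d, hd⟩ := hb.2
  have h01 : ψE (-(toMat (a * b) 0 1)) = ψE (-(toMat a 0 1)) * ψE (-(toMat b 0 1)) := by
    rw [← AddChar.map_add_eq_mul]
    refine addChar_eq_of_sub_mem hψE ?_
    convert neg_mem k01 using 1
    ring
  have h13 : ψ (basePart F (toMat (a * b) 1 3)) =
      ψ (basePart F (toMat a 1 3)) * ψ (basePart F (toMat b 1 3)) := by
    rw [addChar_basePart h hψ hc, addChar_basePart h hψ hd, ← AddChar.map_add_eq_mul]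
    refine addChar_basePart h hψ ?_
    convert add_mem k13 (add_mem hc hd) using 1
    rw [map_add]; ring
  rw [howeChar, howeChar, howeChar, h01, h13]
  push_cast
  ring

omit [ValuativeRel F] in
theorem howeChar_ne_zero (g : U22 σ) : howeChar ψ ψE g ≠ 0 := by
  simp [howeChar]

theorem howeChar_eq_genericChar (h : IsUnramifiedConj σ ϖ) (hψ : ∀ x ∈ 𝒪[F], ψ x = 1) {u : U22 σ}
    (hu : u ∈ unipotent σ) : howeChar ψ ψE u = genericChar ψ ψE u := by
  rw [unipotent_eq] at hu
  obtain ⟨c, hc⟩ := h.fixed _ (conj_apply_adjacent (i := 1) hu (by decide))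
  change algebraMap F E c = toMat u 1 3 at hc
  rw [howeChar, genericChar, ← hc, toBase_algebraMap, addChar_basePart h hψ (c := c)]
  rw [sub_self]; exact zero_mem _

theorem howeChar_eq_one (h : IsUnramifiedConj σ ϖ) (hψ : ∀ x ∈ 𝒪[F], ψ x = 1)
    (hψE : ∀ x ∈ 𝒪[E], ψE x = 1) {C : ℕ} {g : U22 σ} (hg : g ∈ congruenceSubgroup h C) :
    howeChar ψ ψE g = 1 := by
  have key : ∀ i j : Fin 4, i ≠ j → toMat g i j ∈ 𝒪[E] := by
    intro i j hij
    have h1 := (mem_congruence h).1 hg i j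
    rw [Matrix.one_apply_ne hij, sub_zero] at h1
    exact mem_fracIdeal_zero.1 (h.anti (by omega) h1)
  rw [howeChar, hψE _ (neg_mem (key 0 1 (by decide))), addChar_basePart h hψ (c := 0),
    hψ 0 (zero_mem _)]
  · simp
  · rw [map_zero, sub_zero]; exact key 1 3 (by decide)

end HoweGroups

/-! ### Averages over cosets -/

section CosetSums

open scoped Pointwise

variable {G V : Type*} [Group G] {N A B : Subgroup G}

/-- The value of a right `N`-invariant function at the representative of a coset. -/
theorem coset_out_eq {X : Type*} {f : G → X} (hf : ∀ a ∈ A, ∀ n ∈ N, f (a * n) = f a) (a : A) :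
    f ((QuotientGroup.mk a : A ⧸ N.subgroupOf A).out : A) = f a := by
  obtain ⟨n, hn⟩ := QuotientGroup.mk_out_eq_mul (N.subgroupOf A) a
  rw [hn]
  exact hf a a.2 n (Subgroup.mem_subgroupOf.1 n.2)

variable [AddCommGroup V]

/-- The sum over `A ⧸ N` of a function on `G`, evaluated at the chosen representatives of the
cosets. It is independent of them if the function is right invariant under `N`. -/
def cosetSum (N A : Subgroup G) [Fintype (A ⧸ N.subgroupOf A)] (f : G → V) : V :=
  ∑ q : A ⧸ N.subgroupOf A, f (q.out : A)

/-- Translation of a coset sum by a map `τ` of `A` that is injective on cosets. -/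
theorem cosetSum_comp [Fintype (A ⧸ N.subgroupOf A)] {f : G → V}
    (hf : ∀ a ∈ A, ∀ n ∈ N, f (a * n) = f a)
    (τ : A → A) (hτ : ∀ a b : A, ((τ a)⁻¹ * τ b : G) ∈ N → (a⁻¹ * b : G) ∈ N) :
    cosetSum N A f = ∑ q : A ⧸ N.subgroupOf A, f (τ q.out) := by
  have hinj : Function.Injective fun q : A ⧸ N.subgroupOf A =>
      (QuotientGroup.mk (τ q.out) : A ⧸ N.subgroupOf A) := by
    intro q q' hq
    rw [QuotientGroup.eq, Subgroup.mem_subgroupOf] at hq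
    have := hτ _ _ hq
    rw [← q.out_eq, ← q'.out_eq]
    exact QuotientGroup.eq.2 (Subgroup.mem_subgroupOf.2 this)
  have hbij := Finite.injective_iff_bijective.1 hinj
  rw [cosetSum, ← hbij.sum_comp]
  exact Finset.sum_congr rfl fun q _ => coset_out_eq hf _

/-- For `q ∈ A ⧸ N`, the products `q b` with `b ∈ B ⧸ N` run through the cosets of `N` in
`q B`. -/
theorem sum_coset_mul {M : Type*} [AddCommMonoid M] [Fintype (A ⧸ N.subgroupOf A)]
    [Fintype (B ⧸ N.subgroupOf B)] (hNB : N ≤ B) (hBA : B ≤ A) [DecidablePred (· ∈ B)]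
    (F : A ⧸ N.subgroupOf A → M) (q : A ⧸ N.subgroupOf A) :
    ∑ s : B ⧸ N.subgroupOf B,
      F (QuotientGroup.mk (q.out * ⟨(s.out : B), hBA (s.out : B).2⟩)) =
    ∑ q' : A ⧸ N.subgroupOf A with ((q.out : A) : G)⁻¹ * (q'.out : A) ∈ B, F q' := by
  refine Finset.sum_bij (fun s _ => QuotientGroup.mk (q.out * ⟨(s.out : B), hBA (s.out : B).2⟩))
    ?_ ?_ ?_ ?_
  · intro s _
    rw [Finset.mem_filter_univ]
    obtain ⟨n, hn⟩ := QuotientGroup.mk_out_eq_mul (N.subgroupOf A)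
      (q.out * ⟨(s.out : B), hBA (s.out : B).2⟩)
    rw [hn]
    have : ((q.out : A) : G)⁻¹ * ((q.out * ⟨(s.out : B), hBA (s.out : B).2⟩ * n : A) : G) =
        (s.out : B) * (n : A) := by
      push_cast; group
    rw [this]
    exact mul_mem (s.out : B).2 (hNB (Subgroup.mem_subgroupOf.1 n.2))
  · intro s _ s' _ hs
    rw [QuotientGroup.eq, Subgroup.mem_subgroupOf] at hs
    rw [← s.out_eq, ← s'.out_eq]
    refine QuotientGroup.eq.2 (Subgroup.mem_subgroupOf.2 ?_)
    push_cast at hs ⊢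
    convert hs using 1
    group
  · intro q' hq'
    rw [Finset.mem_filter_univ] at hq'
    refine ⟨QuotientGroup.mk ⟨_, hq'⟩, Finset.mem_univ _, ?_⟩
    obtain ⟨n, hn⟩ := QuotientGroup.mk_out_eq_mul (N.subgroupOf B) ⟨_, hq'⟩
    refine Eq.trans ?_ q'.out_eq
    refine QuotientGroup.eq.2 (Subgroup.mem_subgroupOf.2 ?_)
    rw [hn]
    have hn' := inv_mem (Subgroup.mem_subgroupOf.1 n.2)
    convert hn' using 1
    push_cast
    group
  · intro s _; rfl

/-- For `N ≤ B ≤ A`, a sum over `A ⧸ N` is, up to the factor `[B : N]`, the double sum over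
`A ⧸ N` and `B ⧸ N`. -/
theorem cosetSum_double [Fintype (A ⧸ N.subgroupOf A)] [Fintype (B ⧸ N.subgroupOf B)] {f : G → V}
    (hf : ∀ a ∈ A, ∀ n ∈ N, f (a * n) = f a) (hNB : N ≤ B) (hBA : B ≤ A) :
    ∑ q : A ⧸ N.subgroupOf A, cosetSum N B (fun b => f ((q.out : A) * b)) =
      Fintype.card (B ⧸ N.subgroupOf B) • cosetSum N A f := by
  classical
  have h1 : ∀ q : A ⧸ N.subgroupOf A, cosetSum N B (fun b => f ((q.out : A) * b)) =
      ∑ q' : A ⧸ N.subgroupOf A with ((q.out : A) : G)⁻¹ * (q'.out : A) ∈ B, f (q'.out : A) := by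
    intro q
    rw [← sum_coset_mul hNB hBA (fun q' => f (q'.out : A)) q, cosetSum]
    exact Finset.sum_congr rfl fun s _ =>
      (coset_out_eq hf (q.out * ⟨(s.out : B), hBA (s.out : B).2⟩)).symm
  have h2 : ∀ q' : A ⧸ N.subgroupOf A, (Finset.univ.filter fun q : A ⧸ N.subgroupOf A =>
      ((q.out : A) : G)⁻¹ * (q'.out : A) ∈ B).card = Fintype.card (B ⧸ N.subgroupOf B) := by
    intro q'
    have h3 := sum_coset_mul hNB hBA (fun _ => 1) q'
    rw [Finset.sum_const, Finset.sum_const, smul_eq_mul, smul_eq_mul, mul_one, mul_one,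
      Finset.card_univ] at h3
    rw [h3]
    congr 1
    ext q
    rw [Finset.mem_filter_univ, Finset.mem_filter_univ, ← inv_mem_iff]
    simp [mul_inv_rev]
  simp_rw [h1, Finset.sum_filter]
  rw [Finset.sum_comm, cosetSum, Finset.smul_sum]
  refine Finset.sum_congr rfl fun q' _ => ?_
  rw [← Finset.sum_filter, Finset.sum_const, h2]

variable [Module ℂ V] [TopologicalSpace G] [IsTopologicalGroup G]
  [MeasurableSpace G] [BorelSpace G]

/-- The integral over `A` of a function that is constant on the cosets of an open subgroup `N` of
finite index is `vol N` times the sum over the cosets. -/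
theorem simpleIntegral_eq_cosetSum (μ : Measure G) [μ.IsMulLeftInvariant]
    [Fintype (A ⧸ N.subgroupOf A)] (hN : IsOpen (N : Set G)) (hNA : N ≤ A)
    (hμ : μ N ≠ ⊤) {f : G → V} (hf : ∀ a ∈ A, ∀ n ∈ N, f (a * n) = f a) :
    simpleIntegral μ A f = ((μ.real N : ℝ) : ℂ) • cosetSum N A f := by
  classical
  have hout : ∀ a : A, ∃ n ∈ N, ((QuotientGroup.mk a : A ⧸ N.subgroupOf A).out : G) = a * n := by
    intro a
    obtain ⟨n, hn⟩ := QuotientGroup.mk_out_eq_mul (N.subgroupOf A) a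
    exact ⟨n, Subgroup.mem_subgroupOf.1 n.2, by rw [hn]; rfl⟩
  have hset : ∀ x : V, (A : Set G) ∩ f ⁻¹' {x} =
      ⋃ q ∈ Finset.univ.filter fun q : A ⧸ N.subgroupOf A => f (q.out : A) = x,
        (((q.out : A) : G) • (N : Set G)) := by
    intro x
    ext g
    simp only [Set.mem_inter_iff, SetLike.mem_coe, Set.mem_preimage, Set.mem_singleton_iff,
      Finset.mem_filter_univ, Set.mem_iUnion, exists_prop]
    constructor
    · rintro ⟨hg, hx⟩
      obtain ⟨n, hn, h1⟩ := hout ⟨g, hg⟩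
      refine ⟨QuotientGroup.mk ⟨g, hg⟩, ?_, ?_⟩
      · rw [h1, hf g hg n hn, hx]
      · rw [h1, Set.mem_smul_set_iff_inv_smul_mem]
        simpa using hn
    · rintro ⟨q, hq, hg⟩
      rw [Set.mem_smul_set_iff_inv_smul_mem, smul_eq_mul, SetLike.mem_coe] at hg
      have : g = (q.out : A) * (((q.out : A) : G)⁻¹ * g) := by group
      rw [this]
      exact ⟨mul_mem (q.out : A).2 (hNA hg), by rw [hf _ (q.out : A).2 _ hg, hq]⟩
  have hmeas : ∀ x : V, μ.real ((A : Set G) ∩ f ⁻¹' {x}) =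
      (Finset.univ.filter fun q : A ⧸ N.subgroupOf A => f (q.out : A) = x).card * μ.real N := by
    intro x
    rw [hset, measureReal_biUnion_finset (h := fun q _ => by rw [measure_smul]; exact hμ)]
    · have : ∀ q : A ⧸ N.subgroupOf A, μ.real (((q.out : A) : G) • (N : Set G)) = μ.real N := by
        intro q; rw [measureReal_def, measure_smul, measureReal_def]
      simp [this]
    · intro q _ q' _ hqq
      refine Set.disjoint_left.2 fun g hg hg' => hqq ?_
      rw [Set.mem_smul_set_iff_inv_smul_mem, smul_eq_mul, SetLike.mem_coe] at hg hg'
      rw [← q.out_eq, ← q'.out_eq]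
      refine QuotientGroup.eq.2 (Subgroup.mem_subgroupOf.2 ?_)
      convert mul_mem hg (inv_mem hg') using 1
      push_cast
      group
    · intro q _
      exact (hN.smul _).measurableSet
  rw [simpleIntegral, finsum_eq_sum_of_support_subset (s := Finset.univ.image
    fun q : A ⧸ N.subgroupOf A => f (q.out : A)), cosetSum, Finset.smul_sum,
    ← Finset.sum_fiberwise_of_maps_to (t := Finset.univ.image
      fun q : A ⧸ N.subgroupOf A => f (q.out : A))
      (g := fun q : A ⧸ N.subgroupOf A => f (q.out : A))
      (fun q hq => Finset.mem_image_of_mem _ hq)]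
  · refine Finset.sum_congr rfl fun x _ => ?_
    rw [Finset.sum_congr rfl (g := fun _ => ((μ.real N : ℝ) : ℂ) • x), Finset.sum_const, hmeas]
    · push_cast
      rw [mul_smul, Nat.cast_smul_eq_nsmul]
    · intro q hq
      rw [(Finset.mem_filter.1 hq).2]
  · intro x hx
    by_contra hcon
    apply hx
    change ((μ.real _ : ℝ) : ℂ) • x = 0
    rw [hmeas, Finset.filter_eq_empty_iff.2, Finset.card_empty]
    · simp
    · intro q _ hq
      exact hcon (by rw [← hq]; simp)

theorem measureReal_eq_card_mul (μ : Measure G) [μ.IsMulLeftInvariant]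
    [Fintype (A ⧸ N.subgroupOf A)] (hN : IsOpen (N : Set G)) (hNA : N ≤ A)
    (hμ : μ N ≠ ⊤) : μ.real A = Fintype.card (A ⧸ N.subgroupOf A) * μ.real N := by
  have h1 := simpleIntegral_eq_cosetSum (V := ℂ) μ hN hNA hμ (f := fun _ => 1)
    (fun _ _ _ _ => rfl)
  rw [simpleIntegral, finsum_eq_single _ (1 : ℂ), cosetSum, Finset.sum_const,
    Finset.card_univ] at h1
  · have h2 : (A : Set G) ∩ (fun _ => (1 : ℂ)) ⁻¹' {1} = A := by ext; simp
    rw [h2] at h1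
    have h3 : ((μ.real A : ℝ) : ℂ) = ((Fintype.card (A ⧸ N.subgroupOf A) * μ.real N : ℝ) : ℂ) := by
      push_cast
      simpa [mul_comm] using h1
    exact_mod_cast h3
  · intro x hx
    have h2 : (A : Set G) ∩ (fun _ => (1 : ℂ)) ⁻¹' {x} = ∅ := by
      ext; simp [hx.symm]
    rw [h2]; simp

end CosetSums

/-! ### Topology of the group and Howe vectors -/

section TopologicalGroup

variable {F E : Type*} [Field F] [Field E] [Algebra F E] {σ : E ≃ₐ[F] E}
  [TopologicalSpace E]

theorem continuous_toMat : Continuous (toMat : U22 σ → Matrix (Fin 4) (Fin 4) E) :=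
  Units.continuous_val.comp continuous_subtype_val

theorem isClosed_unipotent [T2Space E] : IsClosed (unipotent σ : Set (U22 σ)) := by
  have : (unipotent σ : Set (U22 σ)) = {g | (∀ i j, wRank 1 j < wRank 1 i → toMat g i j = 0) ∧
      ∀ i, toMat g i i = 1} := by
    ext g
    rw [SetLike.mem_coe, unipotent_eq, mem_unitriangular]; rfl
  rw [this]
  have hc : ∀ i j, Continuous fun g : U22 σ => toMat g i j := fun i j =>
    continuous_toMat.matrix_elem i j
  refine IsClosed.and ?_ ?_
  · simp only [Set.ofPred_forall]
    exact isClosed_iInter fun i => isClosed_iInter fun j => isClosed_iInter fun _ =>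
      isClosed_eq (hc i j) continuous_const
  · simp only [Set.ofPred_forall]
    exact isClosed_iInter fun i => isClosed_eq (hc i i) continuous_const

variable [IsTopologicalRing E]

theorem continuous_formAdjoint (hσ : Continuous σ) : Continuous (formAdjoint σ) := by
  refine continuous_pi fun i => continuous_pi fun j => ?_
  exact continuous_const.mul (hσ.comp (continuous_id.matrix_elem _ _))

/-- As the inverse of a unitary matrix is its adjoint, `U(2,2)` is a closed subspace of the space of
matrices. -/
theorem isClosedEmbedding_toMat [T2Space E] (hσ : Continuous σ) :
    Topology.IsClosedEmbedding (toMat : U22 σ → Matrix (Fin 4) (Fin 4) E) := by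
  have hcomp : (fun A : Matrix (Fin 4) (Fin 4) E => (A, MulOpposite.op (formAdjoint σ A))) ∘
      (toMat : U22 σ → _) = Units.embedProduct _ ∘ (Subtype.val : U22 σ → GL (Fin 4) E) := by
    ext1 g
    simp only [Function.comp, Units.embedProduct_apply, ← toMat_inv]
    rfl
  refine ⟨⟨Topology.IsInducing.of_comp continuous_toMat
    (continuous_id.prodMk (MulOpposite.continuous_op.comp (continuous_formAdjoint hσ))) ?_,
    toMat_injective⟩, ?_⟩
  · have hind := Units.isInducing_embedProduct.comp
      (Topology.IsInducing.subtypeVal (t := fun g : GL (Fin 4) E => g ∈ U22 σ))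
    exact hcomp ▸ hind
  · have : Set.range (toMat : U22 σ → _) =
        {A : Matrix (Fin 4) (Fin 4) E | A * formAdjoint σ A = 1} := by
      ext A
      constructor
      · rintro ⟨g, rfl⟩
        exact (unitary_iff _).1 g.2
      · intro h
        exact ⟨ofMulAdjoint A h, rfl⟩
    rw [this]
    exact isClosed_eq (continuous_id.mul (continuous_formAdjoint hσ)) continuous_const

end TopologicalGroup

section Levels

variable {F E : Type*} [Field F] [ValuativeRel F] [Field E] [ValuativeRel E]
  [TopologicalSpace E] [IsNonarchimedeanLocalField E] [Algebra F E]
  {σ : E ≃ₐ[F] E} {ϖ : Fˣ}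

theorem isCompact_fracIdeal {p : E} (hp : p ≠ 0) (n : ℤ) : IsCompact (fracIdeal p n : Set E) := by
  have h : (fracIdeal p n : Set E) = (fun x => p ^ n * x) '' (𝒪[E] : Set E) := by
    ext x
    constructor
    · intro hx
      refine ⟨p ^ (-n) * x, hx, ?_⟩
      simp only
      rw [← mul_assoc, ← zpow_add₀ hp]; simp
    · rintro ⟨y, hy, rfl⟩
      rw [SetLike.mem_coe, mem_fracIdeal, ← mul_assoc, ← zpow_add₀ hp]
      simpa using hy
  rw [h]
  exact (isCompact_iff_compactSpace.2 (inferInstanceAs (CompactSpace 𝒪[E]))).image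
    (continuous_const.mul continuous_id)

theorem isOpen_fracIdeal (p : E) (n : ℤ) : IsOpen (fracIdeal p n : Set E) := by
  have h : (fracIdeal p n : Set E) = (fun x => p ^ (-n) * x) ⁻¹' (𝒪[E] : Set E) := rfl
  rw [h]
  exact IsOpen.preimage (continuous_const.mul continuous_id) Valuation.isOpen_integer

/-- The group `U_m`, as a subgroup of `U`. -/
def unipotentLevelSubgroup (h : IsUnramifiedConj σ ϖ) (m : ℕ) : Subgroup (unipotent σ) :=
  (howeSubgroup h m).subgroupOf (unipotent σ)

omit [TopologicalSpace E] [IsNonarchimedeanLocalField E] in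
theorem coe_unipotentLevelSubgroup (h : IsUnramifiedConj σ ϖ) (m : ℕ) :
    (unipotentLevelSubgroup h m : Set (unipotent σ)) = unipotentLevel σ ϖ m := by
  ext u
  exact ⟨fun hu => howeSubgroup_le h hu, fun hu => unipotent_inf_howeGroup_le h u.2 hu⟩

/-- The group `U ∩ K_C`, as a subgroup of `U`. -/
def unipotentCongruence (h : IsUnramifiedConj σ ϖ) (C : ℕ) : Subgroup (unipotent σ) :=
  (congruenceSubgroup h C).subgroupOf (unipotent σ)

omit [TopologicalSpace E] [IsNonarchimedeanLocalField E] in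
theorem unipotentCongruence_le (h : IsUnramifiedConj σ ϖ) (C m : ℕ) :
    unipotentCongruence h C ≤ unipotentLevelSubgroup h m :=
  fun u hu => unipotent_inf_congruence_le h m u.2 hu

theorem isOpen_unipotentCongruence (h : IsUnramifiedConj σ ϖ) (C : ℕ) :
    IsOpen (unipotentCongruence h C : Set (unipotent σ)) := by
  have : (unipotentCongruence h C : Set (unipotent σ)) = {u : unipotent σ | ∀ i j,
      toMat (u : U22 σ) i j - (1 : Matrix (Fin 4) (Fin 4) E) i j ∈
        fracIdeal (algebraMap F E (ϖ : F)) C} := by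
    ext u
    exact mem_congruence h
  rw [this]
  simp only [Set.ofPred_forall]
  refine isOpen_iInter_of_finite fun i => isOpen_iInter_of_finite fun j => ?_
  refine (isOpen_fracIdeal (algebraMap F E (ϖ : F)) C).preimage
    (f := fun u : unipotent σ => toMat (u : U22 σ) i j - (1 : Matrix (Fin 4) (Fin 4) E) i j) ?_
  exact ((continuous_toMat.comp continuous_subtype_val).matrix_elem i j).sub continuous_const

theorem isCompact_unipotentLevelSubgroup [T2Space E] (h : IsUnramifiedConj σ ϖ)
    (hσ : Continuous σ) (m : ℕ) :
    IsCompact (unipotentLevelSubgroup h m : Set (unipotent σ)) := by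
  let K : Fin 4 → Fin 4 → Set E := fun i j => {x | x - (1 : Matrix (Fin 4) (Fin 4) E) i j ∈
    fracIdeal (algebraMap F E (ϖ : F)) (howeExp m i j)}
  have hK : ∀ i j, IsCompact (K i j) := by
    intro i j
    convert (isCompact_fracIdeal (uniformizer_ne_zero (E := E) (ϖ := ϖ)) (howeExp m i j)).image
      (continuous_id.add (continuous_const (y := (1 : Matrix (Fin 4) (Fin 4) E) i j))) using 1
    ext x
    constructor
    · intro hx; exact ⟨_, hx, by simp⟩
    · rintro ⟨y, hy, rfl⟩
      simpa [K] using hy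
  have hbox : IsCompact (Set.univ.pi fun i => Set.univ.pi (K i)) :=
    isCompact_univ_pi fun i => isCompact_univ_pi (hK i)
  have hcl : Topology.IsClosedEmbedding fun u : unipotent σ => toMat (u : U22 σ) :=
    (isClosedEmbedding_toMat hσ).comp isClosed_unipotent.isClosedEmbedding_subtypeVal
  convert hcl.isCompact_preimage hbox using 1
  ext u
  rw [coe_unipotentLevelSubgroup]
  change _ ∈ howeGroup σ ϖ m ↔ _
  rw [mem_howeGroup h]
  exact ⟨fun H i _ j _ => H i j, fun H i j => H i trivial j trivial⟩

theorem finite_unipotentLevel_quotient [T2Space E] (h : IsUnramifiedConj σ ϖ)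
    (hσ : Continuous σ) (C m : ℕ) :
    Finite (unipotentLevelSubgroup h m ⧸
      (unipotentCongruence h C).subgroupOf (unipotentLevelSubgroup h m)) := by
  have : CompactSpace (unipotentLevelSubgroup h m) :=
    isCompact_iff_compactSpace.1 (isCompact_unipotentLevelSubgroup h hσ m)
  exact Subgroup.quotient_finite_of_isOpen _
    ((isOpen_unipotentCongruence h C).preimage continuous_subtype_val)

/-! ### Howe vectors -/

variable {ψ : AddChar F Circle} {ψE : AddChar E Circle} {V : Type*} [AddCommGroup V] [Module ℂ V]
  {π : Representation ℂ (U22 σ) V} {v : V}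

/-- The integrand `χ(g)⁻¹ π(g) v` of the Howe vector, with the character `χ` of the Howe group. -/
def howeIntegrand (ψ : AddChar F Circle) (ψE : AddChar E Circle)
    (π : Representation ℂ (U22 σ) V) (v : V) (g : U22 σ) : V :=
  (howeChar ψ ψE g)⁻¹ • π g v

omit [TopologicalSpace E] [IsNonarchimedeanLocalField E] in
theorem howeIntegrand_mul (h : IsUnramifiedConj σ ϖ) (hψ : ∀ x ∈ 𝒪[F], ψ x = 1)
    (hψE : ∀ x ∈ 𝒪[E], ψE x = 1) {m C : ℕ} (hv : ∀ k ∈ congruence σ C, π k v = v) {a b : U22 σ}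
    (ha : a ∈ howeSubgroup h m) (hb : b ∈ howeSubgroup h m) (hbC : b ∈ congruenceSubgroup h C) :
    howeIntegrand ψ ψE π v (a * b) = howeIntegrand ψ ψE π v a := by
  rw [howeIntegrand, howeIntegrand, howeChar_mul h hψ hψE ha hb, howeChar_eq_one h hψ hψE hbC,
    mul_one, map_mul, Module.End.mul_apply, hv b hbC]

omit [TopologicalSpace E] [IsNonarchimedeanLocalField E] in
theorem map_howeIntegrand (h : IsUnramifiedConj σ ϖ) (hψ : ∀ x ∈ 𝒪[F], ψ x = 1)
    (hψE : ∀ x ∈ 𝒪[E], ψE x = 1) {m : ℕ} {g a : U22 σ}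
    (hg : g ∈ howeSubgroup h m) (ha : a ∈ howeSubgroup h m) :
    π g (howeIntegrand ψ ψE π v a) = howeChar ψ ψE g • howeIntegrand ψ ψE π v (g * a) := by
  have h0 := howeChar_ne_zero (ψ := ψ) (ψE := ψE) g
  rw [howeIntegrand, howeIntegrand, howeChar_mul h hψ hψE hg ha, map_smul, map_mul,
    Module.End.mul_apply, smul_smul]
  congr 1
  field_simp

variable [MeasurableSpace (unipotent σ)] [BorelSpace (unipotent σ)] (μ : Measure (unipotent σ))
  [μ.IsHaarMeasure]

/-- The Howe vector is an average over the finite set `U_m / (U ∩ K_C)`. -/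
theorem howeVector_eq [T2Space E] (h : IsUnramifiedConj σ ϖ) (hσ : Continuous σ)
    (hψ : ∀ x ∈ 𝒪[F], ψ x = 1)
    (hψE : ∀ x ∈ 𝒪[E], ψE x = 1) {m C : ℕ} (hv : ∀ k ∈ congruence σ C, π k v = v)
    [Fintype (unipotentLevelSubgroup h m ⧸
      (unipotentCongruence h C).subgroupOf (unipotentLevelSubgroup h m))] :
    howeVector μ ϖ ψ ψE π v m = (Fintype.card (unipotentLevelSubgroup h m ⧸
      (unipotentCongruence h C).subgroupOf (unipotentLevelSubgroup h m)) : ℂ)⁻¹ •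
      cosetSum (unipotentCongruence h C) (unipotentLevelSubgroup h m)
        (fun u => howeIntegrand ψ ψE π v (u : U22 σ)) := by
  have hN := isOpen_unipotentCongruence h C
  have hle := unipotentCongruence_le h C m
  have hfin : μ (unipotentCongruence h C) ≠ ⊤ :=
    ((measure_mono hle).trans_lt (isCompact_unipotentLevelSubgroup h hσ m).measure_lt_top).ne
  have hpos : μ.real (unipotentCongruence h C) ≠ 0 := by
    rw [measureReal_def, ENNReal.toReal_ne_zero]
    exact ⟨(hN.measure_pos μ ⟨1, one_mem _⟩).ne', hfin⟩
  have hfun : (fun u : unipotent σ => (genericChar ψ ψE (u : U22 σ))⁻¹ • π (u : U22 σ) v) =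
      fun u : unipotent σ => howeIntegrand ψ ψE π v (u : U22 σ) := by
    ext u
    rw [howeIntegrand, howeChar_eq_genericChar h hψ u.2]
  rw [howeVector, hfun, ← coe_unipotentLevelSubgroup h,
    simpleIntegral_eq_cosetSum μ hN hle hfin, measureReal_eq_card_mul μ hN hle hfin, smul_smul]
  · congr 1
    push_cast
    have : ((μ.real (unipotentCongruence h C) : ℝ) : ℂ) ≠ 0 := by exact_mod_cast hpos
    rw [mul_inv, mul_assoc, inv_mul_cancel₀ this, mul_one]
  · intro a ha n hn
    exact howeIntegrand_mul h hψ hψE hv ha (hle hn) hn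

/-- The Howe group acts on the Howe vector by its character. -/
theorem map_howeVector [T2Space E] (h : IsUnramifiedConj σ ϖ) (hσ : Continuous σ)
    (hψ : ∀ x ∈ 𝒪[F], ψ x = 1)
    (hψE : ∀ x ∈ 𝒪[E], ψE x = 1) {m C : ℕ} (hC : 1 ≤ C) (hCm : C ≤ m)
    (hv : ∀ k ∈ congruence σ C, π k v = v) {g : U22 σ} (hg : g ∈ howeSubgroup h m) :
    π g (howeVector μ ϖ ψ ψE π v m) = howeChar ψ ψE g • howeVector μ ϖ ψ ψE π v m := by
  have := finite_unipotentLevel_quotient h hσ C m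
  have := Fintype.ofFinite (unipotentLevelSubgroup h m ⧸
    (unipotentCongruence h C).subgroupOf (unipotentLevelSubgroup h m))
  have hle := unipotentCongruence_le h C m
  -- By the Iwahori factorization, left multiplication by `g` permutes the cosets.
  have key : ∀ a : unipotentLevelSubgroup h m, ∃ b : unipotentLevelSubgroup h m,
      ((b : unipotent σ) : U22 σ)⁻¹ * (g * ((a : unipotent σ) : U22 σ)) ∈
        congruenceSubgroup h C := by
    intro a
    obtain ⟨u, hu, hum, huC⟩ := iwahori_factorization h (hC.trans hCm) (mul_mem hg a.2)
    refine ⟨⟨⟨u⁻¹, inv_mem hu⟩, ?_⟩, ?_⟩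
    · exact inv_mem hum
    · simp only [inv_inv]
      rw [mem_congruenceSubgroup, mem_congruence h] at huC ⊢
      exact fun i j => h.anti (by exact_mod_cast hCm) (huC i j)
  choose τ hτ using key
  have hmul : ∀ a ∈ unipotentLevelSubgroup h m, ∀ n ∈ unipotentCongruence h C,
      howeIntegrand ψ ψE π v ((a * n : unipotent σ) : U22 σ) =
        howeIntegrand ψ ψE π v (a : U22 σ) :=
    fun a ha n hn => howeIntegrand_mul h hψ hψE hv ha (hle hn) hn
  have hperm := cosetSum_comp (f := fun u : unipotent σ => howeIntegrand ψ ψE π v (u : U22 σ))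
    hmul τ (by
      intro a b hab
      have h1 := mul_mem (mul_mem (inv_mem (hτ a)) (Subgroup.mem_subgroupOf.1 hab)) (hτ b)
      rw [unipotentCongruence, Subgroup.mem_subgroupOf]
      convert h1 using 1
      simp only [Subgroup.coe_mul, Subgroup.coe_inv]
      group)
  rw [howeVector_eq μ h hσ hψ hψE hv, map_smul, smul_comm]
  congr 1
  conv_rhs => rw [hperm]
  rw [cosetSum, map_sum, Finset.smul_sum]
  refine Finset.sum_congr rfl fun q _ => ?_
  have hq : ((q.out : unipotentLevelSubgroup h m) : U22 σ) ∈ howeSubgroup h m := q.out.2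
  rw [map_howeIntegrand h hψ hψE hg hq]
  congr 1
  have hτq : ((τ q.out : unipotentLevelSubgroup h m) : U22 σ) ∈ howeSubgroup h m := (τ q.out).2
  have h1 := howeIntegrand_mul (ψ := ψ) (ψE := ψE) h hψ hψE hv hτq
    (mul_mem (inv_mem hτq) (mul_mem hg hq)) (hτ q.out)
  rw [← h1, mul_inv_cancel_left]

/-- For `k ≤ m`, the Howe vector at level `m` is an average of translates by `U_m` of the Howe
vector at level `k`. -/
theorem howeVector_eq_average [T2Space E] (h : IsUnramifiedConj σ ϖ) (hσ : Continuous σ)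
    (hψ : ∀ x ∈ 𝒪[F], ψ x = 1)
    (hψE : ∀ x ∈ 𝒪[E], ψE x = 1) {k m C : ℕ} (hkm : k ≤ m)
    (hv : ∀ k ∈ congruence σ C, π k v = v)
    [Fintype (unipotentLevelSubgroup h m ⧸
      (unipotentCongruence h C).subgroupOf (unipotentLevelSubgroup h m))] :
    howeVector μ ϖ ψ ψE π v m = (Fintype.card (unipotentLevelSubgroup h m ⧸
      (unipotentCongruence h C).subgroupOf (unipotentLevelSubgroup h m)) : ℂ)⁻¹ •
      cosetSum (unipotentCongruence h C) (unipotentLevelSubgroup h m)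
        (fun u => howeIntegrand ψ ψE π (howeVector μ ϖ ψ ψE π v k) (u : U22 σ)) := by
  have := finite_unipotentLevel_quotient h hσ C k
  have := Fintype.ofFinite (unipotentLevelSubgroup h k ⧸
    (unipotentCongruence h C).subgroupOf (unipotentLevelSubgroup h k))
  have hle := unipotentCongruence_le h C m
  have hmul : ∀ a ∈ unipotentLevelSubgroup h m, ∀ n ∈ unipotentCongruence h C,
      howeIntegrand ψ ψE π v ((a * n : unipotent σ) : U22 σ) =
        howeIntegrand ψ ψE π v (a : U22 σ) :=
    fun a ha n hn => howeIntegrand_mul h hψ hψE hv ha (hle hn) hn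
  have hBA : unipotentLevelSubgroup h k ≤ unipotentLevelSubgroup h m :=
    fun u hu => unipotent_inf_howeSubgroup_mono h hkm u.2 hu
  have hdouble := cosetSum_double
    (f := fun u : unipotent σ => howeIntegrand ψ ψE π v (u : U22 σ)) hmul
    (unipotentCongruence_le h C k) hBA
  have hterm : ∀ a ∈ unipotentLevelSubgroup h m,
      howeIntegrand ψ ψE π (howeVector μ ϖ ψ ψE π v k) (a : U22 σ) =
      (Fintype.card (unipotentLevelSubgroup h k ⧸
        (unipotentCongruence h C).subgroupOf (unipotentLevelSubgroup h k)) : ℂ)⁻¹ •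
      cosetSum (unipotentCongruence h C) (unipotentLevelSubgroup h k)
        (fun b => howeIntegrand ψ ψE π v ((a * b : unipotent σ) : U22 σ)) := by
    intro a ha
    rw [howeIntegrand, howeVector_eq μ h hσ hψ hψE hv, map_smul, smul_comm]
    congr 1
    rw [cosetSum, cosetSum, map_sum, Finset.smul_sum]
    refine Finset.sum_congr rfl fun q _ => ?_
    have ha' : (a : U22 σ) ∈ howeSubgroup h m := ha
    have hq : ((q.out : unipotentLevelSubgroup h k) : U22 σ) ∈ howeSubgroup h m := hBA q.out.2
    rw [map_howeIntegrand h hψ hψE ha' hq, smul_smul,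
      inv_mul_cancel₀ (howeChar_ne_zero _), one_smul]
    rfl
  have hcard : (Fintype.card (unipotentLevelSubgroup h k ⧸
        (unipotentCongruence h C).subgroupOf (unipotentLevelSubgroup h k)) : ℂ) ≠ 0 := by
    exact_mod_cast Fintype.card_ne_zero
  rw [howeVector_eq μ h hσ hψ hψE hv]
  congr 1
  conv_rhs =>
    rw [cosetSum, Finset.sum_congr rfl fun q _ => hterm _ (q.out : unipotentLevelSubgroup h m).2]
  rw [← Finset.smul_sum, hdouble, ← Nat.cast_smul_eq_nsmul ℂ, smul_smul, inv_mul_cancel₀ hcard,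
    one_smul]

end Levels

/-! ### Combinatorics of reduced words -/

section Words

/-- The row of the simple root `s`: its root elements have their free entry in this row. -/
def simpleRow : SimpleRoot → Fin 4
  | .α => 0
  | .β => 1

/-- The column of the simple root `s`. -/
def simpleCol : SimpleRoot → Fin 4
  | .α => 1
  | .β => 3

/-- The row of the root obtained from the simple root `s` by the inverse of `w`. -/
def rootRow (w : WeylGroup) (s : SimpleRoot) : Fin 4 := (w : Equiv.Perm (Fin 4)).symm (simpleRow s)

/-- The column of the root obtained from the simple root `s` by the inverse of `w`. -/
def rootCol (w : WeylGroup) (s : SimpleRoot) : Fin 4 := (w : Equiv.Perm (Fin 4)).symm (simpleCol s)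

theorem apply_rootRow (w : WeylGroup) (s : SimpleRoot) :
    (w : Equiv.Perm (Fin 4)) (rootRow w s) = simpleRow s := by simp [rootRow]

theorem apply_rootCol (w : WeylGroup) (s : SimpleRoot) :
    (w : Equiv.Perm (Fin 4)) (rootCol w s) = simpleCol s := by simp [rootCol]

theorem rank_adjacent (w : WeylGroup) (s : SimpleRoot) :
    (wRank w (rootRow w s) : ℕ) + 1 = wRank w (rootCol w s) := by
  rw [wRank, wRank, apply_rootRow, apply_rootCol]
  cases s <;> decide

theorem rank_lt (w : WeylGroup) (s : SimpleRoot) :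
    wRank w (rootRow w s) < wRank w (rootCol w s) := by
  have := rank_adjacent w s
  rw [Fin.lt_def]; omega

theorem rootRow_ne_rootCol (w : WeylGroup) (s : SimpleRoot) : rootRow w s ≠ rootCol w s := by
  intro h
  have := rank_lt w s
  rw [h] at this
  exact lt_irrefl _ this

/-- The form of `reduced_split` in which it is decided by a finite computation: `s` is the letter of
`ω` with index `n`. -/
theorem reducedWords_pos : ∀ ω ∈ reducedWords, ∀ n : Fin 4, ∀ s ∈ (ω.drop n).head?,
    wRank 1 (rootRow (wordProd (ω.drop (n + 1))) s) <
      wRank 1 (rootCol (wordProd (ω.drop (n + 1))) s) ∧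
    wRank (wordProd ω) (rootCol (wordProd (ω.drop (n + 1))) s) <
      wRank (wordProd ω) (rootRow (wordProd (ω.drop (n + 1))) s) := by
  decide

theorem length_le_of_mem_reducedWords : ∀ ω ∈ reducedWords, ω.length ≤ 4 := by decide

/-- The roots `γ` obtained from the letters of a reduced word of `w` are the positive roots with
`w(γ) < 0`. -/
theorem reduced_split {ω ω₁ ω₂ : List SimpleRoot} {s : SimpleRoot} (hω : ω ∈ reducedWords)
    (h : ω = ω₁ ++ s :: ω₂) :
    wRank 1 (rootRow (wordProd ω₂) s) < wRank 1 (rootCol (wordProd ω₂) s) ∧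
    wRank (wordProd ω) (rootCol (wordProd ω₂) s) <
      wRank (wordProd ω) (rootRow (wordProd ω₂) s) := by
  have hlen := length_le_of_mem_reducedWords ω hω
  have hlt : ω₁.length < 4 := by rw [h] at hlen; simp at hlen; omega
  have := reducedWords_pos ω hω ⟨ω₁.length, hlt⟩ s (by rw [h]; simp)
  have h2 : ω.drop (ω₁.length + 1) = ω₂ := by
    rw [h, ← List.drop_drop]; simp
  simpa only [h2] using this

/-- A simple reflection permutes the positive roots other than its own. -/
theorem flagRank_simple_lt : ∀ (s : SimpleRoot) (k l : Fin 4), flagRank k < flagRank l →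
    ¬(k = simpleRow s ∧ l = simpleCol s) → ¬(k = simpleCol s + 2 ∧ l = simpleRow s + 2) →
    wRank (simpleReflection s) k < wRank (simpleReflection s) l := by
  intro s; cases s <;> decide

theorem simpleReflection_row (s : SimpleRoot) :
    (simpleReflection s : Equiv.Perm (Fin 4)) (simpleRow s) = simpleCol s := by
  cases s <;> decide

theorem simpleReflection_col (s : SimpleRoot) :
    (simpleReflection s : Equiv.Perm (Fin 4)) (simpleCol s) = simpleRow s := by
  cases s <;> decide

theorem flagRank_simple_le : ∀ (s : SimpleRoot) (k : Fin 4), k ≠ simpleRow s →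
    k ≠ simpleCol s + 2 → wRank (simpleReflection s) k ≤ flagRank k := by
  intro s; cases s <;> decide

theorem simpleReflection_mul_self (s : SimpleRoot) :
    simpleReflection s * simpleReflection s = 1 := by
  cases s <;> decide

/-- A subword of a reduced word has a reduced subword with the same product. -/
theorem exists_reduced_sublist : ∀ ω ∈ reducedWords, ∀ ω' ∈ ω.sublists, ∃ ω'' ∈ reducedWords,
    ω''.Sublist ω' ∧ wordProd ω'' = wordProd ω' := by
  decide +kernel

theorem isReducedWord_of_mem {ω : List SimpleRoot} (hω : ω ∈ reducedWords) : IsReducedWord ω := by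
  obtain ⟨ω₀, h₀, h₁⟩ := exists_isReducedWord (wordProd ω)
  have h₂ := mem_reducedWords h₀
  have key : ∀ ω ∈ reducedWords, ∀ ω' ∈ reducedWords, wordProd ω' = wordProd ω →
      ω.length ≤ ω'.length := by decide +kernel
  intro ω' h'
  exact (key ω hω ω₀ h₂ h₁).trans (h₀ ω' (h'.trans h₁.symm))

theorem weylLength_eq {ω : List SimpleRoot} (hω : IsReducedWord ω) :
    weylLength (wordProd ω) = ω.length := by
  apply le_antisymm
  · exact Nat.sInf_le ⟨ω, rfl, rfl⟩
  · refine le_csInf ⟨_, ω, rfl, rfl⟩ ?_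
    rintro n ⟨ω', h1, rfl⟩
    exact hω ω' h1

end Words

/-! ### Rank one and the Bruhat decomposition -/

section RankOne

variable {F E : Type*} [Field F] [Field E] [Algebra F E] {σ : E ≃ₐ[F] E}

/-- The two places of a root element play symmetric roles. -/
theorem rootNil_symm (hσ : ∀ x, σ (σ x) = x) {i j : Fin 4} {c : E} (hc : j = i + 2 → σ c = c) :
    rootNil σ (j + 2) (i + 2) (-(((formSign i * formSign j : ℤ) : E) * σ c)) =
      rootNil σ i j c := by
  have hs : ((formSign i * formSign j : ℤ) : E) * ((formSign i * formSign j : ℤ) : E) = 1 := by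
    rw [← Int.cast_mul, mul_mul_mul_comm, formSign_mul_self, formSign_mul_self]; simp
  ext k l
  simp only [rootNil, Matrix.of_apply, add_two_add_two]
  by_cases h1 : k = i ∧ l = j
  · obtain ⟨rfl, rfl⟩ := h1
    rw [if_pos (⟨rfl, rfl⟩ : k = k ∧ l = l), if_pos (⟨rfl, rfl⟩ : k = k ∧ l = l)]
    split_ifs with h2
    · obtain ⟨h2, h3⟩ := h2
      rw [hc h3, h3, formSign_add_two, mul_neg, formSign_mul_self]
      simp
    · rw [formSign_add_two, formSign_add_two, neg_mul_neg, mul_comm (formSign l), map_neg, map_mul,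
        map_intCast, hσ, mul_neg, neg_neg, ← mul_assoc, hs, one_mul]
  · rw [if_neg h1, if_neg h1]

/-- The product of a root element with entry `c ≠ 0` and the opposite root element with entry
`-c⁻¹`. In rank one this is the matrix with rows `(0, c)` and `(-c⁻¹, 1)`. -/
def rankOneElt (hσ : ∀ x, σ (σ x) = x) (i j : Fin 4) (hij : i ≠ j) (c : E)
    (hc : j = i + 2 → σ c = c) : U22 σ :=
  rootElt hσ i j hij c hc * rootElt hσ j i hij.symm (-c⁻¹) (fun h => by
    rw [map_neg, map_inv₀, hc (add_two_eq_iff.1 h.symm)])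

theorem rankOneElt_apply_row (hσ : ∀ x, σ (σ x) = x) {i j : Fin 4} (hij : i ≠ j) {c : E}
    (hc : j = i + 2 → σ c = c) (h0 : c ≠ 0) {l : Fin 4} (hl : l ≠ j) :
    toMat (rankOneElt hσ i j hij c hc) i l = 0 := by
  rw [rankOneElt, rootElt_mul_apply, toMat_rootElt, Matrix.add_apply, Matrix.add_apply]
  rw [Matrix.one_apply_ne (Ne.symm hl), rootNil_eq_zero (i := j) (k := i), zero_add, add_zero]
  · by_cases hil : l = i
    · subst hil
      rw [Matrix.one_apply_eq]
      simp [rootNil, h0]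
    · rw [Matrix.one_apply_ne (Ne.symm hil), rootNil_eq_zero, mul_zero, add_zero]
      · exact fun h => hil h.2
      · rintro ⟨h1, h2⟩
        exact hil (by rw [h2, h1, add_two_add_two])
  · exact fun h => hij h.1
  · exact fun h => ne_add_two _ h.1

theorem rankOneElt_apply_row' (hσ : ∀ x, σ (σ x) = x) {i j : Fin 4} (hij : i ≠ j) {c : E}
    (hc : j = i + 2 → σ c = c) (h0 : c ≠ 0) {l : Fin 4} (hl : l ≠ i + 2) :
    toMat (rankOneElt hσ i j hij c hc) (j + 2) l = 0 := by
  have hij' : j + 2 ≠ i + 2 := fun h => hij (add_left_inj (2 : Fin 4) |>.1 h).symm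
  set c' := -(((formSign i * formSign j : ℤ) : E) * σ c) with hc'
  have h0' : c' ≠ 0 := by
    have : ((formSign i * formSign j : ℤ) : E) ≠ 0 := by
      unfold formSign; split_ifs <;> simp
    exact neg_ne_zero.2 (mul_ne_zero this (by simpa using h0))
  have hcc : i + 2 = j + 2 + 2 → σ c' = c' := by
    intro h
    rw [add_two_add_two] at h
    rw [hc', map_neg, map_mul, map_intCast, hσ, hc h.symm]
  have heq : rankOneElt hσ i j hij c hc = rankOneElt hσ (j + 2) (i + 2) hij' c' hcc := by
    apply toMat_injective
    rw [rankOneElt, rankOneElt, toMat_mul, toMat_mul, toMat_rootElt, toMat_rootElt, toMat_rootElt,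
      toMat_rootElt, rootNil_symm hσ hc]
    have : -c'⁻¹ = -(((formSign j * formSign i : ℤ) : E) * σ (-c⁻¹)) := by
      have hs : ((formSign j * formSign i : ℤ) : E)⁻¹ = ((formSign j * formSign i : ℤ) : E) := by
        unfold formSign; split_ifs <;> simp
      rw [hc', map_neg, map_inv₀, inv_neg, mul_inv, mul_comm (formSign i), hs]
      ring
    rw [this, rootNil_symm hσ]
    intro h
    rw [map_neg, map_inv₀, hc (add_two_eq_iff.1 h.symm)]
  rw [heq]
  exact rankOneElt_apply_row hσ hij' hcc h0' hl

theorem rankOneElt_apply_of_ne (hσ : ∀ x, σ (σ x) = x) {i j : Fin 4} (hij : i ≠ j) {c : E}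
    (hc : j = i + 2 → σ c = c) {k l : Fin 4} (hki : k ≠ i) (hkj : k ≠ j + 2) (hkl : k ≠ l)
    (h1 : ¬(k = j ∧ l = i)) (h2 : ¬(k = i + 2 ∧ l = j + 2)) :
    toMat (rankOneElt hσ i j hij c hc) k l = 0 := by
  rw [rankOneElt, rootElt_mul_apply_of_ne _ _ _ _ hki hkj, toMat_rootElt, Matrix.add_apply,
    Matrix.one_apply_ne hkl, rootNil_eq_zero h1 h2, add_zero]

/-- The rank one Bruhat decomposition: a representative of the simple reflection moves
`rankOneElt` into the Borel subgroup. -/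
theorem simple_mul_rankOneElt_mem (hσ : ∀ x, σ (σ x) = x) {n n' : U22 σ} {w : WeylGroup}
    {s : SimpleRoot} (hn : IsMonomial n w) (hn' : IsMonomial n' (simpleReflection s)) {c : E}
    (hc : rootCol w s = rootRow w s + 2 → σ c = c) (h0 : c ≠ 0) :
    n' * (n * rankOneElt hσ _ _ (rootRow_ne_rootCol w s) c hc * n⁻¹) ∈ triangular σ 1 := by
  rw [mem_triangular]
  intro k l hkl
  obtain ⟨k, rfl⟩ := (simpleReflection s : Equiv.Perm (Fin 4)).surjective k
  obtain ⟨k, rfl⟩ := (w : Equiv.Perm (Fin 4)).surjective k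
  obtain ⟨l, rfl⟩ := (w : Equiv.Perm (Fin 4)).surjective l
  rw [toMat_mul, hn'.mul_apply, (hn.conj_eq_zero_iff _ _ _).2, mul_zero]
  change flagRank ((w : Equiv.Perm (Fin 4)) l) <
    wRank (simpleReflection s) ((w : Equiv.Perm (Fin 4)) k) at hkl
  have hrow := apply_rootRow w s
  have hcol := apply_rootCol w s
  by_cases hk1 : k = rootRow w s
  · rw [hk1]
    refine rankOneElt_apply_row hσ _ hc h0 ?_
    rintro rfl
    rw [hk1, hrow, hcol, wRank, simpleReflection_row] at hkl
    exact lt_irrefl _ hkl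
  by_cases hk2 : k = rootCol w s + 2
  · rw [hk2]
    refine rankOneElt_apply_row' hσ _ hc h0 ?_
    rintro rfl
    rw [hk2, w.2, w.2, hrow, hcol, wRank, (simpleReflection s).2, simpleReflection_col] at hkl
    exact lt_irrefl _ hkl
  refine rankOneElt_apply_of_ne hσ _ hc hk1 hk2 ?_ ?_ ?_
  · rintro rfl
    refine absurd hkl (not_lt.2 (flagRank_simple_le s _ ?_ ?_))
    · rw [← hrow]; exact fun h => hk1 ((w : Equiv.Perm (Fin 4)).injective h)
    · rw [← hcol, ← w.2]; exact fun h => hk2 ((w : Equiv.Perm (Fin 4)).injective h)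
  · rintro ⟨rfl, rfl⟩
    rw [hrow, hcol, wRank, simpleReflection_col] at hkl
    exact lt_irrefl _ hkl
  · rintro ⟨rfl, rfl⟩
    rw [w.2, w.2, hrow, hcol, wRank, (simpleReflection s).2, simpleReflection_row] at hkl
    exact lt_irrefl _ hkl

theorem conj_rootEntry {w : WeylGroup} {s : SimpleRoot} {u : U22 σ} (hu : u ∈ unitriangular σ w) :
    rootCol w s = rootRow w s + 2 →
      σ (toMat u (rootRow w s) (rootCol w s)) = toMat u (rootRow w s) (rootCol w s) := by
  intro h
  have hadj := rank_adjacent w s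
  rw [h] at hadj ⊢
  exact conj_apply_adjacent hu hadj

/-- An element of the unipotent group for `w` without component in the root of `s` belongs to the
unipotent group for `s w`. -/
theorem mem_unitriangular_simple_mul {w : WeylGroup} {s : SimpleRoot} {u : U22 σ}
    (hu : u ∈ unitriangular σ w) (h0 : toMat u (rootRow w s) (rootCol w s) = 0) :
    u ∈ unitriangular σ (simpleReflection s * w) := by
  have h0' := toMat_apply_swap_eq_zero hu (rank_adjacent w s) h0
  have hu' := hu
  rw [mem_unitriangular] at hu ⊢
  refine ⟨fun k l hkl => ?_, hu.2⟩
  by_contra hne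
  have hkl' : k ≠ l := by rintro rfl; exact lt_irrefl _ hkl
  have h1 : wRank w k < wRank w l :=
    lt_of_le_of_ne (not_lt.1 fun h => hne (hu.1 k l h)) fun h => hkl' (wRank_injective w h)
  refine lt_asymm hkl (flagRank_simple_lt s _ _ h1 ?_ ?_)
  · rintro ⟨h2, h3⟩
    rw [← apply_rootRow w] at h2
    rw [← apply_rootCol w] at h3
    rw [(w : Equiv.Perm (Fin 4)).injective h2, (w : Equiv.Perm (Fin 4)).injective h3] at hne
    exact hne h0
  · rintro ⟨h2, h3⟩
    rw [← apply_rootCol w, ← w.2] at h2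
    rw [← apply_rootRow w, ← w.2] at h3
    rw [(w : Equiv.Perm (Fin 4)).injective h2, (w : Equiv.Perm (Fin 4)).injective h3] at hne
    exact hne h0'

/-- An element `u` of the unipotent group for `w` with nonzero component `c` in the root of `s`:
after multiplication by an opposite root element with entry `-c⁻¹` it becomes an element of
`(n' n)⁻¹ B n`, for representatives `n` and `n'` of `w` and of `s`. -/
theorem exists_simple_mul_eq (hσ : ∀ x, σ (σ x) = x) {n n' : U22 σ} {w : WeylGroup}
    {s : SimpleRoot} (hn : IsMonomial n w) (hn' : IsMonomial n' (simpleReflection s)) {u : U22 σ}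
    (hu : u ∈ unitriangular σ w) {c : E} (hc : rootRow w s = rootCol w s + 2 → σ c = c)
    (hcu : c = -(toMat u (rootRow w s) (rootCol w s))⁻¹)
    (h0 : toMat u (rootRow w s) (rootCol w s) ≠ 0) :
    ∃ b ∈ triangular σ 1,
      n' * n * (u * rootElt hσ _ _ (rootRow_ne_rootCol w s).symm c hc) = b * n := by
  have hcd := conj_rootEntry (s := s) hu
  obtain ⟨x, hx⟩ : ∃ x, x = rootElt hσ _ _ (rootRow_ne_rootCol w s)
    (toMat u (rootRow w s) (rootCol w s)) hcd := ⟨_, rfl⟩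
  have hxu : x ∈ unitriangular σ w := by
    rw [hx]; exact rootElt_mem_unitriangular _ _ _ _ (rank_lt w s)
  have hux : u * x⁻¹ ∈ unitriangular σ (simpleReflection s * w) := by
    refine mem_unitriangular_simple_mul (mul_mem hu (inv_mem hxu)) ?_
    rw [toMat_mul_apply_adjacent hu (inv_mem hxu) (rank_adjacent w s),
      toMat_inv_apply_adjacent hxu (rank_adjacent w s), hx, rootElt_apply, add_neg_cancel]
  have h1 := ((hn'.mul hn).conj_mem_unitriangular 1 (u * x⁻¹)).2 (by rwa [one_mul])
  have h2 := simple_mul_rankOneElt_mem hσ hn hn' hcd h0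
  refine ⟨_, mul_mem h1.1 h2, ?_⟩
  rw [rankOneElt, ← hx]
  subst hcu
  group

end RankOne

section Cells

variable {F E : Type*} [Field F] [Field E] [Algebra F E] {σ : E ≃ₐ[F] E}

theorem mem_bruhatCell_iff {w : WeylGroup} {g : U22 σ} :
    g ∈ bruhatCell σ w ↔ ∃ b ∈ triangular σ 1, ∃ n, IsMonomial n w ∧ ∃ b' ∈ triangular σ 1,
      g = b * n * b' := by
  constructor
  · rintro ⟨b, hb, b', hb', rfl⟩
    exact ⟨b, mem_borel_iff.1 hb, _, isMonomial_weylRep w, b', mem_borel_iff.1 hb', rfl⟩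
  · rintro ⟨b, hb, n, hn, b', hb', rfl⟩
    obtain ⟨t, ht, rfl⟩ := hn.exists_torus_mul (isMonomial_weylRep w)
    exact ⟨b * t, mem_borel_iff.2 (mul_mem hb (torus_le_triangular ht 1)), b',
      mem_borel_iff.2 hb', by group⟩

theorem bruhatCell_mul_mem {w : WeylGroup} {g b : U22 σ} (hg : g ∈ bruhatCell σ w)
    (hb : b ∈ triangular σ 1) : g * b ∈ bruhatCell σ w := by
  rw [mem_bruhatCell_iff] at hg ⊢
  obtain ⟨b₁, h1, n, hn, b₂, h2, rfl⟩ := hg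
  exact ⟨b₁, h1, n, hn, b₂ * b, mul_mem h2 hb, by group⟩

/-- Elements of the cell of `w` have the form `b n u` with `b` in the Borel subgroup, `u` unipotent
and `n` any given representative of `w`. -/
theorem exists_of_mem_bruhatCell {w : WeylGroup} {g n : U22 σ} (hg : g ∈ bruhatCell σ w)
    (hn : IsMonomial n w) : ∃ b ∈ triangular σ 1, ∃ u ∈ unitriangular σ 1, g = b * n * u := by
  obtain ⟨b, h1, n', hn', b', h2, rfl⟩ := mem_bruhatCell_iff.1 hg
  obtain ⟨t, ht, u, hu, rfl⟩ := exists_torus_mul h2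
  have hnt : IsMonomial (n' * t) w := by
    have := hn'.mul (mem_torus_iff.1 ht)
    rwa [mul_one] at this
  obtain ⟨t', ht', h3⟩ := hnt.exists_torus_mul hn
  rw [unipotent_eq] at hu
  refine ⟨b * t', mul_mem h1 (torus_le_triangular ht' 1), u, hu, ?_⟩
  have : b * n' * (t * u) = b * (n' * t) * u := by group
  rw [this, h3]; group

/-- The product rule `B w B s ⊆ B w B ∪ B w s B` for Bruhat cells. -/
theorem mul_simple_mem (hσ : ∀ x, σ (σ x) = x) {w : WeylGroup} {s : SimpleRoot} {g n' : U22 σ}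
    (hg : g ∈ bruhatCell σ w)
    (hn' : IsMonomial n' (simpleReflection s)) :
    g * n' ∈ bruhatCell σ w ∨ g * n' ∈ bruhatCell σ (w * simpleReflection s) := by
  obtain ⟨b, hb, u, hu, rfl⟩ := exists_of_mem_bruhatCell hg (isMonomial_weylRep w)
  have hn := isMonomial_weylRep (σ := σ) w
  have hcd := conj_rootEntry (s := s) hu
  obtain ⟨c, hc⟩ : ∃ c, c = toMat u (rootRow 1 s) (rootCol 1 s) := ⟨_, rfl⟩
  rw [← hc] at hcd
  obtain ⟨x, hx⟩ : ∃ x, x = rootElt hσ _ _ (rootRow_ne_rootCol 1 s) c hcd := ⟨_, rfl⟩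
  have hxu : x ∈ unitriangular σ 1 := by
    rw [hx]; exact rootElt_mem_unitriangular _ _ _ _ (rank_lt 1 s)
  have hs_inv : (simpleReflection s)⁻¹ = simpleReflection s :=
    inv_eq_of_mul_eq_one_left (simpleReflection_mul_self s)
  have hns : IsMonomial n'⁻¹ (simpleReflection s) := by
    have := hn'.inv; rwa [hs_inv] at this
  -- Move the part of `u` outside the root group of `s` to the right.
  have hux : n'⁻¹ * (x⁻¹ * u) * n' ∈ unitriangular σ 1 := by
    have h1 : x⁻¹ * u ∈ unitriangular σ (simpleReflection s * 1) := by
      refine mem_unitriangular_simple_mul (mul_mem (inv_mem hxu) hu) ?_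
      rw [toMat_mul_apply_adjacent (inv_mem hxu) hu (rank_adjacent 1 s),
        toMat_inv_apply_adjacent hxu (rank_adjacent 1 s), hx, rootElt_apply, hc, neg_add_cancel]
    have h2 := (hns.conj_mem_unitriangular 1 (x⁻¹ * u)).2 (by simpa using h1)
    rwa [inv_inv] at h2
  have hrw : b * weylRep σ w * u * n' =
      b * weylRep σ w * x * n' * (n'⁻¹ * (x⁻¹ * u) * n') := by group
  rw [hrw]
  have hwn := hn.mul hn'
  suffices h : b * weylRep σ w * x * n' ∈ bruhatCell σ w ∨
      b * weylRep σ w * x * n' ∈ bruhatCell σ (w * simpleReflection s) from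
    h.imp (fun h => bruhatCell_mul_mem h hux.1) (fun h => bruhatCell_mul_mem h hux.1)
  rcases lt_or_gt_of_ne ((wRank_injective w).ne (rootRow_ne_rootCol 1 s)) with hlt | hlt
  · -- Here `w` maps the root of `s` to a positive root.
    right
    rw [mem_bruhatCell_iff]
    have h1 : weylRep σ w * x * (weylRep σ w)⁻¹ ∈ unitriangular σ 1 := by
      rw [hn.conj_mem_unitriangular, one_mul, hx]
      exact rootElt_mem_unitriangular _ _ _ _ hlt
    exact ⟨b * (weylRep σ w * x * (weylRep σ w)⁻¹), mul_mem hb h1.1, _, hwn, 1, one_mem _,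
      by group⟩
  · by_cases h0 : c = 0
    · right
      have hx1 : x = 1 := by
        subst h0
        rw [hx, rootElt_zero]
      rw [mem_bruhatCell_iff, hx1]
      exact ⟨b, hb, _, hwn, 1, one_mem _, by group⟩
    · left
      have hcd' : rootCol 1 s = rootRow 1 s + 2 → σ (-c) = -c := fun h => by rw [map_neg, hcd h]
      have hcd'' : rootRow 1 s = rootCol 1 s + 2 → σ (-(-c)⁻¹) = -(-c)⁻¹ := fun h => by
        rw [map_neg, map_inv₀, map_neg, hcd (add_two_eq_iff.1 h.symm)]
      obtain ⟨y, hy⟩ : ∃ y, y = rootElt hσ _ _ (rootRow_ne_rootCol 1 s).symm (-(-c)⁻¹) hcd'' :=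
        ⟨_, rfl⟩
      have h1 : weylRep σ w * y * (weylRep σ w)⁻¹ ∈ unitriangular σ 1 := by
        rw [hn.conj_mem_unitriangular, one_mul, hy]
        exact rootElt_mem_unitriangular _ _ _ _ hlt
      have h2 := simple_mul_rankOneElt_mem hσ (IsMonomial.one) hns hcd' (neg_ne_zero.2 h0)
      have hxinv : rootElt hσ _ _ (rootRow_ne_rootCol 1 s) (-c) hcd' = x⁻¹ := by
        rw [eq_inv_iff_mul_eq_one, hx]
        apply toMat_injective
        have hnil : rootNil σ (rootRow 1 s) (rootCol 1 s) (-c) =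
            -rootNil σ (rootRow 1 s) (rootCol 1 s) c := by
          ext k l
          simp only [rootNil, Matrix.of_apply, Matrix.neg_apply]
          split_ifs <;> simp
        rw [toMat_mul, toMat_rootElt, toMat_rootElt, hnil, toMat_one, add_mul, one_mul, mul_add,
          mul_one, neg_mul, rootNil_mul_self (rootRow_ne_rootCol 1 s)]
        abel
      rw [rankOneElt, hxinv, ← hy] at h2
      rw [mem_bruhatCell_iff]
      refine ⟨b * (weylRep σ w * y * (weylRep σ w)⁻¹), mul_mem hb h1.1, _, hn, _, inv_mem h2, ?_⟩
      group

/-- Iterating the product rule: `B w B ẇ'` is contained in the union of the cells of `w w''`, where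
`w''` runs through the products of subwords of the word of `w'`. -/
theorem mul_wordRep_mem (hσ : ∀ x, σ (σ x) = x) (ω : List SimpleRoot) :
    ∀ {w : WeylGroup} {g : U22 σ}, g ∈ bruhatCell σ w →
      ∃ ω' : List SimpleRoot, ω'.Sublist ω ∧ g * wordRep σ ω ∈ bruhatCell σ (w * wordProd ω') := by
  induction ω with
  | nil =>
    intro w g hg
    refine ⟨[], List.Sublist.refl _, ?_⟩
    simpa [wordRep, wordProd] using hg
  | cons s ω ih =>
    intro w g hg
    rw [wordRep_cons, ← mul_assoc]
    rcases mul_simple_mem hσ hg (isMonomial_simpleRep s) with h | h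
    · obtain ⟨ω', h1, h2⟩ := ih h
      exact ⟨ω', h1.cons s, h2⟩
    · obtain ⟨ω', h1, h2⟩ := ih h
      refine ⟨s :: ω', h1.cons_cons s, ?_⟩
      rwa [wordProd_cons, ← mul_assoc]

end Cells

/-! ### Descent along Bruhat cells -/

section Descent

variable {F E : Type*} [Field F] [ValuativeRel F] [Field E] [ValuativeRel E] [Algebra F E]
  {σ : E ≃ₐ[F] E} {ϖ : Fˣ}

/-- The uniformizer `ϖ` of `F`, as an element of `E`. -/
local notation "𝔭" => algebraMap F E (ϖ : F)

/-- The formal properties of the relation `W_{v_k}(g) = W_{v'_k}(g)` between a level `k` and an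
element `g`: it is invariant under `U` on the left and under the Howe group of level `k` on the
right, and the relation at level `m` follows by averaging from that at a level `k ≤ m`. -/
structure IsHoweRelation (h : IsUnramifiedConj σ ϖ) (C : ℕ) (R : ℕ → U22 σ → Prop) : Prop where
  left : ∀ {k g u}, u ∈ unipotent σ → R k g → R k (u * g)
  right : ∀ {k g x}, C ≤ k → x ∈ howeSubgroup h k → R k (g * x) → R k g
  average : ∀ {k m g}, C ≤ k → k ≤ m →
    (∀ u ∈ unipotent σ, u ∈ howeSubgroup h m → R k (g * u)) → R m g

/-- Right multiplication by elements of `U_k` removes, one after the other, the components of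
`u ∈ U` in the roots given by the letters of a reduced word, until a component is met that is not
small at level `k`. -/
theorem strip (h : IsUnramifiedConj σ ϖ) {ω : List SimpleRoot} (hω : ω ∈ reducedWords) (k : ℕ)
    {u : U22 σ} (hu : u ∈ unitriangular σ 1) (ω₂ : List SimpleRoot) :
    ∀ ω₁ : List SimpleRoot, ω = ω₁ ++ ω₂ →
    (∃ x ∈ unitriangular σ 1, x ∈ howeSubgroup h k ∧
      x ∈ unitriangular σ (longestElt * wordProd ω) ∧ u * x ∈ unitriangular σ (wordProd ω₂)) ∨
    ∃ (ω₁' : List SimpleRoot) (s : SimpleRoot) (ω₂' : List SimpleRoot), ω = ω₁' ++ s :: ω₂' ∧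
      ω₂'.length < ω₂.length ∧ ∃ x ∈ unitriangular σ 1, x ∈ howeSubgroup h k ∧
        u * x ∈ unitriangular σ (wordProd ω₂') ∧
        toMat (u * x) (rootRow (wordProd ω₂') s) (rootCol (wordProd ω₂') s) ∉
          fracIdeal 𝔭 (howeExp k (rootRow (wordProd ω₂') s) (rootCol (wordProd ω₂') s)) := by
  induction ω₂ with
  | nil =>
    intro ω₁ _
    refine Or.inl ⟨1, one_mem _, one_mem _, one_mem _, ?_⟩
    rw [mul_one]; exact hu
  | cons s ω₂ ih =>
    intro ω₁ hsplit
    rcases ih (ω₁ ++ [s]) (by rw [hsplit]; simp) with ⟨x, hx1, hxk, hxw, hux⟩ | hr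
    · by_cases hsmall : toMat (u * x) (rootRow (wordProd ω₂) s) (rootCol (wordProd ω₂) s) ∈
          fracIdeal 𝔭 (howeExp k (rootRow (wordProd ω₂) s) (rootCol (wordProd ω₂) s))
      · left
        obtain ⟨hpos, hneg⟩ := reduced_split hω hsplit
        have hc := conj_rootEntry (s := s) hux
        have hc' : rootCol (wordProd ω₂) s = rootRow (wordProd ω₂) s + 2 →
            σ (-toMat (u * x) (rootRow (wordProd ω₂) s) (rootCol (wordProd ω₂) s)) =
            -toMat (u * x) (rootRow (wordProd ω₂) s) (rootCol (wordProd ω₂) s) := fun h => by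
          rw [map_neg, hc h]
        have hne := rootRow_ne_rootCol (wordProd ω₂) s
        have hy : rootElt h.invol _ _ hne _ hc' ∈ unitriangular σ (wordProd ω₂) :=
          rootElt_mem_unitriangular _ _ _ _ (rank_lt _ s)
        refine ⟨x * rootElt h.invol _ _ hne _ hc',
          mul_mem hx1 (rootElt_mem_unitriangular _ _ _ _ hpos),
          mul_mem hxk (rootElt_mem_howeSubgroup h hne _ hc' (neg_mem hsmall)),
          mul_mem hxw (rootElt_mem_unitriangular _ _ _ _ ?_), ?_⟩
        · rw [wRank_longestElt_mul, wRank_longestElt_mul]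
          exact Fin.rev_lt_rev.2 hneg
        · rw [← mul_assoc, wordProd_cons]
          refine mem_unitriangular_simple_mul (mul_mem hux hy) ?_
          rw [toMat_mul_apply_adjacent hux hy (rank_adjacent _ s), rootElt_apply, add_neg_cancel]
      · right
        exact ⟨ω₁, s, ω₂, hsplit, by simp, x, hx1, hxk, hux, hsmall⟩
    · right
      obtain ⟨ω₁', s', ω₂', h1, h2, h3⟩ := hr
      exact ⟨ω₁', s', ω₂', h1, by simp only [List.length_cons]; omega, h3⟩

/-- If an entry is large at level `k`, its inverse is small at a level `k' ≤ k / 3` in the opposite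
place. -/
theorem inv_mem_of_large (h : IsUnramifiedConj σ ϖ) {k k' : ℕ} (hk : 3 * k' ≤ k) {i j : Fin 4}
    (hij : wRank 1 i < wRank 1 j) {c : E} (hc : c ∉ fracIdeal 𝔭 (howeExp k i j)) :
    c⁻¹ ∈ fracIdeal 𝔭 (howeExp k' j i) := by
  refine h.anti ?_ (inv_mem_fracIdeal hc)
  have h1 := weight_lt_of_rank_lt hij
  have h2 : (3 * k' : ℤ) ≤ k := by exact_mod_cast hk
  rw [howeExp, howeExp]
  nlinarith [mul_nonneg (sub_nonneg.2 h2) (by omega : (0 : ℤ) ≤ -(weight i - weight j + 1)),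
    mul_nonneg (Int.natCast_nonneg k') (by omega : (0 : ℤ) ≤ -(weight i - weight j + 1) - 1)]

variable {h : IsUnramifiedConj σ ϖ} {C : ℕ} {R : ℕ → U22 σ → Prop}

/-- If `u` has a large component in the root of a letter of the reduced word, then `ẇ u` lies,
modulo the Howe group of a lower level, in smaller Bruhat cells. Each of the letters to the right
of this one costs a factor `4` in the level, for the components that were small at level `k` may be
large at level `k / 4`. -/
theorem IsHoweRelation.of_large (hR : IsHoweRelation h C R) {ω : List SimpleRoot}
    (hω : ω ∈ reducedWords) {k₀ : ℕ} (hk₀ : C ≤ k₀)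
    (hlow : ∀ ω' : List SimpleRoot, ω'.Sublist ω → ω'.length < ω.length → ∀ k, k₀ ≤ k →
      ∀ g ∈ bruhatCell σ (wordProd ω'), R k g) (n : ℕ) :
    ∀ (ω₁ : List SimpleRoot) (s : SimpleRoot) (ω₂ : List SimpleRoot), ω = ω₁ ++ s :: ω₂ →
      ω₂.length = n → ∀ k, 4 ^ (n + 1) * k₀ ≤ k → ∀ b ∈ triangular σ 1,
      ∀ u ∈ unitriangular σ 1, u ∈ unitriangular σ (wordProd ω₂) →
      toMat u (rootRow (wordProd ω₂) s) (rootCol (wordProd ω₂) s) ∉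
        fracIdeal 𝔭 (howeExp k (rootRow (wordProd ω₂) s) (rootCol (wordProd ω₂) s)) →
      R k (b * wordRep σ ω * u) := by
  induction n using Nat.strong_induction_on with
  | _ n ih =>
  intro ω₁ s ω₂ hsplit hlen k hk b hb u hu huy hlarge
  have hk₁ : 4 ^ n * k₀ ≤ k / 4 := by
    rw [Nat.le_div_iff_mul_le (by norm_num)]
    calc 4 ^ n * k₀ * 4 = 4 ^ (n + 1) * k₀ := by ring
      _ ≤ k := hk
  have hkk : k₀ ≤ k / 4 := (Nat.le_mul_of_pos_left _ (by positivity)).trans hk₁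
  have hCk : C ≤ k / 4 := hk₀.trans hkk
  -- Descend to the level `k / 4`, where the inverse of the large entry is small. Averaging replaces
  -- `u` by `u u'` with `u' ∈ U_k`, and then the letters to the right of `s` are removed again.
  refine hR.average hCk (Nat.div_le_self k 4) fun u' hu' hk' => ?_
  have hu1 := hu'
  rw [unipotent_eq] at hu1
  rw [mul_assoc]
  rcases strip h hω (k / 4) (mul_mem hu hu1) ω₂ (ω₁ ++ [s]) (by rw [hsplit]; simp) with
    ⟨x, hx1, hxk, -, hux⟩ | ⟨ω₁', s', ω₂', hsplit', hlen', x, hx1, hxk, hux, hbig⟩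
  · refine hR.right hCk hxk ?_
    obtain ⟨hpos, -⟩ := reduced_split hω hsplit
    -- The factor `u' x` belongs to `U_k`, so that the component remains large.
    have hxk' : x ∈ howeSubgroup h k := unipotent_inf_howeSubgroup_mono h (Nat.div_le_self k 4)
      (by rw [unipotent_eq]; exact hx1) hxk
    have hy : u' * x ∈ unitriangular σ (wordProd ω₂) := by
      have := mul_mem (inv_mem huy) hux
      rwa [mul_assoc, inv_mul_cancel_left] at this
    have hsum := toMat_mul_apply_adjacent huy hy (rank_adjacent (wordProd ω₂) s)
    rw [← mul_assoc] at hsum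
    have hlarge' : toMat (u * u' * x) (rootRow (wordProd ω₂) s) (rootCol (wordProd ω₂) s) ∉
        fracIdeal 𝔭 (howeExp k (rootRow (wordProd ω₂) s) (rootCol (wordProd ω₂) s)) := by
      intro hmem
      apply hlarge
      have h1 := (mul_mem hk' hxk').1 (rootRow (wordProd ω₂) s) (rootCol (wordProd ω₂) s)
      rw [Matrix.one_apply_ne (rootRow_ne_rootCol _ s), sub_zero] at h1
      rw [hsum] at hmem
      simpa using sub_mem hmem h1
    have h0 : toMat (u * u' * x) (rootRow (wordProd ω₂) s) (rootCol (wordProd ω₂) s) ≠ 0 := by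
      intro h0; rw [h0] at hlarge'; exact hlarge' (zero_mem _)
    have hc := conj_rootEntry (s := s) hux
    have hc' : rootRow (wordProd ω₂) s = rootCol (wordProd ω₂) s + 2 →
        σ (-(toMat (u * u' * x) (rootRow (wordProd ω₂) s) (rootCol (wordProd ω₂) s))⁻¹) =
        -(toMat (u * u' * x) (rootRow (wordProd ω₂) s) (rootCol (wordProd ω₂) s))⁻¹ := fun h => by
      rw [map_neg, map_inv₀, hc (add_two_eq_iff.1 h.symm)]
    have hz := rootElt_mem_howeSubgroup h (rootRow_ne_rootCol (wordProd ω₂) s).symm _ hc'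
      (neg_mem (inv_mem_of_large h (k' := k / 4) (by omega) hpos hlarge'))
    -- In rank one, multiplication by the opposite root element deletes the letter `s`.
    refine hR.right hCk hz ?_
    obtain ⟨b', hb', heq⟩ := exists_simple_mul_eq h.invol (isMonomial_wordRep ω₂)
      (isMonomial_simpleRep s) hux hc' rfl h0
    have hcell : b * wordRep σ ω₁ * b' ∈ bruhatCell σ (wordProd ω₁) :=
      mem_bruhatCell_iff.2 ⟨b, hb, _, isMonomial_wordRep ω₁, b', hb', rfl⟩
    obtain ⟨ω', hsub, hmem⟩ := mul_wordRep_mem h.invol ω₂ hcell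
    have hgoal : b * (wordRep σ ω * (u * u')) * x *
        rootElt h.invol _ _ (rootRow_ne_rootCol (wordProd ω₂) s).symm _ hc' =
        b * wordRep σ ω₁ * b' * wordRep σ ω₂ := by
      rw [mul_assoc _ b', ← heq, hsplit, wordRep_append, wordRep_cons]
      group
    rw [mul_assoc b, hgoal]
    rw [← wordProd_append] at hmem
    refine hlow (ω₁ ++ ω') ?_ ?_ _ hkk _ hmem
    · rw [hsplit]
      exact (List.Sublist.refl ω₁).append (hsub.cons s)
    · rw [hsplit]
      have := hsub.length_le
      simp only [List.length_append, List.length_cons]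
      omega
  · -- A component is large at level `k / 4`, in the root of a letter further to the right.
    refine hR.right hCk hxk ?_
    have := ih ω₂'.length (by omega) ω₁' s' ω₂' hsplit' rfl (k / 4) ?_ b hb _
      (mul_mem (mul_mem hu hu1) hx1) hux hbig
    · rwa [mul_assoc, mul_assoc, mul_assoc] at *
    · refine le_trans ?_ hk₁
      exact Nat.mul_le_mul_right _ (Nat.pow_le_pow_right (by norm_num) (by omega))

variable {a : ℕ → ℕ}

/-- The exponents `a_t` increase with `t`. -/
theorem exponent_mono {l : ℕ} (ha : ∀ t, 1 ≤ t → t ≤ l → t + a (t - 1) ≤ a t) {i j : ℕ}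
    (hij : i ≤ j) (hjl : j ≤ l) : a i ≤ a j := by
  induction j, hij using Nat.le_induction with
  | base => exact le_rfl
  | succ j hij ih =>
    have h1 := ha (j + 1) (by omega) hjl
    have h2 := ih (by omega)
    simp only [Nat.add_sub_cancel] at h1
    omega

/-- For a point `b ẇ u` of the cell of `w`, either the relation holds because of the smaller cells,
or the components of `u` in the roots made negative by `w` can be removed at level `m`. -/
theorem IsHoweRelation.strip_or (hR : IsHoweRelation h C R) {ω : List SimpleRoot}
    (hω : ω ∈ reducedWords) (ha : ∀ t, 1 ≤ t → t ≤ ω.length → t + a (t - 1) ≤ a t)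
    (hlow : ∀ ω' : List SimpleRoot, ω'.Sublist ω → ω'.length < ω.length → ∀ k,
      4 ^ a (ω.length - 1) * C ≤ k → ∀ g ∈ bruhatCell σ (wordProd ω'), R k g)
    {m : ℕ} (hm : 4 ^ a ω.length * C ≤ m) {b u : U22 σ} (hb : b ∈ triangular σ 1)
    (hu : u ∈ unitriangular σ 1) :
    R m (b * wordRep σ ω * u) ∨ ∃ x ∈ unitriangular σ 1, x ∈ howeSubgroup h m ∧
      x ∈ unitriangular σ (longestElt * wordProd ω) ∧ u * x ∈ unitriangular σ (wordProd ω) := by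
  have hCm : C ≤ m := (Nat.le_mul_of_pos_left _ (by positivity)).trans hm
  rcases strip h hω m hu ω [] rfl with hl | ⟨ω₁, s, ω₂, hsplit, hlen, x, hx1, hxm, hux, hbig⟩
  · exact Or.inr hl
  · left
    refine hR.right hCm hxm ?_
    rw [mul_assoc]
    refine hR.of_large hω (k₀ := 4 ^ a (ω.length - 1) * C)
      (Nat.le_mul_of_pos_left _ (by positivity)) hlow _ ω₁ s ω₂ hsplit rfl m ?_ b hb _
      (mul_mem hu hx1) hux hbig
    refine le_trans ?_ hm
    -- At most `l(w)` descents are needed, each by a factor `4`, and `a_l ≥ l + a_(l-1)`.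
    rw [← mul_assoc, ← pow_add]
    refine Nat.mul_le_mul_right _ (Nat.pow_le_pow_right (by norm_num) ?_)
    have := ha ω.length (by omega) le_rfl
    omega

/-- If the relation holds on the torus translates of the representatives of all `w' ≤ w`, it holds
on the Bruhat cell of `w`. -/
theorem IsHoweRelation.of_bruhatCell (hR : IsHoweRelation h C R) (l : ℕ) :
    ∀ ω ∈ reducedWords, ω.length = l → (∀ t, 1 ≤ t → t ≤ l → t + a (t - 1) ≤ a t) →
    (∀ ω' : List SimpleRoot, ω'.Sublist ω → ∀ k, 4 ^ a (weylLength (wordProd ω')) * C ≤ k →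
      ∀ t ∈ torus σ, R k (t * weylRep σ (wordProd ω'))) →
    ∀ m, 4 ^ a l * C ≤ m → ∀ g ∈ bruhatCell σ (wordProd ω), R m g := by
  induction l using Nat.strong_induction_on with
  | _ l ih =>
  intro ω hω hlen ha hyp m hm g hg
  have hred := isReducedWord_of_mem hω
  obtain ⟨b, hb, u, hu, rfl⟩ := exists_of_mem_bruhatCell hg (isMonomial_wordRep ω)
  have hCm : C ≤ m := (Nat.le_mul_of_pos_left _ (by positivity)).trans hm
  have hlow : ∀ ω' : List SimpleRoot, ω'.Sublist ω → ω'.length < ω.length → ∀ k,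
      4 ^ a (ω.length - 1) * C ≤ k → ∀ g ∈ bruhatCell σ (wordProd ω'), R k g := by
    intro ω' hsub hlt k hk g hg
    obtain ⟨ω'', h1, h2, h3⟩ := exists_reduced_sublist ω hω ω' (List.mem_sublists.2 hsub)
    rw [← h3] at hg
    have hle := h2.length_le
    refine ih ω''.length (by omega) ω'' h1 rfl (fun t ht1 ht2 => ha t ht1 (by omega))
      (fun τ hτ => hyp τ (hτ.trans (h2.trans hsub))) k (le_trans ?_ hk) g hg
    exact Nat.mul_le_mul_right _ (Nat.pow_le_pow_right (by norm_num)
      (exponent_mono ha (by omega) (by omega)))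
  subst hlen
  rcases hR.strip_or hω ha hlow hm hb hu with hdone | ⟨x, -, hxm, -, hux⟩
  · exact hdone
  · -- The conjugate of `u x` by `ẇ` lies in `U`, so that the point is in `U t ẇ` for some `t ∈ T`.
    refine hR.right hCm hxm ?_
    have h1 := ((isMonomial_wordRep (σ := σ) ω).conj_mem_unitriangular 1 (u * x)).2
      (by rwa [one_mul])
    obtain ⟨t, ht, u₀, hu₀, h2⟩ := exists_torus_mul (mul_mem hb h1.1)
    have h3 : t * u₀ * t⁻¹ ∈ unipotent σ := by
      rw [unipotent_eq] at hu₀ ⊢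
      rw [(mem_torus_iff.1 ht).conj_mem_unitriangular, mul_one]
      exact hu₀
    have h4 : b * wordRep σ ω * u * x = t * u₀ * t⁻¹ * (t * wordRep σ ω) := by
      calc b * wordRep σ ω * u * x =
          b * (wordRep σ ω * (u * x) * (wordRep σ ω)⁻¹) * wordRep σ ω := by group
        _ = t * u₀ * t⁻¹ * (t * wordRep σ ω) := by rw [h2]; group
    rw [h4]
    refine hR.left h3 ?_
    have := hyp ω (List.Sublist.refl ω) m (by rwa [weylLength_eq hred]) t ht
    rwa [weylRep_wordProd σ hred] at this

/-- If the relation holds on the torus translates of the representatives of all `w' < w`, it holds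
on `t ẇ u` for the elements `u` of `U_w⁻` outside `U_m`. -/
theorem IsHoweRelation.of_notMem (hR : IsHoweRelation h C R) {ω : List SimpleRoot}
    (hω : ω ∈ reducedWords) (ha : ∀ t, 1 ≤ t → t ≤ ω.length → t + a (t - 1) ≤ a t)
    (hyp : ∀ ω' : List SimpleRoot, ω'.Sublist ω → ω'.length < ω.length →
      ∀ k, 4 ^ a (weylLength (wordProd ω')) * C ≤ k →
      ∀ t ∈ torus σ, R k (t * weylRep σ (wordProd ω')))
    {m : ℕ} (hm : 4 ^ a ω.length * C ≤ m) {t u : U22 σ} (ht : t ∈ torus σ)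
    (hu : u ∈ unipotentMinus σ (wordProd ω)) (hum : u ∉ howeGroup σ ϖ m) :
    R m (t * weylRep σ (wordProd ω) * u) := by
  have hlow : ∀ ω' : List SimpleRoot, ω'.Sublist ω → ω'.length < ω.length → ∀ k,
      4 ^ a (ω.length - 1) * C ≤ k → ∀ g ∈ bruhatCell σ (wordProd ω'), R k g := by
    intro ω' hsub hlt k hk g hg
    obtain ⟨ω'', h1, h2, h3⟩ := exists_reduced_sublist ω hω ω' (List.mem_sublists.2 hsub)
    rw [← h3] at hg
    have hle := h2.length_le
    refine hR.of_bruhatCell ω''.length ω'' h1 rfl (fun t ht1 ht2 => ha t ht1 (by omega))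
      (fun τ hτ => hyp τ (hτ.trans (h2.trans hsub)) ?_) k (le_trans ?_ hk) g hg
    · have := hτ.length_le; omega
    · exact Nat.mul_le_mul_right _ (Nat.pow_le_pow_right (by norm_num)
        (exponent_mono ha (by omega) (by omega)))
  obtain ⟨hu1, huw⟩ := mem_unipotentMinus hu
  rw [weylRep_wordProd σ (isReducedWord_of_mem hω)]
  rcases hR.strip_or hω ha hlow hm (torus_le_triangular ht 1) hu1 with
    hdone | ⟨x, hx1, hxm, hxw, hux⟩
  · exact hdone
  · -- Now `u x` lies in `U_w⁻` and in its complement, so that `u = x⁻¹` lies in `U_m`.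
    exfalso
    have h1 := unitriangular_inf_longestElt hux (mul_mem huw hxw)
    rw [eq_inv_of_mul_eq_one_left h1] at hum
    exact hum (howeSubgroup_le h (inv_mem hxm))

end Descent

/-! ### Whittaker functions of Howe vectors -/

section Whittaker

variable {F E : Type*} [Field F] [ValuativeRel F] [Field E] [ValuativeRel E]
  [TopologicalSpace E] [IsNonarchimedeanLocalField E] [Algebra F E]
  {σ : E ≃ₐ[F] E} {ϖ : Fˣ} {ψ : AddChar F Circle} {ψE : AddChar E Circle}

theorem t2Space_of_isNonarchimedeanLocalField (E : Type*) [Field E] [ValuativeRel E]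
    [TopologicalSpace E] [IsNonarchimedeanLocalField E] : T2Space E := by
  let := IsTopologicalAddGroup.rightUniformSpace E
  have := isUniformAddGroup_of_addCommGroup (G := E)
  infer_instance

variable {V V' : Type*} [AddCommGroup V] [Module ℂ V] [AddCommGroup V'] [Module ℂ V']
  {π : Representation ℂ (U22 σ) V} {π' : Representation ℂ (U22 σ) V'}
  {ℓ : V →ₗ[ℂ] ℂ} {ℓ' : V' →ₗ[ℂ] ℂ} {v : V} {v' : V'}

omit [ValuativeRel F] [ValuativeRel E] [TopologicalSpace E] [IsNonarchimedeanLocalField E] in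
theorem whittaker_unipotent_mul (hℓ : IsWhittakerFunctional ψ ψE π ℓ) (ξ : V) {u : U22 σ}
    (hu : u ∈ unipotent σ) (g : U22 σ) :
    whittaker π ℓ ξ (u * g) = genericChar ψ ψE u * whittaker π ℓ ξ g := by
  rw [whittaker, map_mul, Module.End.mul_apply, hℓ.2 u hu, whittaker]

variable [MeasurableSpace (unipotent σ)] [BorelSpace (unipotent σ)] (μ : Measure (unipotent σ))
  [μ.IsHaarMeasure] [T2Space E]

theorem whittaker_howeVector_mul (h : IsUnramifiedConj σ ϖ) (hσ : Continuous σ)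
    (hψ : ∀ x ∈ 𝒪[F], ψ x = 1) (hψE : ∀ x ∈ 𝒪[E], ψE x = 1) {k C : ℕ} (hC : 1 ≤ C) (hCk : C ≤ k)
    (hv : ∀ x ∈ congruence σ C, π x v = v) (g : U22 σ) {x : U22 σ} (hx : x ∈ howeSubgroup h k) :
    whittaker π ℓ (howeVector μ ϖ ψ ψE π v k) (g * x) =
      howeChar ψ ψE x * whittaker π ℓ (howeVector μ ϖ ψ ψE π v k) g := by
  rw [whittaker, map_mul, Module.End.mul_apply, map_howeVector μ h hσ hψ hψE hC hCk hv hx,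
    map_smul, map_smul, smul_eq_mul, whittaker]

theorem whittaker_howeVector_average (h : IsUnramifiedConj σ ϖ) (hσ : Continuous σ)
    (hψ : ∀ x ∈ 𝒪[F], ψ x = 1) (hψE : ∀ x ∈ 𝒪[E], ψE x = 1) {k m C : ℕ} (hkm : k ≤ m)
    (hv : ∀ x ∈ congruence σ C, π x v = v) (g : U22 σ)
    [Fintype (unipotentLevelSubgroup h m ⧸
      (unipotentCongruence h C).subgroupOf (unipotentLevelSubgroup h m))] :
    whittaker π ℓ (howeVector μ ϖ ψ ψE π v m) g = (Fintype.card (unipotentLevelSubgroup h m ⧸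
      (unipotentCongruence h C).subgroupOf (unipotentLevelSubgroup h m)) : ℂ)⁻¹ *
      cosetSum (unipotentCongruence h C) (unipotentLevelSubgroup h m) fun u =>
        (howeChar ψ ψE (u : U22 σ))⁻¹ *
          whittaker π ℓ (howeVector μ ϖ ψ ψE π v k) (g * (u : U22 σ)) := by
  rw [whittaker, howeVector_eq_average μ h hσ hψ hψE hkm hv, map_smul, map_smul, smul_eq_mul,
    cosetSum, map_sum, map_sum, cosetSum]
  congr 1
  refine Finset.sum_congr rfl fun q _ => ?_
  rw [howeIntegrand, map_smul, map_smul, smul_eq_mul, whittaker, map_mul, Module.End.mul_apply]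

/-- The equality of the Whittaker functions of two Howe vectors has the formal properties used in
the descent along Bruhat cells. -/
theorem isHoweRelation_whittaker (h : IsUnramifiedConj σ ϖ) (hσ : Continuous σ)
    (hψ : ∀ x ∈ 𝒪[F], ψ x = 1) (hψE : ∀ x ∈ 𝒪[E], ψE x = 1) {C : ℕ} (hC : 1 ≤ C)
    (hℓ : IsWhittakerFunctional ψ ψE π ℓ) (hℓ' : IsWhittakerFunctional ψ ψE π' ℓ')
    (hv : ∀ x ∈ congruence σ C, π x v = v) (hv' : ∀ x ∈ congruence σ C, π' x v' = v') :
    IsHoweRelation h C fun k g => whittaker π ℓ (howeVector μ ϖ ψ ψE π v k) g =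
      whittaker π' ℓ' (howeVector μ ϖ ψ ψE π' v' k) g where
  left := by
    intro k g u hu hg
    rw [whittaker_unipotent_mul hℓ _ hu, whittaker_unipotent_mul hℓ' _ hu, hg]
  right := by
    intro k g x hCk hx hg
    rw [whittaker_howeVector_mul μ h hσ hψ hψE hC hCk hv g hx,
      whittaker_howeVector_mul μ h hσ hψ hψE hC hCk hv' g hx] at hg
    exact mul_left_cancel₀ (howeChar_ne_zero x) hg
  average := by
    intro k m g _ hkm hg
    have := finite_unipotentLevel_quotient h hσ C m
    have := Fintype.ofFinite (unipotentLevelSubgroup h m ⧸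
      (unipotentCongruence h C).subgroupOf (unipotentLevelSubgroup h m))
    rw [whittaker_howeVector_average μ h hσ hψ hψE hkm hv,
      whittaker_howeVector_average μ h hσ hψ hψE hkm hv', cosetSum, cosetSum]
    congr 1
    refine Finset.sum_congr rfl fun q _ => ?_
    rw [hg _ (q.out : unipotentLevelSubgroup h m).1.2 (q.out : unipotentLevelSubgroup h m).2]

end Whittaker

section Main

variable {F E : Type*} [Field F] [ValuativeRel F] [TopologicalSpace F]
  [IsNonarchimedeanLocalField F] [Field E] [ValuativeRel E] [TopologicalSpace E]
  [IsNonarchimedeanLocalField E] [Algebra F E] [ValuativeExtension F E]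

theorem continuous_and_isUnramifiedConj (hquad : Module.finrank F E = 2)
    (hunr : IsUnramifiedExtension F E) (σ : E ≃ₐ[F] E) (hσ : σ ≠ AlgEquiv.refl)
    (ϖ : Fˣ) (hϖ : IsUniformizer (ϖ : F)) : Continuous σ ∧ IsUnramifiedConj σ ϖ := by
  have hu := hunr _ hϖ
  have hfin : FiniteDimensional F E := Module.finite_of_finrank_pos (by omega)
  have hc := continuous_algEquiv hfin σ (continuous_algebraMap_of_uniformizer ϖ.ne_zero hu)
  obtain ⟨h1, h2⟩ := conj_involutive_and_fixed hquad hσ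
  exact ⟨hc, h1, h2, fun x hx => map_mem_integer_of_continuous (σ : E →+* E) hc
    uniformizer_ne_zero hu.valuation_lt_one (AlgEquiv.commutes σ _) hx,
    fun _ => algebraMap_mem_integer, hu, hu.valuation_lt_one⟩

theorem IsUnramifiedChar.eq_one {K : Type*} [Field K] [ValuativeRel K] [TopologicalSpace K]
    {ψ : AddChar K Circle} (hψ : IsUnramifiedChar ψ) : ∀ x ∈ 𝒪[K], ψ x = 1 := by
  intro x hx
  have := (hψ.2 1).2 (one_mem _) x hx
  rwa [one_mul] at this

end Main

end HoweU22

end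

theorem proposition2p5
    {F E : Type*} [Field F] [ValuativeRel F] [TopologicalSpace F] [IsNonarchimedeanLocalField F]
    [Field E] [ValuativeRel E] [TopologicalSpace E] [IsNonarchimedeanLocalField E]
    [Algebra F E] [ValuativeExtension F E]
    (hquad : Module.finrank F E = 2) (hunr : HoweU22.IsUnramifiedExtension F E)
    (σ : E ≃ₐ[F] E) (hσ : σ ≠ AlgEquiv.refl)
    (ϖ : Fˣ) (hϖ : HoweU22.IsUniformizer (ϖ : F))
    (ψ : AddChar F Circle) (hψ : HoweU22.IsUnramifiedChar ψ)
    (ψE : AddChar E Circle) (hψE : HoweU22.IsUnramifiedChar ψE)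
    (hψEF : ∀ x : F, ψE (algebraMap F E x) = 1)
    [MeasurableSpace (HoweU22.unipotent σ)] [BorelSpace (HoweU22.unipotent σ)]
    (μ : MeasureTheory.Measure (HoweU22.unipotent σ)) [μ.IsHaarMeasure]
    {V V' : Type*} [AddCommGroup V] [Module ℂ V] [AddCommGroup V'] [Module ℂ V']
    (π : Representation ℂ (HoweU22.U22 σ) V) (π' : Representation ℂ (HoweU22.U22 σ) V')
    (hirr : π.IsIrreducible) (hirr' : π'.IsIrreducible)
    (hsm : HoweU22.IsSmoothRep π) (hsm' : HoweU22.IsSmoothRep π')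
    (ω : Subgroup.center (HoweU22.U22 σ) →* ℂˣ)
    (hω : HoweU22.HasCentralChar π ω) (hω' : HoweU22.HasCentralChar π' ω)
    (ℓ : V →ₗ[ℂ] ℂ) (hℓ : HoweU22.IsWhittakerFunctional ψ ψE π ℓ)
    (ℓ' : V' →ₗ[ℂ] ℂ) (hℓ' : HoweU22.IsWhittakerFunctional ψ ψE π' ℓ')
    (v : V) (hv : HoweU22.whittaker π ℓ v 1 = 1)
    (v' : V') (hv' : HoweU22.whittaker π' ℓ' v' 1 = 1)
    (C : ℕ) (hC : 1 ≤ C)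
    (hvC : ∀ k ∈ HoweU22.congruence σ C, π k v = v)
    (hvC' : ∀ k ∈ HoweU22.congruence σ C, π' k v' = v')
    (w : HoweU22.WeylGroup)
    (a : ℕ → ℕ) (ha0 : a 0 = 0)
    (ha : ∀ t : ℕ, 1 ≤ t → t ≤ HoweU22.weylLength w → t + a (t - 1) ≤ a t)
    (m : ℕ) (hm : 4 ^ a (HoweU22.weylLength w) * C ≤ m) :
    ((∀ w' : HoweU22.WeylGroup, HoweU22.BruhatLT w' w →
        ∀ k : ℕ, 4 ^ a (HoweU22.weylLength w') * C ≤ k → ∀ t ∈ HoweU22.torus σ,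
          HoweU22.whittaker π ℓ (HoweU22.howeVector μ ϖ ψ ψE π v k) (t * HoweU22.weylRep σ w') =
          HoweU22.whittaker π' ℓ' (HoweU22.howeVector μ ϖ ψ ψE π' v' k)
            (t * HoweU22.weylRep σ w')) →
      ∀ t ∈ HoweU22.torus σ, ∀ u ∈ HoweU22.unipotentMinus σ w, u ∉ HoweU22.howeGroup σ ϖ m →
        HoweU22.whittaker π ℓ (HoweU22.howeVector μ ϖ ψ ψE π v m)
          (t * HoweU22.weylRep σ w * u) =
        HoweU22.whittaker π' ℓ' (HoweU22.howeVector μ ϖ ψ ψE π' v' m)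
          (t * HoweU22.weylRep σ w * u)) ∧
    ((∀ w' : HoweU22.WeylGroup, HoweU22.BruhatLE w' w →
        ∀ k : ℕ, 4 ^ a (HoweU22.weylLength w') * C ≤ k → ∀ t ∈ HoweU22.torus σ,
          HoweU22.whittaker π ℓ (HoweU22.howeVector μ ϖ ψ ψE π v k) (t * HoweU22.weylRep σ w') =
          HoweU22.whittaker π' ℓ' (HoweU22.howeVector μ ϖ ψ ψE π' v' k)
            (t * HoweU22.weylRep σ w')) →
      ∀ g ∈ HoweU22.bruhatCell σ w,
        HoweU22.whittaker π ℓ (HoweU22.howeVector μ ϖ ψ ψE π v m) g =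
        HoweU22.whittaker π' ℓ' (HoweU22.howeVector μ ϖ ψ ψE π' v' m) g) := by
  obtain ⟨hc, h⟩ := HoweU22.continuous_and_isUnramifiedConj hquad hunr σ hσ ϖ hϖ
  have := HoweU22.t2Space_of_isNonarchimedeanLocalField E
  have hR := HoweU22.isHoweRelation_whittaker μ h hc hψ.eq_one hψE.eq_one hC hℓ hℓ' hvC hvC'
  obtain ⟨τ, hτ, rfl⟩ := HoweU22.exists_isReducedWord w
  have hmem := HoweU22.mem_reducedWords hτ
  have hlen := HoweU22.weylLength_eq hτ
  rw [hlen] at ha hm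
  refine ⟨fun hyp t ht u hu hum => ?_, fun hyp g hg => ?_⟩
  · refine hR.of_notMem hmem ha (fun τ' hsub hlt k hk t ht => hyp _ ⟨⟨τ, hτ, rfl, τ', hsub, rfl⟩,
      fun heq => ?_⟩ k hk t ht) hm ht hu hum
    exact absurd (hτ τ' heq) (not_le.2 hlt)
  · exact hR.of_bruhatCell _ τ hmem rfl ha (fun τ' hsub k hk t ht =>
      hyp _ ⟨τ, hτ, rfl, τ', hsub, rfl⟩ k hk t ht) m hm g hg
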